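/- Let $n\ge 1$ and let $F\subset \mathrm{Sym}^2(\mathbb R^n)$ be a convex ST-invariant cone subequation: a nonempty closed convex set $F\ne \mathrm{Sym}^2(\mathbb R^n)$ with $F+\{A\ge 0\}\subset F$ and $tF\subset F$ for all $t\ge 0$, invariant under a subgroup of $\mathrm O(n)$ which acts transitively on the unit sphere. Let $$p=p_F=\sup\{\bar p\in\mathbb R:\ P_{e^\perp}-(\bar p-1)P_e\in F\}\qquad(|e|=1)$$ be its Riesz characteristic, where $P_e$ and $P_{e^\perp}=I-P_e$ are the orthogonal projections onto the line $\mathbb Re$ and onto its orthogonal complement. Set $K(t)=t^{2-p}$ if $1\le p<2$, $K(t)=\log t$ if $p=2$ and $K(t)=-t^{-(p-2)}$ if $p>2$ (for $t>0$). Let $u$ be an $F$-subharmonic function (upper semicontinuous with values in $[-\infty,\infty)$, and a subsolution of $D^2u\in F$ in the viscosity sense) on an open neighborhood of $0\in\mathbb R^n$, which is not identically $-\infty$ near $0$. With $S$ the unit sphere, $B$ the closed unit ball and $|S|,|B|$ their surface measure and volume, put $$M(u,r)=\sup_{\sigma\in S}u(r\sigma),\qquad S(u,r)=\frac1{|S|}\int_S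 u(r\sigma)\,d\sigma,\qquad V(u,r)=\frac1{|B|}\int_B u(rx)\,dx ,$$ and for $\Psi=M,S,V$ define the density $$\Theta^\Psi(u)=\lim_{0<s<r\downarrow 0}\frac{\Psi(u,r)-\Psi(u,s)}{K(r)-K(s)} .$$ Let $u_r(x)=r^{p-2}\,(u(rx)-u(0))$ if $p<2$, $u_r(x)=u(rx)-M(u,r)$ if $p=2$, and $u_r(x)=r^{p-2}u(rx)$ if $p>2$. A tangent to $u$ at $0$ is a function $U(x)=\lim_{s\downarrow0}\operatorname{ess\,sup}_{B_s(x)}\overline U$ on $\mathbb R^n$, where $\overline U=\lim_j u_{r_j}$ in $L^1_{\rm loc}(\mathbb R^n)$ for some sequence $r_j\downarrow 0$. (a) If $p\ne 2$, then the densities $\Theta^M(u),\Theta^S(u),\Theta^V(u)$ exist as real numbers, and every tangent $U$ to $u$ at $0$ satisfies, for all $r>0$, $$M(U,r)=\Theta^M(u)K(r),\qquad S(U,r)=\Theta^S(u)K(r),\qquad V(U,r)=\Theta^V(u)K(r).$$ In particular $\Theta^\Psi(U)=\Theta^\Psi(u)$ for $\Psi=M,S,V$. (b) If $p=2$, then the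 densities $\Theta^M(u),\Theta^S(u),\Theta^V(u)$ exist and are equal to one real number $\Theta$, and every tangent $U$ to $u$ at $0$ satisfies $$\Theta^M(U)=\Theta^S(U)=\Theta^V(U)=\Theta .$$ Moreover, $\frac1{|S|}\int_S U$ and $\frac1{|B|}\int_B U$ are finite, and for all $r>0$ $$M(U,r)=\Theta\log r,\qquad S(U,r)=\Theta\log r+\frac1{|S|}\int_S U,\qquad V(U,r)=\Theta\log r+\frac1{|B|}\int_B U ,$$ with $$-C\,\Theta\le \frac1{|S|}\int_S U\le 0,\qquad -(C+1)\,\Theta\le \frac1{|B|}\int_B U,\qquad C=\frac1{\varphi(1/e)}>1,\qquad \varphi(\lambda)=\frac{1-\lambda}{(1+\lambda)^{n-1}} .$$ -/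

import Mathlib

open MeasureTheory Filter Topology Set

namespace Tangents

noncomputable section

/-! ### Subequations -/

/-- A (pure second-order, constant coefficient) cone subequation on `ℝⁿ`: a closed cone `F` of real
symmetric matrices, stable under adding positive semidefinite matrices, neither empty nor the whole
space of symmetric matrices. -/
structure IsConeSubequation {n : ℕ} (F : Set (Matrix (Fin n) (Fin n) ℝ)) : Prop where
  symm : ∀ A ∈ F, A.IsSymm
  closed : IsClosed F
  nonempty : F.Nonempty
  proper : ∃ A : Matrix (Fin n) (Fin n) ℝ, A.IsSymm ∧ A ∉ F
  positivity : ∀ A ∈ F, ∀ P : Matrix (Fin n) (Fin n) ℝ, P.PosSemidef → A + P ∈ F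
  cone : ∀ A ∈ F, ∀ t : ℝ, 0 ≤ t → t • A ∈ F

/-- `F` is invariant under some subgroup of `O(n)` which acts transitively on the unit sphere. -/
def IsSTInvariant {n : ℕ} (F : Set (Matrix (Fin n) (Fin n) ℝ)) : Prop :=
  ∃ G : Subgroup (Matrix.orthogonalGroup (Fin n) ℝ),
    (∀ x y : Fin n → ℝ, x ⬝ᵥ x = 1 → y ⬝ᵥ y = 1 →
      ∃ g ∈ G, Matrix.mulVec (g : Matrix (Fin n) (Fin n) ℝ) x = y) ∧
    ∀ g ∈ G, ∀ A ∈ F,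
      (g : Matrix (Fin n) (Fin n) ℝ) * A * (g : Matrix (Fin n) (Fin n) ℝ).transpose ∈ F

/-- The orthogonal projection `P_e` onto the line spanned by a unit vector `e`. -/
def lineProj {n : ℕ} (e : Fin n → ℝ) : Matrix (Fin n) (Fin n) ℝ :=
  Matrix.vecMulVec e e

/-- The (increasing) Riesz characteristic
`p_F = sup {p : P_{e^⊥} - (p - 1) P_e ∈ F}`, with `P_{e^⊥} = I - P_e`. For an ST-invariant `F` the
condition does not depend on the unit vector `e`. For a convex ST-invariant cone subequation the
set contains `1` and is bounded above by `n`, so that the real supremum is genuine. -/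
def rieszChar {n : ℕ} (F : Set (Matrix (Fin n) (Fin n) ℝ)) : ℝ :=
  sSup {p : ℝ | ∀ e : Fin n → ℝ, e ⬝ᵥ e = 1 →
    (1 - lineProj e) - (p - 1) • lineProj e ∈ F}

/-- The Riesz kernel `K_p(t)`, `t > 0`. -/
def rieszK (p t : ℝ) : ℝ :=
  if p < 2 then t ^ (2 - p) else if p = 2 then Real.log t else -(1 / t ^ (p - 2))

/-! ### Subharmonic functions, in the viscosity sense -/

/-- The Hessian matrix of `φ` at `x`. -/
def hessian {n : ℕ} (φ : EuclideanSpace ℝ (Fin n) → ℝ) (x : EuclideanSpace ℝ (Fin n)) :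
    Matrix (Fin n) (Fin n) ℝ :=
  Matrix.of fun i j =>
    fderiv ℝ (fderiv ℝ φ) x (EuclideanSpace.single i 1) (EuclideanSpace.single j 1)

/-- `u` is `F`-subharmonic on `X`: it is upper semicontinuous there with values in `[-∞, ∞)`, and
every `C²` test function touching `u` from above at a point of `X` has its Hessian in `F`. -/
structure IsSubharmonicOn {n : ℕ} (F : Set (Matrix (Fin n) (Fin n) ℝ))
    (u : EuclideanSpace ℝ (Fin n) → EReal) (X : Set (EuclideanSpace ℝ (Fin n))) : Prop where
  usc : UpperSemicontinuousOn u X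
  ne_top : ∀ x ∈ X, u x ≠ ⊤
  viscosity : ∀ x₀ ∈ X, ∀ φ : EuclideanSpace ℝ (Fin n) → ℝ, ContDiffAt ℝ 2 φ x₀ →
    (∀ᶠ x in 𝓝 x₀, u x ≤ (φ x : EReal)) → u x₀ = (φ x₀ : EReal) → hessian φ x₀ ∈ F

/-! ### Averages -/

/-- The average of an extended-real valued function with respect to a finite nonzero measure, as
(average of the positive part) - (average of the negative part) in `[-∞, ∞]`. -/
def eAverage {α : Type*} [MeasurableSpace α] (μ : Measure α) (f : α → EReal) : EReal :=
  (((μ univ)⁻¹ * ∫⁻ x, (f x).toENNReal ∂μ : ENNReal) : EReal)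
    - (((μ univ)⁻¹ * ∫⁻ x, (-f x).toENNReal ∂μ : ENNReal) : EReal)

/-- `M(u, r)`, the maximum over the sphere of radius `r`. -/
def sphereMax {n : ℕ} (u : EuclideanSpace ℝ (Fin n) → EReal) (r : ℝ) : EReal :=
  ⨆ σ ∈ Metric.sphere (0 : EuclideanSpace ℝ (Fin n)) 1, u (r • σ)

/-- `S(u, r)`, the spherical average: `Measure.toSphere volume` is the surface measure of the unit
sphere. -/
def sphereMean {n : ℕ} (u : EuclideanSpace ℝ (Fin n) → EReal) (r : ℝ) : EReal :=
  eAverage (Measure.toSphere (volume : Measure (EuclideanSpace ℝ (Fin n))))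
    fun σ => u (r • (σ : EuclideanSpace ℝ (Fin n)))

/-- `V(u, r)`, the volume average. -/
def ballMean {n : ℕ} (u : EuclideanSpace ℝ (Fin n) → EReal) (r : ℝ) : EReal :=
  eAverage (volume.restrict (Metric.closedBall (0 : EuclideanSpace ℝ (Fin n)) 1))
    fun x => u (r • x)

/-- `ψ` has density `Θ ∈ ℝ` at `0` with respect to `K_p`:
`(ψ(r) - ψ(s)) / (K_p(r) - K_p(s)) → Θ` as `0 < s < r ↓ 0`. -/
def HasDensity (p : ℝ) (ψ : ℝ → EReal) (Θ : ℝ) : Prop :=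
  Tendsto (fun q : ℝ × ℝ =>
      (ψ q.1 - ψ q.2) / ((rieszK p q.1 - rieszK p q.2 : ℝ) : EReal))
    ((𝓝[>] (0 : ℝ) ×ˢ 𝓝[>] (0 : ℝ)) ⊓ 𝓟 {q : ℝ × ℝ | q.2 < q.1}) (𝓝 (Θ : EReal))

/-! ### Tangents -/

/-- The tangential `p`-flow `u_r`. -/
def flow {n : ℕ} (p : ℝ) (u : EuclideanSpace ℝ (Fin n) → EReal) (r : ℝ)
    (x : EuclideanSpace ℝ (Fin n)) : EReal :=
  if p < 2 then ((1 / r ^ (2 - p) : ℝ) : EReal) * (u (r • x) - u 0)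
  else if p = 2 then u (r • x) - sphereMax u r
  else ((r ^ (p - 2) : ℝ) : EReal) * u (r • x)

/-- `U` is a tangent to `u` at `0`: for some `r_j ↓ 0` the functions `u_{r_j}` converge in
`L¹_loc(ℝⁿ)` to some `V`, and `U(x) = lim_{r → 0} ess sup_{B_r(x)} V` at every point `x`. -/
def IsTangent {n : ℕ} (p : ℝ) (u U : EuclideanSpace ℝ (Fin n) → EReal) : Prop :=
  ∃ (r : ℕ → ℝ) (V : EuclideanSpace ℝ (Fin n) → ℝ),
    Tendsto r atTop (𝓝[>] (0 : ℝ)) ∧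
    LocallyIntegrable V volume ∧
    (∀ R : ℝ, 0 < R →
      Tendsto (fun j => ∫⁻ x in Metric.closedBall (0 : EuclideanSpace ℝ (Fin n)) R,
        (flow p u (r j) x - (V x : EReal)).abs) atTop (𝓝 0)) ∧
    ∀ x, Tendsto (fun s : ℝ => essSup (fun y => (V y : EReal))
      (volume.restrict (Metric.closedBall x s))) (𝓝[>] (0 : ℝ)) (𝓝 (U x))

/-- `φ(λ) = (1 - λ) / (1 + λ)^(n-1)`, the constant in Harnack's inequality on `ℝⁿ`; the exponent
`n - 1` is taken in `ℤ`. -/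
def harnackφ (n : ℕ) (l : ℝ) : ℝ :=
  (1 - l) / (1 + l) ^ ((n : ℤ) - 1)

/-- `C = 1 / φ(1/e)`. -/
def harnackC (n : ℕ) : ℝ :=
  1 / harnackφ n (1 / Real.exp 1)

end

end Tangents

namespace Tangents

/-! ### Hessians -/

/-! Everything rests on two facts about the pair `F`, `K`. First, the Hessian of `K(|x|)` at `x ≠ 0`
is a positive multiple of `P_{e^⊥} - (p-1) P_e` with `e = x/|x|`. By the definition of `p` as a
supremum, an arbitrarily small concave quadratic perturbation of `a + b K(|x|)`, `b ≥ 0`, has its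
Hessian outside `F`, so such functions dominate `F`-subharmonic functions on an annulus once they do
so on its boundary (`IsSubharmonicOn.le_add_mul_rieszK`). Consequently the spherical maximum is
nondecreasing and convex as a function of `K(r)` (`IsSubharmonicOn.isRieszConvex_sphereMax`), its
chordal slopes are monotone, and their infimum is the density
(`IsRieszConvex.exists_hasRealDensity`).

Second, convexity and invariance force every matrix of `F` to have nonnegative trace
(`IsConeSubequation.trace_nonneg`). So an `F`-subharmonic function is classically subharmonic, and
the Poisson, mean value and Harnack inequalities hold; they are proved here directly from the
viscosity definition. To keep integrals meaningful without integrability assumptions, a function `u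
≤ c` is replaced by its reflection `c - u` with values in `[0, ∞]`.

The spherical mean, viewed as a radial function, is again `F`-subharmonic
(`IsSubharmonicOn.sphMean`): it is an average of rotations of `u` over the compact stabilizer of `F`
in the orthogonal group. If a test function violated the conclusion, its Hessian could be separated
from `F` by a positive definite matrix, and the mean value inequality over small ellipsoids adapted
to that matrix would give a contradiction. Hence the spherical mean is `K`-convex as well. The
volume mean is the average of the spherical means at radii `r|y|`, and since `K(r|y|) - K(s|y|) =
|y|^(2-p) (K(r) - K(s))` its density is that of the spherical mean times the average of `|y|^(2-p)`
over the unit ball.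

For tangents, a density together with the scaling of `K` determines the limits of the rescaled
maxima and means. These limits must be transferred through `L¹` convergence to the pointwise
representative `U` (`IsLocalSubharmonic.tangent_means`). Ball averages of a fixed radius converge
uniformly on compact sets; the mean value inequality compares them with the functions themselves,
monotonicity in the radius gives the opposite bounds, and letting the averaging radius tend to zero
closes the gap.

When `p = 2`, Harnack's inequality bounds `M(r) - S(r)` by `C (M(r) - M(r/e))`, and the last
difference tends to `Θ` because `log (1/e) = -1`. This bounded gap forces the two densities to
agree. A subsequential limit of `S - M` along the blow-up radii is the mean of `U` over the unit
sphere, and it lies in `[-CΘ, 0]`. The mean of `log |y|` over the unit ball is `-1/n`, which yields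
the volume statement. -/

lemma hessian_eq_of_hasFDerivAt {n : ℕ} {φ : EuclideanSpace ℝ (Fin n) → ℝ}
    {φ₁ : EuclideanSpace ℝ (Fin n) → EuclideanSpace ℝ (Fin n) →L[ℝ] ℝ}
    {φ₂ : EuclideanSpace ℝ (Fin n) →L[ℝ] EuclideanSpace ℝ (Fin n) →L[ℝ] ℝ}
    {x : EuclideanSpace ℝ (Fin n)}
    (h₁ : ∀ᶠ y in 𝓝 x, HasFDerivAt φ (φ₁ y) y) (h₂ : HasFDerivAt φ₁ φ₂ x) :
    hessian φ x = Matrix.of fun i j =>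
      φ₂ (EuclideanSpace.single i 1) (EuclideanSpace.single j 1) := by
  have : fderiv ℝ φ =ᶠ[𝓝 x] φ₁ := h₁.mono fun y hy => hy.fderiv
  unfold hessian
  rw [this.fderiv_eq, h₂.fderiv]

lemma contDiffAt_two_hasFDerivAt {E : Type*} [NormedAddCommGroup E] [NormedSpace ℝ E]
    {φ : E → ℝ} {x : E} (h : ContDiffAt ℝ 2 φ x) :
    (∀ᶠ y in 𝓝 x, HasFDerivAt φ (fderiv ℝ φ y) y) ∧
      HasFDerivAt (fderiv ℝ φ) (fderiv ℝ (fderiv ℝ φ) x) x := by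
  constructor
  · filter_upwards [h.eventually (by simp)] with y hy
    exact (hy.differentiableAt (by norm_num)).hasFDerivAt
  · exact ((h.fderiv_right (m := 1) (by norm_num)).differentiableAt (by norm_num)).hasFDerivAt

lemma sum_single_eq {n : ℕ} (v : EuclideanSpace ℝ (Fin n)) :
    v = ∑ i, v i • (EuclideanSpace.single i 1 : EuclideanSpace ℝ (Fin n)) := by
  ext j
  simp [Finset.sum_apply, Pi.single_apply]

lemma dotProduct_hessian {n : ℕ} (φ : EuclideanSpace ℝ (Fin n) → ℝ)
    (x v w : EuclideanSpace ℝ (Fin n)) :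
    v.ofLp ⬝ᵥ (hessian φ x).mulVec w.ofLp = fderiv ℝ (fderiv ℝ φ) x v w := by
  conv_rhs => rw [sum_single_eq v, sum_single_eq w]
  simp only [map_sum, map_smul, _root_.sum_apply, _root_.smul_apply,
    smul_eq_mul, dotProduct, Matrix.mulVec, hessian, Matrix.of_apply, Finset.mul_sum]
  rw [Finset.sum_comm]
  refine Finset.sum_congr rfl fun i _ => Finset.sum_congr rfl fun j _ => ?_
  ring

lemma hessian_isSymm {n : ℕ} {φ : EuclideanSpace ℝ (Fin n) → ℝ} {x : EuclideanSpace ℝ (Fin n)}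
    (h : ContDiffAt ℝ 2 φ x) : (hessian φ x).IsSymm := by
  ext i j
  exact (h.isSymmSndFDerivAt (by simp)) _ _

lemma hessian_add {n : ℕ} {φ ψ : EuclideanSpace ℝ (Fin n) → ℝ} {x : EuclideanSpace ℝ (Fin n)}
    (h : ContDiffAt ℝ 2 φ x) (h' : ContDiffAt ℝ 2 ψ x) :
    hessian (fun y => φ y + ψ y) x = hessian φ x + hessian ψ x := by
  obtain ⟨a, b⟩ := contDiffAt_two_hasFDerivAt h
  obtain ⟨c, d⟩ := contDiffAt_two_hasFDerivAt h'
  rw [hessian_eq_of_hasFDerivAt (φ₁ := fun y => fderiv ℝ φ y + fderiv ℝ ψ y)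
    (by filter_upwards [a, c] with y h1 h2 using h1.add h2) (b.add d)]
  rfl

lemma hessian_const_mul {n : ℕ} {φ : EuclideanSpace ℝ (Fin n) → ℝ}
    {x : EuclideanSpace ℝ (Fin n)} (h : ContDiffAt ℝ 2 φ x) (c : ℝ) :
    hessian (fun y => c * φ y) x = c • hessian φ x := by
  obtain ⟨a, b⟩ := contDiffAt_two_hasFDerivAt h
  rw [hessian_eq_of_hasFDerivAt (φ₁ := fun y => c • fderiv ℝ φ y)
    (by filter_upwards [a] with y h1 using h1.const_mul c) (b.const_smul c)]
  rfl

lemma hessian_neg {n : ℕ} {φ : EuclideanSpace ℝ (Fin n) → ℝ}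
    {x : EuclideanSpace ℝ (Fin n)} (h : ContDiffAt ℝ 2 φ x) :
    hessian (fun y => - φ y) x = - hessian φ x := by
  simpa using hessian_const_mul h (-1)

lemma hessian_const {n : ℕ} (c : ℝ) (x : EuclideanSpace ℝ (Fin n)) :
    hessian (fun _ => c) x = 0 := by
  ext i j
  simp [hessian]

lemma hessian_comp_affine {n : ℕ} {φ : EuclideanSpace ℝ (Fin n) → ℝ}
    (L : EuclideanSpace ℝ (Fin n) →L[ℝ] EuclideanSpace ℝ (Fin n)) (b : EuclideanSpace ℝ (Fin n))
    {x : EuclideanSpace ℝ (Fin n)} (h : ContDiffAt ℝ 2 φ (L x + b)) :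
    hessian (fun y => φ (L y + b)) x = Matrix.of fun i j =>
      fderiv ℝ (fderiv ℝ φ) (L x + b) (L (EuclideanSpace.single i 1))
        (L (EuclideanSpace.single j 1)) := by
  obtain ⟨h1, h2⟩ := contDiffAt_two_hasFDerivAt h
  have hL : ∀ y, HasFDerivAt (fun y => L y + b) L y := fun y => L.hasFDerivAt.add_const b
  rw [hessian_eq_of_hasFDerivAt (φ₁ := fun y => (fderiv ℝ φ (L y + b)).comp L)
    (φ₂ := (ContinuousLinearMap.compL ℝ (EuclideanSpace ℝ (Fin n)) (EuclideanSpace ℝ (Fin n))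
      ℝ).flip L ∘L ((fderiv ℝ (fderiv ℝ φ) (L x + b)).comp L))]
  · rfl
  · have : Tendsto (fun y => L y + b) (𝓝 x) (𝓝 (L x + b)) := (hL x).continuousAt
    filter_upwards [this.eventually h1] with y hy
    exact hy.comp y (hL y)
  · exact (((ContinuousLinearMap.compL ℝ (EuclideanSpace ℝ (Fin n)) (EuclideanSpace ℝ (Fin n))
      ℝ).flip L).hasFDerivAt).comp x (h2.comp x (hL x))

lemma hessian_comp_add {n : ℕ} {φ : EuclideanSpace ℝ (Fin n) → ℝ} (b : EuclideanSpace ℝ (Fin n))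
    {x : EuclideanSpace ℝ (Fin n)} (h : ContDiffAt ℝ 2 φ (x + b)) :
    hessian (fun y => φ (y + b)) x = hessian φ (x + b) :=
  hessian_comp_affine (ContinuousLinearMap.id ℝ _) b h

lemma hessian_radial {n : ℕ} {g g₁ : ℝ → ℝ} {g₂ : ℝ} {x : EuclideanSpace ℝ (Fin n)}
    (h₁ : ∀ᶠ t in 𝓝 (‖x‖ ^ 2), HasDerivAt g (g₁ t) t) (h₂ : HasDerivAt g₁ g₂ (‖x‖ ^ 2)) :
    hessian (fun y => g (‖y‖ ^ 2)) x =
      (4 * g₂) • Matrix.vecMulVec x.ofLp x.ofLp + (2 * g₁ (‖x‖ ^ 2)) • 1 := by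
  have hq : ∀ y : EuclideanSpace ℝ (Fin n),
      HasFDerivAt (fun y : EuclideanSpace ℝ (Fin n) => ‖y‖ ^ 2) (2 • innerSL ℝ y) y := fun y =>
    (hasStrictFDerivAt_norm_sq y).hasFDerivAt
  rw [hessian_eq_of_hasFDerivAt (φ₁ := fun y => g₁ (‖y‖ ^ 2) • (2 • innerSL ℝ y))
    (φ₂ := g₁ (‖x‖ ^ 2) • (2 • innerSL ℝ) + (g₂ • (2 • innerSL ℝ x)).smulRight (2 • innerSL ℝ x))]
  · ext i j
    have h1 : innerSL ℝ (EuclideanSpace.single i (1 : ℝ)) (EuclideanSpace.single j (1 : ℝ)) =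
        if i = j then 1 else 0 := by
      rw [innerSL_apply_apply, EuclideanSpace.inner_single_left]
      simp [PiLp.single_apply]
    simp [Matrix.vecMulVec_apply, Matrix.one_apply, EuclideanSpace.inner_single_right, h1]
    split_ifs <;> ring
  · filter_upwards [(hq x).continuousAt.tendsto.eventually h₁] with y hy
    exact hy.comp_hasFDerivAt y (hq y)
  · exact (h₂.comp_hasFDerivAt x (hq x)).smul ((2 • innerSL ℝ :
      EuclideanSpace ℝ (Fin n) →L[ℝ] EuclideanSpace ℝ (Fin n) →L[ℝ] ℝ).hasFDerivAt (x := x))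

lemma hessian_norm_sq {n : ℕ} (x : EuclideanSpace ℝ (Fin n)) :
    hessian (fun y => ‖y‖ ^ 2) x = (2 : ℝ) • 1 := by
  have := hessian_radial (x := x) (g := fun t => t) (g₁ := fun _ => 1) (g₂ := 0)
    (Eventually.of_forall fun t => hasDerivAt_id t) (hasDerivAt_const _ _)
  simpa using this

/-- The second derivative test at a local minimum. -/
lemma deriv_deriv_nonneg_of_isLocalMin {f : ℝ → ℝ} {a : ℝ} (h : IsLocalMin f a)
    (hc : ContinuousAt f a) : 0 ≤ deriv (deriv f) a := by
  by_contra! hneg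
  -- A negative second derivative would make `a` a local maximum too; then `f` is locally constant
  -- and its second derivative vanishes.
  have hmax := isLocalMax_of_deriv_deriv_neg hneg h.deriv_eq_zero hc
  have hconst : f =ᶠ[𝓝 a] fun _ => f a := by
    filter_upwards [h, hmax] with y h1 h2 using le_antisymm h2 h1
  have : deriv f =ᶠ[𝓝 a] fun _ => 0 := by
    filter_upwards [hconst.eventuallyEq_nhds] with y hy
    rw [hy.deriv_eq]; simp
  rw [this.deriv_eq] at hneg
  simp at hneg

/-- Restriction to the line through `x` in direction `v` reduces this to one variable. -/
lemma snd_fderiv_nonneg_of_isLocalMin {E : Type*} [NormedAddCommGroup E] [NormedSpace ℝ E]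
    {f : E → ℝ} {x : E} (hf : ContDiffAt ℝ 2 f x) (h : IsLocalMin f x) (v : E) :
    0 ≤ fderiv ℝ (fderiv ℝ f) x v v := by
  obtain ⟨h1, h2⟩ := contDiffAt_two_hasFDerivAt hf
  set c : ℝ → E := fun t => x + t • v
  have hc : ∀ t, HasDerivAt c v t := fun t => by
    simpa [c] using ((hasDerivAt_id t).smul_const v).const_add x
  have hc0 : c 0 = x := by simp [c]
  have hct : Tendsto c (𝓝 0) (𝓝 x) := by simpa [hc0] using (hc 0).continuousAt.tendsto
  have hd : deriv (f ∘ c) =ᶠ[𝓝 0] fun t => fderiv ℝ f (c t) v := by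
    filter_upwards [hct.eventually h1] with t ht
    exact (ht.comp_hasDerivAt t (hc t)).deriv
  have hmin : IsLocalMin (f ∘ c) 0 := by
    have := hct.eventually h
    simpa [IsLocalMin, IsMinFilter, hc0] using this
  have hdd : deriv (deriv (f ∘ c)) 0 = fderiv ℝ (fderiv ℝ f) x v v := by
    rw [hd.deriv_eq]
    have h2' : HasFDerivAt (fderiv ℝ f) (fderiv ℝ (fderiv ℝ f) x) (c 0) := by rwa [hc0]
    have := (h2'.comp_hasDerivAt (0 : ℝ) (hc 0)).clm_apply (hasDerivAt_const (0 : ℝ) v)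
    simpa using this.deriv
  rw [← hdd]
  refine deriv_deriv_nonneg_of_isLocalMin hmin ?_
  have hfc : ContinuousAt f (c 0) := by rw [hc0]; exact hf.continuousAt
  exact hfc.comp (hc 0).continuousAt

lemma trace_hessian_eq {n : ℕ} (φ : EuclideanSpace ℝ (Fin n) → ℝ) (x : EuclideanSpace ℝ (Fin n)) :
    (hessian φ x).trace = ∑ i, fderiv ℝ (fderiv ℝ φ) x (EuclideanSpace.single i 1)
      (EuclideanSpace.single i 1) := rfl

lemma continuousAt_trace_hessian {n : ℕ} {φ : EuclideanSpace ℝ (Fin n) → ℝ}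
    {x : EuclideanSpace ℝ (Fin n)} (h : ContDiffAt ℝ 2 φ x) :
    ContinuousAt (fun y => (hessian φ y).trace) x := by
  simp only [trace_hessian_eq]
  have : ContinuousAt (fderiv ℝ (fderiv ℝ φ)) x :=
    ((h.fderiv_right (m := 1) (by norm_num)).fderiv_right (m := 0) (by norm_num)).continuousAt
  exact tendsto_finsetSum _ fun i _ =>
    (this.clm_apply continuousAt_const).clm_apply continuousAt_const

/-! ### Subharmonic functions -/

lemma IsSubharmonicOn.mono {n : ℕ} {F F' : Set (Matrix (Fin n) (Fin n) ℝ)}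
    {u : EuclideanSpace ℝ (Fin n) → EReal} {X X' : Set (EuclideanSpace ℝ (Fin n))}
    (h : IsSubharmonicOn F u X) (hF : F ⊆ F') (hX : X' ⊆ X) : IsSubharmonicOn F' u X' :=
  ⟨h.usc.mono hX, fun x hx => h.ne_top x (hX hx),
    fun x hx φ hφ h1 h2 => hF (h.viscosity x (hX hx) φ hφ h1 h2)⟩

/-- A strict supersolution bounds a subharmonic function if it does so off an open set. -/
lemma IsSubharmonicOn.le_of_hessian_notMem {n : ℕ} {F : Set (Matrix (Fin n) (Fin n) ℝ)}
    {u : EuclideanSpace ℝ (Fin n) → EReal} {X K O : Set (EuclideanSpace ℝ (Fin n))}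
    (h : IsSubharmonicOn F u X) (hK : IsCompact K) (hKX : K ⊆ X) (hO : IsOpen O) (hOK : O ⊆ K)
    {φ : EuclideanSpace ℝ (Fin n) → ℝ} (hφc : ContinuousOn φ K)
    (hφ : ∀ x ∈ O, ContDiffAt ℝ 2 φ x) (hφF : ∀ x ∈ O, hessian φ x ∉ F)
    (hb : ∀ x ∈ K, x ∉ O → u x ≤ (φ x : EReal)) : ∀ x ∈ K, u x ≤ (φ x : EReal) := by
  intro x hx
  by_contra! hlt
  -- The difference `u - φ` is written as a sum with a real second summand, where addition of
  -- extended reals is continuous; this makes `d` upper semicontinuous.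
  set d : EuclideanSpace ℝ (Fin n) → EReal := fun y => u y + ((-φ y : ℝ) : EReal) with hd
  have husc : UpperSemicontinuousOn d K := by
    intro y hy
    refine UpperSemicontinuousWithinAt.add' (h.usc.mono hKX y hy)
      (g := fun y => ((-φ y : ℝ) : EReal)) ?_ ?_
    · exact ((continuous_coe_real_ereal.continuousAt.comp_continuousWithinAt
        (hφc y hy).neg)).upperSemicontinuousWithinAt
    · exact EReal.continuousAt_add (Or.inr (EReal.coe_ne_bot _)) (Or.inr (EReal.coe_ne_top _))
  obtain ⟨y, hyK, hy⟩ := husc.exists_isMaxOn ⟨x, hx⟩ hK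
  have hdx : 0 < d x := by
    have : ((φ x : ℝ) : EReal) + ((-φ x : ℝ) : EReal) < u x + ((-φ x : ℝ) : EReal) :=
      EReal.add_lt_add_right_coe hlt _
    rw [← EReal.coe_add, add_neg_cancel] at this
    exact this
  have hdy : 0 < d y := hdx.trans_le (hy hx)
  have hyt := h.ne_top y (hKX hyK)
  have hyb : u y ≠ ⊥ := by
    intro hb; simp [hd, hb] at hdy
  obtain ⟨a, ha⟩ : ∃ a : ℝ, u y = a := ⟨_, (EReal.coe_toReal hyt hyb).symm⟩
  have hpos : 0 < a - φ y := by
    simp only [hd, ha, ← EReal.coe_add] at hdy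
    have := EReal.coe_pos.1 hdy
    linarith
  have hyO : y ∈ O := by
    by_contra hno
    have := hb y hyK hno
    rw [ha, EReal.coe_le_coe_iff] at this
    linarith
  refine hφF y hyO ?_
  have hc2 := hφ y hyO
  -- At a maximum point `y` of `u - φ`, the vertical translate of `φ` through the graph of `u` is a
  -- test function with the same Hessian as `φ`.
  have := h.viscosity y (hKX hyK) (fun z => φ z + (a - φ y)) (hc2.add contDiffAt_const) ?_
    (by rw [ha]; congr 1; ring)
  · rwa [hessian_add hc2 contDiffAt_const, hessian_const, add_zero] at this
  · filter_upwards [hO.mem_nhds hyO] with z hz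
    have h1 : d z ≤ d y := hy (hOK hz)
    simp only [hd, ha, ← EReal.coe_add] at h1
    have h2 : d z + (φ z : EReal) ≤ ((a + -φ y : ℝ) : EReal) + (φ z : EReal) := by gcongr
    have h3 : d z + (φ z : EReal) = u z := by
      simp only [hd]
      rw [add_assoc, ← EReal.coe_add]; simp
    rw [h3, ← EReal.coe_add] at h2
    refine h2.trans (le_of_eq ?_)
    congr 1; ring

/-- A `C²` function with non-negative Laplacian is subharmonic in the viscosity sense. -/
lemma isSubharmonicOn_of_trace_nonneg {n : ℕ} {h : EuclideanSpace ℝ (Fin n) → ℝ}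
    {X : Set (EuclideanSpace ℝ (Fin n))} (hh : ∀ x ∈ X, ContDiffAt ℝ 2 h x)
    (htr : ∀ x ∈ X, 0 ≤ (hessian h x).trace) :
    IsSubharmonicOn {A | 0 ≤ A.trace} (fun x => (h x : EReal)) X where
  usc := fun x hx => (continuous_coe_real_ereal.continuousAt.comp
    (hh x hx).continuousAt).continuousWithinAt.upperSemicontinuousWithinAt
  ne_top := fun x _ => EReal.coe_ne_top _
  viscosity := by
    intro x hx φ hφ hle heq
    have h1 : hessian (fun y => φ y + (- h y)) x = hessian φ x + - hessian h x := by
      rw [hessian_add hφ (hh x hx).neg, hessian_neg (hh x hx)]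
    have hmin : IsLocalMin (fun y => φ y + (- h y)) x := by
      filter_upwards [hle] with y hy
      have := EReal.coe_le_coe_iff.1 hy
      have := EReal.coe_eq_coe_iff.1 heq
      linarith
    have h2 : 0 ≤ (hessian (fun y => φ y + (- h y)) x).trace := by
      rw [trace_hessian_eq]
      exact Finset.sum_nonneg fun i _ =>
        snd_fderiv_nonneg_of_isLocalMin (hφ.add (hh x hx).neg) hmin _
    rw [h1, Matrix.trace_add, Matrix.trace_neg] at h2
    have := htr x hx
    simp only [mem_ofPred_eq]
    linarith

/-! ### Cone subequations -/

/-- The sum of the absolute values of the entries dominates the quadratic form on unit vectors. This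
is used to show that a cone containing a negative multiple of the identity would contain all
symmetric matrices. -/
lemma posSemidef_add_smul_one {n : ℕ} {A : Matrix (Fin n) (Fin n) ℝ} (hA : A.IsSymm) :
    ∃ t : ℝ, 0 ≤ t ∧ (A + t • 1).PosSemidef := by
  refine ⟨∑ i, ∑ j, |A i j|, by positivity, Matrix.PosSemidef.of_dotProduct_mulVec_nonneg ?_ ?_⟩
  · have : (A + (∑ i, ∑ j, |A i j|) • (1 : Matrix (Fin n) (Fin n) ℝ)).IsSymm := by
      rw [Matrix.IsSymm, Matrix.transpose_add, Matrix.transpose_smul, Matrix.transpose_one, hA.eq]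
    rwa [Matrix.IsHermitian, Matrix.conjTranspose_eq_transpose_of_trivial]
  · intro x
    have h1 : ∀ i j, |x i * A i j * x j| ≤ |A i j| * (x ⬝ᵥ x) := by
      intro i j
      have hk : ∀ k, x k ^ 2 ≤ x ⬝ᵥ x := fun k => by
        rw [dotProduct, sq]
        exact Finset.single_le_sum (f := fun k => x k * x k) (fun k _ => mul_self_nonneg _)
          (Finset.mem_univ k)
      have : |x i| * |x j| ≤ x ⬝ᵥ x := by
        have := hk i
        have := hk j
        rw [← sq_abs] at *
        nlinarith [sq_nonneg (|x i| - |x j|), sq_abs (x i), sq_abs (x j)]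
      calc |x i * A i j * x j| = |A i j| * (|x i| * |x j|) := by rw [abs_mul, abs_mul]; ring
        _ ≤ _ := by gcongr
    have h2 : x ⬝ᵥ A.mulVec x = ∑ i, ∑ j, x i * A i j * x j := by
      simp only [dotProduct, Matrix.mulVec, Finset.mul_sum, mul_assoc]
    have h3 : -(∑ i, ∑ j, |A i j|) * (x ⬝ᵥ x) ≤ x ⬝ᵥ A.mulVec x := by
      rw [h2, ← Finset.sum_neg_distrib, Finset.sum_mul]
      refine Finset.sum_le_sum fun i _ => ?_
      rw [← Finset.sum_neg_distrib, Finset.sum_mul]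
      refine Finset.sum_le_sum fun j _ => ?_
      rw [neg_mul]
      exact (abs_le.1 (h1 i j)).1
    rw [star_trivial, Matrix.add_mulVec, dotProduct_add, Matrix.smul_mulVec, Matrix.one_mulVec,
      dotProduct_smul, smul_eq_mul]
    linarith

lemma lineProj_mulVec {n : ℕ} (e x : Fin n → ℝ) :
    (lineProj e).mulVec x = (e ⬝ᵥ x) • e := by
  ext i
  simp only [lineProj, Matrix.vecMulVec_apply, Matrix.mulVec, dotProduct, Finset.sum_mul,
    Pi.smul_apply, smul_eq_mul]
  exact Finset.sum_congr rfl fun j _ => by ring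

lemma trace_lineProj {n : ℕ} (e : Fin n → ℝ) : (lineProj e).trace = e ⬝ᵥ e := by
  simp [lineProj, Matrix.trace_vecMulVec]

lemma posSemidef_lineProj {n : ℕ} (e : Fin n → ℝ) : (lineProj e).PosSemidef := by
  simpa [lineProj] using Matrix.posSemidef_vecMulVec_self_star e

lemma posSemidef_one_sub_lineProj {n : ℕ} {e : Fin n → ℝ} (he : e ⬝ᵥ e = 1) :
    (1 - lineProj e).PosSemidef := by
  refine Matrix.PosSemidef.of_dotProduct_mulVec_nonneg
    (Matrix.isHermitian_one.sub (posSemidef_lineProj e).1) fun x => ?_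
  rw [star_trivial, Matrix.sub_mulVec, Matrix.one_mulVec, lineProj_mulVec, dotProduct_sub,
    dotProduct_smul, smul_eq_mul]
  have : 0 ≤ (x - (e ⬝ᵥ x) • e) ⬝ᵥ (x - (e ⬝ᵥ x) • e) := by
    simpa using dotProduct_star_self_nonneg (x - (e ⬝ᵥ x) • e)
  simp only [sub_dotProduct, dotProduct_sub, dotProduct_smul, smul_dotProduct, smul_eq_mul, he,
    dotProduct_comm x e] at this ⊢
  linarith

namespace IsConeSubequation

variable {n : ℕ} {F : Set (Matrix (Fin n) (Fin n) ℝ)}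

lemma zero_mem (hF : IsConeSubequation F) : (0 : Matrix (Fin n) (Fin n) ℝ) ∈ F := by
  obtain ⟨A, hA⟩ := hF.nonempty
  simpa using hF.cone A hA 0 le_rfl

lemma mem_of_posSemidef (hF : IsConeSubequation F) {P : Matrix (Fin n) (Fin n) ℝ}
    (hP : P.PosSemidef) : P ∈ F := by
  simpa using hF.positivity 0 hF.zero_mem P hP

/-- Otherwise every symmetric `A = -t I + (A + t I)`, with `t` large, would lie in `F` by the cone
property and positivity, against properness. -/
lemma neg_one_notMem (hF : IsConeSubequation F) : (-1 : Matrix (Fin n) (Fin n) ℝ) ∉ F := by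
  intro h
  obtain ⟨A, hA, hAF⟩ := hF.proper
  obtain ⟨t, ht, hP⟩ := posSemidef_add_smul_one hA
  apply hAF
  have := hF.positivity _ (hF.cone _ h t ht) _ hP
  simpa using this

lemma smul_one_notMem (hF : IsConeSubequation F) {c : ℝ} (hc : c < 0) :
    c • (1 : Matrix (Fin n) (Fin n) ℝ) ∉ F := by
  intro h
  apply hF.neg_one_notMem
  have := hF.cone _ h (-c)⁻¹ (by have : 0 < -c := by linarith
                                 positivity)
  rw [smul_smul] at this
  rwa [show (-c)⁻¹ * c = -1 by rw [inv_neg, neg_mul, inv_mul_cancel₀ hc.ne], neg_one_smul] at this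

lemma dim_ne_zero (hF : IsConeSubequation F) : n ≠ 0 := by
  rintro rfl
  apply hF.neg_one_notMem
  rw [Subsingleton.elim (-1 : Matrix (Fin 0) (Fin 0) ℝ) 0]
  exact hF.zero_mem

lemma add_mem (hF : IsConeSubequation F) (hconv : Convex ℝ F) {A B : Matrix (Fin n) (Fin n) ℝ}
    (hA : A ∈ F) (hB : B ∈ F) : A + B ∈ F := by
  have := hF.cone _ (hconv hA hB (a := 1 / 2) (b := 1 / 2) (by norm_num) (by norm_num)
    (by norm_num)) 2 (by norm_num)
  rwa [smul_add, smul_smul, smul_smul, mul_one_div_cancel two_ne_zero, one_smul, one_smul] at this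

lemma sum_mem (hF : IsConeSubequation F) (hconv : Convex ℝ F) {ι : Type*} (s : Finset ι)
    {A : ι → Matrix (Fin n) (Fin n) ℝ} (hA : ∀ i ∈ s, A i ∈ F) : ∑ i ∈ s, A i ∈ F := by
  classical
  induction s using Finset.induction_on with
  | empty => simpa using hF.zero_mem
  | insert i s hi ih =>
    rw [Finset.sum_insert hi]
    exact hF.add_mem hconv (hA i (by simp)) (ih fun j hj => hA j (by simp [hj]))

end IsConeSubequation

/-! ### Invariant matrices and nonnegativity of the trace on `F` -/

lemma exists_unit_vec {n : ℕ} (hn : n ≠ 0) : ∃ e : Fin n → ℝ, e ⬝ᵥ e = 1 :=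
  ⟨Pi.single ⟨0, Nat.pos_of_ne_zero hn⟩ 1, by simp⟩

/-- A symmetric matrix with constant quadratic form on the unit sphere is scalar. -/
lemma eq_smul_one_of_dotProduct_const {n : ℕ} {A : Matrix (Fin n) (Fin n) ℝ} (hA : A.IsSymm)
    {c : ℝ} (h : ∀ x : Fin n → ℝ, x ⬝ᵥ x = 1 → x ⬝ᵥ A.mulVec x = c) : A = c • 1 := by
  have hd : ∀ i, A i i = c := fun i => by simpa using h (Pi.single i 1) (by simp)
  ext i j
  by_cases hij : i = j
  · subst hij; simp [hd]
  · have hs : A j i = A i j := hA.apply i j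
    set r : ℝ := (√2)⁻¹ with hr
    have hr2 : r * r = 1 / 2 := by
      rw [hr, ← mul_inv, Real.mul_self_sqrt (by norm_num)]; norm_num
    -- The diagonal is already known; the unit vector halfway between two basis vectors detects the
    -- off-diagonal entry.
    have := h (r • (Pi.single i 1 + Pi.single j 1))
      (by simp [hij, Ne.symm hij]; linarith)
    simp [Matrix.mulVec_add, Matrix.mulVec_smul, hd, hs] at this
    simp [hij]
    have h4 : (r * r) * (2 * c + 2 * A i j) = c := by linarith
    rw [hr2] at h4
    linarith

/-- A nonempty closed convex set of matrices which is invariant under conjugation by `G` and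
which meets a bounded set contains a `G`-invariant matrix. -/
lemma exists_invariant_mem {n : ℕ} {S : Set (Matrix (Fin n) (Fin n) ℝ)} (hc : IsClosed S)
    (hconv : Convex ℝ S) (hne : S.Nonempty)
    (G : Set (Matrix (Fin n) (Fin n) ℝ)) (hG : ∀ g ∈ G, g.transpose * g = 1)
    (hS : ∀ g ∈ G, ∀ A ∈ S, g * A * g.transpose ∈ S) :
    ∃ A ∈ S, ∀ g ∈ G, g * A * g.transpose = A := by
  -- This is the squared Frobenius norm. It is preserved by orthogonal conjugation, so uniqueness of
  -- its minimizer on a closed convex invariant set makes the minimizer a fixed point.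
  set N : Matrix (Fin n) (Fin n) ℝ → ℝ := fun A => (A.transpose * A).trace with hN
  have hNs : ∀ A, N A = ∑ i, ∑ j, A j i ^ 2 := fun A => by
    simp [hN, Matrix.trace, Matrix.mul_apply, sq]
  have hNc : Continuous N := by
    simp only [hN]
    fun_prop
  obtain ⟨A₀, hA₀⟩ := hne
  have hcomp : IsCompact (S ∩ {A | N A ≤ N A₀}) := by
    have hcl : IsClosed (S ∩ {A | N A ≤ N A₀}) := hc.inter (isClosed_le hNc continuous_const)
    have hbox : IsCompact {A : Matrix (Fin n) (Fin n) ℝ |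
        ∀ i, A i ∈ {a : Fin n → ℝ | ∀ j, a j ∈ Icc (-(1 + N A₀)) (1 + N A₀)}} :=
      isCompact_pi_infinite fun _ => isCompact_pi_infinite fun _ => isCompact_Icc
    refine hbox.of_isClosed_subset hcl ?_
    rintro A ⟨-, hA⟩ i j
    have : A i j ^ 2 ≤ N A := by
      rw [hNs]
      exact (Finset.single_le_sum (f := fun i' => A i' j ^ 2) (fun _ _ => sq_nonneg _)
        (Finset.mem_univ i)).trans (Finset.single_le_sum (f := fun j' => ∑ i', A i' j' ^ 2)
        (fun _ _ => Finset.sum_nonneg fun _ _ => sq_nonneg _) (Finset.mem_univ j))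
    have hA' : N A ≤ N A₀ := hA
    constructor <;> nlinarith
  obtain ⟨A, ⟨hAS, hAN⟩, hmin⟩ := hcomp.exists_isMinOn ⟨A₀, hA₀, le_refl (N A₀)⟩ hNc.continuousOn
  have hmin' : ∀ B ∈ S, N A ≤ N B := by
    intro B hB
    by_cases h : N B ≤ N A₀
    · exact hmin ⟨hB, h⟩
    · exact le_trans hAN (le_of_not_ge h)
  refine ⟨A, hAS, fun g hg => ?_⟩
  set B := g * A * g.transpose with hB
  have hNB : N B = N A := by
    simp only [hN, hB, Matrix.transpose_mul, Matrix.transpose_transpose]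
    calc (g * (A.transpose * g.transpose) * (g * A * g.transpose)).trace
        = (g * (A.transpose * (g.transpose * g) * A * g.transpose)).trace := by
          simp only [Matrix.mul_assoc]
      _ = (A.transpose * A * (g.transpose * g)).trace := by
          rw [Matrix.trace_mul_comm, hG g hg]; simp only [Matrix.mul_assoc, Matrix.mul_one]
          rw [hG g hg, Matrix.mul_one]
      _ = _ := by rw [hG g hg, Matrix.mul_one]
  have hBS : B ∈ S := hS g hg A hAS
  have hmid := hmin' _ (hconv hAS hBS (a := 1 / 2) (b := 1 / 2) (by norm_num) (by norm_num)
    (by norm_num))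
  -- The parallelogram law: the midpoint of two minimizers would have smaller norm unless they
  -- coincide.
  have hpar : N ((1 / 2 : ℝ) • A + (1 / 2 : ℝ) • B) = N A / 2 + N B / 2 - N (B - A) / 4 := by
    simp only [hNs, Finset.sum_div, ← Finset.sum_add_distrib, ← Finset.sum_sub_distrib]
    refine Finset.sum_congr rfl fun i _ => Finset.sum_congr rfl fun j _ => ?_
    simp only [Matrix.add_apply, Matrix.smul_apply, Matrix.sub_apply, smul_eq_mul]
    ring
  have hz : N (B - A) ≤ 0 := by rw [hpar, hNB] at hmid; linarith
  ext i j
  have : (B - A) i j ^ 2 ≤ N (B - A) := by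
    rw [hNs]
    exact (Finset.single_le_sum (f := fun i' => (B - A) i' j ^ 2) (fun _ _ => sq_nonneg _)
      (Finset.mem_univ i)).trans (Finset.single_le_sum (f := fun j' => ∑ i', (B - A) i' j' ^ 2)
      (fun _ _ => Finset.sum_nonneg fun _ _ => sq_nonneg _) (Finset.mem_univ j))
  have h0 : (B - A) i j = 0 := pow_eq_zero_iff two_ne_zero |>.1
    (le_antisymm (this.trans hz) (sq_nonneg _))
  rw [Matrix.sub_apply] at h0
  linarith

namespace IsConeSubequation

variable {n : ℕ} {F : Set (Matrix (Fin n) (Fin n) ℝ)}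

/-- The slice of `F` with the same trace as `A` is closed, convex and invariant, so it contains a
matrix fixed by the group. Transitivity makes its quadratic form constant on the unit sphere, so it
is scalar, and `F` contains no negative multiple of the identity. This is where convexity turns
`F`-subharmonicity into classical subharmonicity. -/
lemma trace_nonneg (hF : IsConeSubequation F) (hST : IsSTInvariant F) (hconv : Convex ℝ F)
    {A : Matrix (Fin n) (Fin n) ℝ} (hA : A ∈ F) : 0 ≤ A.trace := by
  obtain ⟨G, htrans, hGF⟩ := hST
  have hG : ∀ g ∈ G, (g : Matrix (Fin n) (Fin n) ℝ).transpose * (g : Matrix (Fin n) (Fin n) ℝ) = 1 :=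
    fun g _ => (Matrix.mem_orthogonalGroup_iff' _ _).1 g.2
  have hcl : IsClosed (F ∩ {B | B.trace = A.trace}) :=
    hF.closed.inter (isClosed_eq (by fun_prop) continuous_const)
  have hcv : Convex ℝ (F ∩ {B | B.trace = A.trace}) := by
    refine hconv.inter fun B hB C hC a b _ _ hab => ?_
    have hB' : B.trace = A.trace := hB
    have hC' : C.trace = A.trace := hC
    simp only [mem_ofPred_eq, Matrix.trace_add, Matrix.trace_smul, hB', hC', smul_eq_mul]
    rw [← add_mul, hab, one_mul]
  obtain ⟨B, ⟨hBF, hBt⟩, hB⟩ := exists_invariant_mem hcl hcv ⟨A, hA, rfl⟩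
    ((fun g : Matrix.orthogonalGroup (Fin n) ℝ => (g : Matrix (Fin n) (Fin n) ℝ)) '' G)
    (by rintro _ ⟨g, hg, rfl⟩; exact hG g hg) (by
      rintro _ ⟨g, hg, rfl⟩ C ⟨hC, hCt⟩
      have hCt' : C.trace = A.trace := hCt
      refine ⟨hGF g hg C hC, ?_⟩
      simp only [mem_ofPred_eq]
      rw [Matrix.trace_mul_comm, ← Matrix.mul_assoc, hG g hg, Matrix.one_mul, hCt'])
  obtain ⟨e, he⟩ := exists_unit_vec hF.dim_ne_zero
  have hBs : B = (e ⬝ᵥ B.mulVec e) • 1 := by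
    refine eq_smul_one_of_dotProduct_const (hF.symm B hBF) fun x hx => ?_
    obtain ⟨g, hg, hgx⟩ := htrans e x he hx
    have h1 : B = (g : Matrix (Fin n) (Fin n) ℝ) * B * (g : Matrix (Fin n) (Fin n) ℝ).transpose :=
      (hB _ ⟨g, hg, rfl⟩).symm
    -- The transpose is the inverse of `g`, so it brings `x` back to `e`.
    have h2 : (g : Matrix (Fin n) (Fin n) ℝ).transpose.mulVec x = e := by
      rw [← hgx, Matrix.mulVec_mulVec, hG g hg, Matrix.one_mulVec]
    conv_lhs => rw [h1]
    rw [← Matrix.mulVec_mulVec, h2, ← Matrix.mulVec_mulVec, Matrix.dotProduct_mulVec,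
      ← Matrix.mulVec_transpose, h2]
  have hBt' : B.trace = A.trace := hBt
  by_contra! hneg
  have hnpos : (0 : ℝ) < n := by exact_mod_cast Nat.pos_of_ne_zero hF.dim_ne_zero
  rw [hBs, Matrix.trace_smul, Matrix.trace_one, Fintype.card_fin, smul_eq_mul] at hBt'
  have hcneg : e ⬝ᵥ B.mulVec e < 0 := by
    by_contra! hge
    have := mul_nonneg hge hnpos.le
    linarith
  rw [hBs] at hBF
  exact hF.smul_one_notMem hcneg hBF

/-! ### Bounds for the Riesz characteristic and separation from `F` -/

lemma rieszSet_eq (q : ℝ) (e : Fin n → ℝ) :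
    (1 - lineProj e) - (q - 1) • lineProj e = 1 - q • lineProj e := by
  rw [sub_smul, one_smul]; abel

/-- Adding the matrices `I - q P_e` over the coordinate directions gives `(n - q) I`, which cannot
lie in `F` if `q > n`. -/
lemma le_of_mem_rieszSet (hF : IsConeSubequation F) (hconv : Convex ℝ F) {q : ℝ}
    (hq : ∀ e : Fin n → ℝ, e ⬝ᵥ e = 1 → (1 - lineProj e) - (q - 1) • lineProj e ∈ F) :
    q ≤ n := by
  by_contra! hlt
  have h := hF.sum_mem hconv Finset.univ (A := fun i : Fin n =>
    1 - q • lineProj (Pi.single i (1 : ℝ))) fun i _ => by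
      rw [← rieszSet_eq]; exact hq _ (by simp)
  refine hF.smul_one_notMem (c := n - q) (by linarith) ?_
  convert h using 1
  ext i j
  by_cases hij : i = j
  · subst hij
    simp [Matrix.sum_apply, lineProj, Matrix.vecMulVec_apply, Pi.single_apply]
  · have : ∀ k, (Pi.single k (1 : ℝ) : Fin n → ℝ) i * (Pi.single k (1 : ℝ) : Fin n → ℝ) j = 0 := by
      intro k
      by_cases hk : i = k
      · subst hk; simp [Ne.symm hij]
      · simp [hk]
    simp [Matrix.sum_apply, lineProj, Matrix.vecMulVec_apply, hij, this]

lemma one_mem_rieszSet (hF : IsConeSubequation F) (e : Fin n → ℝ) (he : e ⬝ᵥ e = 1) :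
    (1 - lineProj e) - ((1 : ℝ) - 1) • lineProj e ∈ F := by
  rw [sub_self, zero_smul, sub_zero]
  exact hF.mem_of_posSemidef (posSemidef_one_sub_lineProj he)

lemma rieszSet_bddAbove (hF : IsConeSubequation F) (hconv : Convex ℝ F) :
    BddAbove {q : ℝ | ∀ e : Fin n → ℝ, e ⬝ᵥ e = 1 →
      (1 - lineProj e) - (q - 1) • lineProj e ∈ F} :=
  ⟨n, fun _ hq => hF.le_of_mem_rieszSet hconv hq⟩

lemma one_le_rieszChar (hF : IsConeSubequation F) (hconv : Convex ℝ F) : 1 ≤ rieszChar F :=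
  le_csSup (hF.rieszSet_bddAbove hconv) hF.one_mem_rieszSet

lemma rieszChar_le (hF : IsConeSubequation F) (hconv : Convex ℝ F) : rieszChar F ≤ n :=
  csSup_le ⟨1, hF.one_mem_rieszSet⟩ fun _ hq => hF.le_of_mem_rieszSet hconv hq

/-- The supremum defining `p` asks for membership in every direction. A transitive invariance group
carries membership from one unit vector to all others, so above `p` it must fail in each direction
separately. -/
lemma one_sub_smul_lineProj_notMem (hF : IsConeSubequation F) (hST : IsSTInvariant F)
    (hconv : Convex ℝ F) {q : ℝ} (hq : rieszChar F < q) {e : Fin n → ℝ} (he : e ⬝ᵥ e = 1) :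
    1 - q • lineProj e ∉ F := by
  intro hmem
  refine not_le.2 hq (le_csSup (hF.rieszSet_bddAbove hconv) fun x hx => ?_)
  obtain ⟨G, htrans, hGF⟩ := hST
  obtain ⟨g, hg, hgx⟩ := htrans e x he hx
  have h1 := hGF g hg _ hmem
  have hgg : (g : Matrix (Fin n) (Fin n) ℝ) * (g : Matrix (Fin n) (Fin n) ℝ).transpose = 1 :=
    (Matrix.mem_orthogonalGroup_iff _ _).1 g.2
  rw [rieszSet_eq]
  convert h1 using 1
  rw [Matrix.mul_sub, Matrix.sub_mul, Matrix.mul_one, hgg, Matrix.mul_smul, Matrix.smul_mul,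
    lineProj, lineProj, Matrix.mul_vecMulVec, Matrix.vecMulVec_mul, hgx,
    Matrix.vecMul_transpose, hgx]

/-- A symmetric matrix off `F` is separated from `F` by a positive definite matrix. -/
lemma exists_posDef_separating (hF : IsConeSubequation F) (hconv : Convex ℝ F)
    (htr : ∀ A ∈ F, 0 ≤ A.trace) {H : Matrix (Fin n) (Fin n) ℝ} (hH : H.IsSymm) (hHF : H ∉ F) :
    ∃ B : Matrix (Fin n) (Fin n) ℝ, B.PosDef ∧ (∀ A ∈ F, 0 ≤ (B * A).trace) ∧
      (B * H).trace < 0 := by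
  let _ : LocallyConvexSpace ℝ (Matrix (Fin n) (Fin n) ℝ) :=
    inferInstanceAs (LocallyConvexSpace ℝ (Fin n → Fin n → ℝ))
  -- Convexity makes the closed cone `F` a proper cone, so `H` is cut off by a functional that is
  -- nonnegative on `F`.
  obtain ⟨f, hf, hfH⟩ := ProperCone.hyperplane_separation_point (x₀ := H)
    (E := Matrix (Fin n) (Fin n) ℝ)
    { carrier := F
      add_mem' := fun ha hb => hF.add_mem hconv ha hb
      zero_mem' := hF.zero_mem
      smul_mem' := fun c x hx => hF.cone x hx c c.2
      isClosed' := hF.closed } hHF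
  set C : Matrix (Fin n) (Fin n) ℝ := Matrix.of fun i j => f (Matrix.single i j 1) with hC
  have hfC : ∀ A, f A = (C * A.transpose).trace := by
    intro A
    conv_lhs => rw [Matrix.matrix_eq_sum_single A]
    simp only [map_sum, Matrix.trace, Matrix.diag, Matrix.mul_apply, hC, Matrix.of_apply,
      Matrix.transpose_apply]
    refine Finset.sum_congr rfl fun i _ => Finset.sum_congr rfl fun j _ => ?_
    rw [show Matrix.single i j (A i j) = A i j • Matrix.single i j (1 : ℝ) by simp, map_smul,
      smul_eq_mul, mul_comm]
  -- Symmetrizing the representing matrix does not change its pairing with symmetric matrices.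
  -- Testing on the rank-one matrices, which lie in `F`, then shows that `D` is positive
  -- semidefinite.
  set D : Matrix (Fin n) (Fin n) ℝ := (1 / 2 : ℝ) • (C + C.transpose) with hD
  have hDs : ∀ A : Matrix (Fin n) (Fin n) ℝ, A.IsSymm → (D * A).trace = f A := by
    intro A hA
    have h1 : (C.transpose * A).trace = (C * A).trace := by
      rw [← Matrix.trace_transpose, Matrix.transpose_mul, Matrix.transpose_transpose, hA.eq,
        Matrix.trace_mul_comm]
    rw [hfC, hA.eq, hD, Matrix.smul_mul, Matrix.add_mul, Matrix.trace_smul, Matrix.trace_add, h1,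
      smul_eq_mul]
    ring
  have hDpos : D.PosSemidef := by
    refine Matrix.PosSemidef.of_dotProduct_mulVec_nonneg ?_ fun x => ?_
    · rw [Matrix.IsHermitian, Matrix.conjTranspose_eq_transpose_of_trivial, hD,
        Matrix.transpose_smul, Matrix.transpose_add, Matrix.transpose_transpose, add_comm]
    · have h1 := hf _ (hF.mem_of_posSemidef (posSemidef_lineProj x))
      rw [← hDs _ (hF.symm _ (hF.mem_of_posSemidef (posSemidef_lineProj x))), lineProj,
        Matrix.mul_vecMulVec, Matrix.trace_vecMulVec] at h1
      rwa [star_trivial, dotProduct_comm]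
  have hDH : (D * H).trace < 0 := by rwa [hDs H hH]
  -- Adding `ε I` makes the separating matrix definite. Nonnegativity on `F` survives because traces
  -- are nonnegative there, and `ε` is small enough to keep the pairing with `H` negative.
  obtain ⟨ε, hε, hεH⟩ : ∃ ε : ℝ, 0 < ε ∧ (D * H).trace + ε * H.trace < 0 := by
    refine ⟨-(D * H).trace / (2 * (1 + |H.trace|)), by
      have : 0 < -(D * H).trace := by linarith
      positivity, ?_⟩
    have h1 : H.trace ≤ |H.trace| := le_abs_self _
    have h2 : 0 < 2 * (1 + |H.trace|) := by positivity
    rw [div_mul_eq_mul_div, ← lt_neg_iff_add_neg', div_lt_iff₀ h2]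
    nlinarith [abs_nonneg H.trace]
  clear_value D
  refine ⟨D + ε • 1, Matrix.PosDef.posSemidef_add hDpos (Matrix.PosDef.one.smul hε), fun A hA => ?_, ?_⟩
  · rw [Matrix.add_mul, Matrix.trace_add, Matrix.smul_mul, Matrix.one_mul, Matrix.trace_smul,
      hDs A (hF.symm A hA), smul_eq_mul]
    exact add_nonneg (hf A hA) (mul_nonneg hε.le (htr A hA))
  · rwa [Matrix.add_mul, Matrix.trace_add, Matrix.smul_mul, Matrix.one_mul, Matrix.trace_smul,
      smul_eq_mul]

end IsConeSubequation

/-! ### The Poisson kernel of the unit ball -/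

/-- The product rule for the Laplacian, needed for the Poisson kernel written as a product. -/
lemma trace_hessian_mul {n : ℕ} {f g : EuclideanSpace ℝ (Fin n) → ℝ} {x : EuclideanSpace ℝ (Fin n)}
    (hf : ContDiffAt ℝ 2 f x) (hg : ContDiffAt ℝ 2 g x) :
    (hessian (fun y => f y * g y) x).trace =
      f x * (hessian g x).trace + g x * (hessian f x).trace +
        2 * ∑ i, fderiv ℝ f x (EuclideanSpace.single i 1) *
          fderiv ℝ g x (EuclideanSpace.single i 1) := by
  obtain ⟨a, b⟩ := contDiffAt_two_hasFDerivAt hf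
  obtain ⟨c, d⟩ := contDiffAt_two_hasFDerivAt hg
  rw [hessian_eq_of_hasFDerivAt (φ₁ := fun y => f y • fderiv ℝ g y + g y • fderiv ℝ f y)
    (by filter_upwards [a, c] with y h1 h2 using h1.mul h2)
    ((a.self_of_nhds.smul d).add (c.self_of_nhds.smul b))]
  simp only [trace_hessian_eq, Finset.mul_sum, ← Finset.sum_add_distrib]
  rw [Matrix.trace]
  refine Finset.sum_congr rfl fun i _ => ?_
  simp
  ring

lemma trace_vecMulVec_ofLp {n : ℕ} (x : EuclideanSpace ℝ (Fin n)) :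
    (Matrix.vecMulVec x.ofLp x.ofLp).trace = ‖x‖ ^ 2 := by
  rw [Matrix.trace_vecMulVec, EuclideanSpace.real_norm_sq_eq, dotProduct]
  simp [sq]

lemma ofLp_dotProduct_self {n : ℕ} (x : EuclideanSpace ℝ (Fin n)) :
    x.ofLp ⬝ᵥ x.ofLp = ‖x‖ ^ 2 := by
  rw [EuclideanSpace.real_norm_sq_eq, dotProduct]
  simp [sq]

/-- The Poisson kernel of the unit ball, normalized by `∫ P(σ, x) dσ = 1`. -/
noncomputable def poissonKernel {n : ℕ} (σ x : EuclideanSpace ℝ (Fin n)) : ℝ :=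
  (1 - ‖x‖ ^ 2) / ‖x - σ‖ ^ n

section

variable {n : ℕ} {σ x : EuclideanSpace ℝ (Fin n)}

lemma poissonKernel_pos (hσ : ‖σ‖ = 1) (hx : ‖x‖ < 1) : 0 < poissonKernel σ x := by
  have h1 : x ≠ σ := by rintro rfl; linarith
  have h2 : 0 < ‖x - σ‖ := norm_pos_iff.2 (sub_ne_zero.2 h1)
  have h3 : 0 < 1 - ‖x‖ ^ 2 := by nlinarith [norm_nonneg x]
  unfold poissonKernel
  positivity

lemma poissonKernel_eq_mul_rpow (x σ : EuclideanSpace ℝ (Fin n)) :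
    poissonKernel σ x = (1 - ‖x‖ ^ 2) * (‖x + -σ‖ ^ 2) ^ (-(n : ℝ) / 2) := by
  rw [poissonKernel, div_eq_mul_inv, ← sub_eq_add_neg]
  congr 1
  rw [← Real.rpow_natCast ‖x - σ‖ 2, ← Real.rpow_mul (norm_nonneg _), ← Real.rpow_natCast,
    ← Real.rpow_neg (norm_nonneg _)]
  congr 1
  push_cast
  ring

lemma hasDerivAt_rpow_const_two {t : ℝ} (ht : 0 < t) (α : ℝ) :
    (∀ᶠ s in 𝓝 t, HasDerivAt (fun s : ℝ => s ^ α) (α * s ^ (α - 1)) s) ∧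
      HasDerivAt (fun s : ℝ => α * s ^ (α - 1)) (α * (α - 1) * t ^ (α - 2)) t := by
  constructor
  · filter_upwards [lt_mem_nhds ht] with s hs
    exact Real.hasDerivAt_rpow_const (Or.inl (ne_of_gt hs))
  · have := (Real.hasDerivAt_rpow_const (p := α - 1) (Or.inl (ne_of_gt ht))).const_mul α
    rwa [← mul_assoc, show α - 1 - 1 = α - 2 by ring] at this

lemma contDiffAt_norm_sq_rpow {z : EuclideanSpace ℝ (Fin n)} (hz : z ≠ 0) (α : ℝ) :
    ContDiffAt ℝ 2 (fun y : EuclideanSpace ℝ (Fin n) => (‖y‖ ^ 2) ^ α) z :=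
  (contDiff_norm_sq ℝ).contDiffAt.rpow_const_of_ne (by
    have := norm_pos_iff.2 hz
    positivity)

lemma contDiffAt_poissonKernel (hx : x ≠ σ) : ContDiffAt ℝ 2 (poissonKernel σ) x := by
  refine ContDiffAt.div ?_ ?_ (by
    have := norm_pos_iff.2 (sub_ne_zero.2 hx)
    positivity)
  · exact contDiffAt_const.sub (contDiff_norm_sq ℝ).contDiffAt
  · exact ((contDiffAt_id.sub contDiffAt_const).norm ℝ (sub_ne_zero.2 hx)).pow n

/-- The Poisson kernel is harmonic. -/
lemma trace_hessian_poissonKernel (hσ : ‖σ‖ = 1) (hx : x ≠ σ) :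
    (hessian (poissonKernel σ) x).trace = 0 := by
  have hz : x + -σ ≠ 0 := by rwa [← sub_eq_add_neg, sub_ne_zero]
  set α : ℝ := -(n : ℝ) / 2 with hα
  set q : ℝ := ‖x + -σ‖ ^ 2 with hq
  have hqpos : 0 < q := by have := norm_pos_iff.2 hz; positivity
  set g : EuclideanSpace ℝ (Fin n) → ℝ := fun y => (‖y‖ ^ 2) ^ α with hg
  -- The kernel is `1 - |y|²` times a translate of the radial power `|z|^(-n)`, so its Laplacian
  -- follows from the product rule and the radial Hessian formula.
  have hfun : poissonKernel σ = fun y => (1 + (-1) * ‖y‖ ^ 2) * g (y + -σ) := by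
    ext y
    rw [poissonKernel_eq_mul_rpow]
    simp only [hg]
    ring
  have hgc : ContDiffAt ℝ 2 g (x + -σ) := contDiffAt_norm_sq_rpow hz α
  have hgc' : ContDiffAt ℝ 2 (fun y => g (y + -σ)) x :=
    hgc.comp x (contDiffAt_id.add contDiffAt_const)
  have hns : ContDiffAt ℝ 2 (fun y : EuclideanSpace ℝ (Fin n) => ‖y‖ ^ 2) x :=
    (contDiff_norm_sq ℝ).contDiffAt
  have hfc : ContDiffAt ℝ 2 (fun y : EuclideanSpace ℝ (Fin n) => 1 + (-1) * ‖y‖ ^ 2) x :=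
    contDiffAt_const.add (contDiffAt_const.mul hns)
  obtain ⟨hr1, hr2⟩ := hasDerivAt_rpow_const_two hqpos α
  have hHg : hessian (fun y => g (y + -σ)) x =
      (4 * (α * (α - 1) * q ^ (α - 2))) • Matrix.vecMulVec (x + -σ).ofLp (x + -σ).ofLp +
        (2 * (α * q ^ (α - 1))) • 1 := by
    rw [hessian_comp_add (-σ) hgc]
    exact hessian_radial (g := fun s => s ^ α) (g₁ := fun s => α * s ^ (α - 1)) hr1 hr2
  have hHf : hessian (fun y : EuclideanSpace ℝ (Fin n) => 1 + (-1) * ‖y‖ ^ 2) x =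
      (-2 : ℝ) • 1 := by
    rw [hessian_add contDiffAt_const (contDiffAt_const.mul hns), hessian_const,
      hessian_const_mul hns, hessian_norm_sq, zero_add, smul_smul]
    norm_num
  have hnd : ∀ z : EuclideanSpace ℝ (Fin n),
      HasFDerivAt (fun y : EuclideanSpace ℝ (Fin n) => ‖y‖ ^ 2) (2 • innerSL ℝ z) z :=
    fun z => (hasStrictFDerivAt_norm_sq z).hasFDerivAt
  have hDf : fderiv ℝ (fun y : EuclideanSpace ℝ (Fin n) => 1 + (-1) * ‖y‖ ^ 2) x =
      (-1 : ℝ) • (2 • innerSL ℝ x) := (((hnd x).const_mul (-1)).const_add 1).fderiv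
  have hDg : fderiv ℝ (fun y => g (y + -σ)) x =
      (α * q ^ (α - 1)) • (2 • innerSL ℝ (x + -σ)) := by
    have h1 : HasFDerivAt (fun y : EuclideanSpace ℝ (Fin n) => ‖y + -σ‖ ^ 2)
        (2 • innerSL ℝ (x + -σ)) x := by
      exact (hnd (x + -σ)).comp x ((hasFDerivAt_id x).add_const (-σ))
    exact (hr1.self_of_nhds.comp_hasFDerivAt x h1).fderiv
  rw [hfun, trace_hessian_mul hfc hgc', hHg, hHf, hDf, hDg]
  have hsum : ∑ i, x i * (x + -σ) i = inner ℝ x (x + -σ) := by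
    rw [PiLp.inner_apply]
    simp [mul_comm]
  have hsum' : ∑ i : Fin n, ((-1 : ℝ) • (2 • innerSL ℝ x)) (EuclideanSpace.single i 1) *
      ((α * q ^ (α - 1)) • (2 • innerSL ℝ (x + -σ))) (EuclideanSpace.single i 1) =
      -4 * (α * q ^ (α - 1)) * inner ℝ x (x + -σ) := by
    rw [← hsum, Finset.mul_sum]
    refine Finset.sum_congr rfl fun i _ => ?_
    simp [EuclideanSpace.inner_single_right]
    ring
  rw [hsum']
  simp only [Matrix.trace_add, Matrix.trace_smul, trace_vecMulVec_ofLp, Matrix.trace_one,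
    Fintype.card_fin, smul_eq_mul, ← hq]
  have hgx : g (x + -σ) = q * q ^ (α - 1) := by
    simp only [hg, ← hq]
    rw [Real.rpow_sub_one hqpos.ne']; field_simp
  have hq2 : q ^ (α - 2) * q = q ^ (α - 1) := by
    rw [show α - 2 = α - 1 - 1 by ring, Real.rpow_sub_one hqpos.ne' (α - 1)]; field_simp
  -- Polarization, using `|σ| = 1`; this identity is what makes all the terms cancel.
  have hinner : 2 * inner ℝ x (x + -σ) = ‖x‖ ^ 2 + q - 1 := by
    have h1 := norm_sub_sq_real x (x + -σ)
    rw [show x - (x + -σ) = σ by abel, hσ] at h1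
    linarith
  have hn : (n : ℝ) = -2 * α := by rw [hα]; ring
  rw [hgx, hn]
  have e1 : 4 * (α * (α - 1) * q ^ (α - 2)) * q = 4 * α * (α - 1) * q ^ (α - 1) := by
    rw [← hq2]; ring
  rw [e1]
  linear_combination (-4 * α * q ^ (α - 1)) * hinner

lemma poissonKernel_comp_isometry (g : EuclideanSpace ℝ (Fin n) ≃ₗᵢ[ℝ] EuclideanSpace ℝ (Fin n)) :
    poissonKernel (g σ) (g x) = poissonKernel σ x := by
  unfold poissonKernel
  rw [← map_sub, g.norm_map, g.norm_map]

lemma poissonKernel_zero (hσ : ‖σ‖ = 1) : poissonKernel σ 0 = 1 := by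
  simp [poissonKernel, hσ]

end

/-! ### The normalized surface measure -/

/-- The normalized surface measure of the unit sphere. -/
noncomputable def sphereProb (n : ℕ) : Measure (Metric.sphere (0 : EuclideanSpace ℝ (Fin n)) 1) :=
  (Measure.toSphere (volume : Measure (EuclideanSpace ℝ (Fin n))) univ)⁻¹ •
    Measure.toSphere (volume : Measure (EuclideanSpace ℝ (Fin n)))

instance {n : ℕ} [NeZero n] : IsProbabilityMeasure (sphereProb n) where
  measure_univ := by
    have : Nonempty (Fin n) := ⟨⟨0, Nat.pos_of_ne_zero (NeZero.ne n)⟩⟩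
    rw [sphereProb, Measure.smul_apply, smul_eq_mul, ENNReal.inv_mul_cancel]
    · rw [Ne, Measure.measure_univ_eq_zero]
      exact Measure.toSphere_ne_zero _
    · exact measure_ne_top _ _

/-- The action of a linear isometry on the unit sphere. -/
noncomputable def sphereMap {n : ℕ} (g : EuclideanSpace ℝ (Fin n) ≃ₗᵢ[ℝ] EuclideanSpace ℝ (Fin n)) :
    Metric.sphere (0 : EuclideanSpace ℝ (Fin n)) 1 → Metric.sphere (0 : EuclideanSpace ℝ (Fin n)) 1 :=
  fun σ => ⟨g σ, by simp⟩

lemma continuous_sphereMap {n : ℕ} (g : EuclideanSpace ℝ (Fin n) ≃ₗᵢ[ℝ] EuclideanSpace ℝ (Fin n)) :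
    Continuous (sphereMap g) :=
  (g.continuous.comp continuous_subtype_val).subtype_mk _

-- The surface measure of a set is a multiple of the volume of the cone over it, and an isometry
-- carries cones to cones and preserves volume.
open scoped Pointwise in
lemma measurePreserving_sphereMap {n : ℕ}
    (g : EuclideanSpace ℝ (Fin n) ≃ₗᵢ[ℝ] EuclideanSpace ℝ (Fin n)) :
    MeasurePreserving (sphereMap g) (sphereProb n) (sphereProb n) := by
  refine ⟨(continuous_sphereMap g).measurable, ?_⟩
  rw [sphereProb, Measure.map_smul]
  congr 1
  ext s hs
  have hm := (continuous_sphereMap g).measurable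
  rw [Measure.map_apply hm hs, Measure.toSphere_apply' _ (hm hs), Measure.toSphere_apply' _ hs]
  congr 1
  rw [← g.measurePreserving.measure_preimage_emb g.toHomeomorph.measurableEmbedding
    (Ioo (0 : ℝ) 1 • (Subtype.val '' s))]
  congr 1
  ext y
  simp only [mem_preimage, Set.mem_smul, mem_image, Subtype.exists, exists_and_right,
    exists_eq_right, sphereMap]
  constructor
  · rintro ⟨r, hr, σ, ⟨hσ, hσs⟩, rfl⟩
    exact ⟨r, hr, g σ, ⟨by simpa using hσ, hσs⟩, by simp⟩
  · rintro ⟨r, hr, τ, ⟨hτ, hτs⟩, hy⟩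
    refine ⟨r, hr, g.symm τ, ⟨by simpa using hτ, ?_⟩, ?_⟩
    · simpa using hτs
    · rw [← map_smul, hy, g.symm_apply_apply]

lemma lintegral_sphere_comp {n : ℕ}
    (g : EuclideanSpace ℝ (Fin n) ≃ₗᵢ[ℝ] EuclideanSpace ℝ (Fin n))
    {f : EuclideanSpace ℝ (Fin n) → ENNReal} (hf : Measurable f) :
    ∫⁻ σ, f (g σ) ∂(sphereProb n) = ∫⁻ σ, f σ ∂(sphereProb n) :=
  (measurePreserving_sphereMap g).lintegral_comp (hf.comp measurable_subtype_coe)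

lemma exists_isometry_map_eq {n : ℕ} {x y : EuclideanSpace ℝ (Fin n)} (h : ‖x‖ = ‖y‖) :
    ∃ g : EuclideanSpace ℝ (Fin n) ≃ₗᵢ[ℝ] EuclideanSpace ℝ (Fin n), g x = y :=
  ⟨_, Submodule.reflection_sub h⟩

/-! ### Comparison with Poisson integrals -/

/-- `h` is a uniform limit on the closed ball of radius `ρ` of functions which are harmonic in the
open unit ball. -/
def IsHarmonicLimit {n : ℕ} (ρ : ℝ) (h : EuclideanSpace ℝ (Fin n) → ℝ) : Prop :=
  ∀ ε : ℝ, 0 < ε → ∃ k : EuclideanSpace ℝ (Fin n) → ℝ,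
    (∀ x ∈ Metric.ball (0 : EuclideanSpace ℝ (Fin n)) 1,
      ContDiffAt ℝ 2 k x ∧ (hessian k x).trace = 0) ∧
    ∀ x ∈ Metric.closedBall (0 : EuclideanSpace ℝ (Fin n)) ρ, |h x - k x| ≤ ε

/-- The submodule of continuous functions on a closed ball which extend to harmonic functions in the
unit ball. -/
def harmonicSubmodule (n : ℕ) (ρ : ℝ) :
    Submodule ℝ C(Metric.closedBall (0 : EuclideanSpace ℝ (Fin n)) ρ, ℝ) where
  carrier := {m | ∃ k : EuclideanSpace ℝ (Fin n) → ℝ,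
    (∀ x ∈ Metric.ball (0 : EuclideanSpace ℝ (Fin n)) 1,
      ContDiffAt ℝ 2 k x ∧ (hessian k x).trace = 0) ∧ ∀ x, m x = k x}
  add_mem' := by
    rintro a b ⟨k, hk, hk'⟩ ⟨l, hl, hl'⟩
    refine ⟨fun x => k x + l x, fun x hx => ⟨(hk x hx).1.add (hl x hx).1, ?_⟩, fun x => ?_⟩
    · rw [hessian_add (hk x hx).1 (hl x hx).1, Matrix.trace_add, (hk x hx).2, (hl x hx).2, add_zero]
    · simp [hk', hl']
  zero_mem' := ⟨fun _ => 0, fun x _ => ⟨contDiffAt_const, by simp [hessian_const]⟩, fun x => rfl⟩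
  smul_mem' := by
    rintro c a ⟨k, hk, hk'⟩
    refine ⟨fun x => c * k x, fun x hx => ⟨contDiffAt_const.mul (hk x hx).1, ?_⟩, fun x => ?_⟩
    · rw [hessian_const_mul (hk x hx).1, Matrix.trace_smul, (hk x hx).2, smul_zero]
    · simp [hk']

lemma continuousOn_poissonKernel {n : ℕ} :
    ContinuousOn (fun p : EuclideanSpace ℝ (Fin n) × EuclideanSpace ℝ (Fin n) =>
      poissonKernel p.1 p.2) {p | p.2 ≠ p.1} := by
  unfold poissonKernel
  refine ContinuousOn.div (by fun_prop) (by fun_prop) fun p hp => ?_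
  have : 0 < ‖p.2 - p.1‖ := norm_pos_iff.2 (sub_ne_zero.2 hp)
  positivity

lemma continuous_poissonKernel_sphere {n : ℕ} {x : EuclideanSpace ℝ (Fin n)} (hx : ‖x‖ < 1) :
    Continuous fun σ : Metric.sphere (0 : EuclideanSpace ℝ (Fin n)) 1 =>
      poissonKernel (σ : EuclideanSpace ℝ (Fin n)) x := by
  refine continuousOn_poissonKernel.comp_continuous (f := fun σ :
    Metric.sphere (0 : EuclideanSpace ℝ (Fin n)) 1 => ((σ : EuclideanSpace ℝ (Fin n)), x))
    (by fun_prop) fun σ => ?_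
  simp only [mem_ofPred_eq]
  rintro rfl
  have : ‖(σ : EuclideanSpace ℝ (Fin n))‖ = 1 := by simp
  linarith

/-- The Poisson integral is a Bochner integral in the space of continuous functions on the smaller
closed ball. Its integrand takes values in the subspace of restrictions of harmonic functions, so
the integral lies in the closure of that subspace. Uniform approximation by harmonic functions is
all that comparison requires, and no differentiation under the integral sign occurs. -/
lemma isHarmonicLimit_poisson {n : ℕ} [NeZero n]
    (f : C(Metric.sphere (0 : EuclideanSpace ℝ (Fin n)) 1, ℝ)) {ρ : ℝ} (hρ : ρ < 1) :
    IsHarmonicLimit ρ fun x => ∫ σ, f σ * poissonKernel (σ : EuclideanSpace ℝ (Fin n)) x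
      ∂(sphereProb n) := by
  intro ε hε
  set K := Metric.closedBall (0 : EuclideanSpace ℝ (Fin n)) ρ
  have : CompactSpace K := isCompact_iff_compactSpace.1 (isCompact_closedBall 0 ρ)
  have hKn : ∀ x : K, ‖(x : EuclideanSpace ℝ (Fin n))‖ < 1 := fun x =>
    (mem_closedBall_zero_iff.1 x.2).trans_lt hρ
  have hSn : ∀ σ : Metric.sphere (0 : EuclideanSpace ℝ (Fin n)) 1, ‖(σ : EuclideanSpace ℝ (Fin n))‖ = 1 := fun σ => by simp
  have hne : ∀ (σ : Metric.sphere (0 : EuclideanSpace ℝ (Fin n)) 1) (x : EuclideanSpace ℝ (Fin n)), ‖x‖ < 1 → x ≠ σ := by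
    rintro σ x hx rfl
    have := hSn σ
    linarith
  let Φ : C(Metric.sphere (0 : EuclideanSpace ℝ (Fin n)) 1 × K, ℝ) := ⟨fun p => f p.1 * poissonKernel (p.1 : EuclideanSpace ℝ (Fin n)) p.2, by
    refine (f.continuous.comp continuous_fst).mul (continuousOn_poissonKernel.comp_continuous
      (f := fun p : Metric.sphere (0 : EuclideanSpace ℝ (Fin n)) 1 × K => ((p.1 : EuclideanSpace ℝ (Fin n)), (p.2 : EuclideanSpace ℝ (Fin n))))
      (by fun_prop) fun p => hne p.1 p.2 (hKn p.2))⟩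
  have hint : Integrable Φ.curry (sphereProb n) :=
    Φ.curry.continuous.integrable_of_hasCompactSupport (HasCompactSupport.of_compactSpace _)
  have hmem : ∫ σ, Φ.curry σ ∂(sphereProb n) ∈ (harmonicSubmodule n ρ).topologicalClosure := by
    refine Convex.integral_mem (Submodule.convex _)
      (Submodule.isClosed_topologicalClosure _) (Eventually.of_forall fun σ => ?_) hint
    refine Submodule.le_topologicalClosure _ ?_
    refine ⟨fun x => f σ * poissonKernel (σ : EuclideanSpace ℝ (Fin n)) x, fun x hx => ?_,
      fun x => rfl⟩
    have hx' := hne σ x (mem_ball_zero_iff.1 hx)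
    refine ⟨contDiffAt_const.mul (contDiffAt_poissonKernel hx'), ?_⟩
    rw [hessian_const_mul (contDiffAt_poissonKernel hx'), Matrix.trace_smul,
      trace_hessian_poissonKernel (hSn σ) hx', smul_zero]
  obtain ⟨m, ⟨k, hk, hmk⟩, hm⟩ := Metric.mem_closure_iff.1 hmem ε hε
  refine ⟨k, hk, fun x hx => ?_⟩
  have h1 : (∫ σ, Φ.curry σ ∂(sphereProb n)) ⟨x, hx⟩ =
      ∫ σ, f σ * poissonKernel (σ : EuclideanSpace ℝ (Fin n)) x ∂(sphereProb n) :=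
    ((ContinuousMap.evalCLM ℝ (⟨x, hx⟩ : K)).integral_comp_comm hint).symm
  beta_reduce
  rw [← h1, ← hmk ⟨x, hx⟩, ← Real.dist_eq]
  exact (ContinuousMap.dist_apply_le_dist _).trans hm.le

/-- A harmonic approximant plus `δ (ρ² - |y|²)` and a small constant has strictly negative
Laplacian, so it is a strict barrier; the perturbations then tend to zero. -/
lemma IsSubharmonicOn.le_of_isHarmonicLimit {n : ℕ} [NeZero n]
    {u : EuclideanSpace ℝ (Fin n) → EReal} {X : Set (EuclideanSpace ℝ (Fin n))}
    (hu : IsSubharmonicOn {A | 0 ≤ A.trace} u X) {ρ : ℝ} (hρ : ρ < 1)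
    (hX : Metric.closedBall 0 ρ ⊆ X) {h : EuclideanSpace ℝ (Fin n) → ℝ}
    (hh : IsHarmonicLimit ρ h) (hb : ∀ x, ‖x‖ = ρ → u x ≤ (h x : EReal))
    {x : EuclideanSpace ℝ (Fin n)} (hx : ‖x‖ ≤ ρ) : u x ≤ (h x : EReal) := by
  have key : ∀ ε : ℝ, 0 < ε → u x ≤ ((h x + ε : ℝ) : EReal) := by
    intro ε hε
    obtain ⟨k, hk, hhk⟩ := hh (ε / 4) (by positivity)
    have hρ0 : 0 ≤ ρ := (norm_nonneg x).trans hx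
    set δ : ℝ := ε / 2 with hδ
    have hc2 : ContDiff ℝ 2 fun y : EuclideanSpace ℝ (Fin n) => ‖y‖ ^ 2 := contDiff_norm_sq ℝ
    have hφc : ∀ y ∈ Metric.ball (0 : EuclideanSpace ℝ (Fin n)) 1, ContDiffAt ℝ 2
        (fun y => k y + (ε / 4 + δ * (ρ ^ 2)) + (-δ) * ‖y‖ ^ 2) y := fun y hy =>
      ((hk y hy).1.add contDiffAt_const).add (contDiffAt_const.mul hc2.contDiffAt)
    have hKb : Metric.closedBall (0 : EuclideanSpace ℝ (Fin n)) ρ ⊆ Metric.ball 0 1 :=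
      Metric.closedBall_subset_ball hρ
    have := hu.le_of_hessian_notMem (K := Metric.closedBall 0 ρ) (O := Metric.ball 0 ρ)
      (φ := fun y => k y + (ε / 4 + δ * (ρ ^ 2)) + (-δ) * ‖y‖ ^ 2)
      (isCompact_closedBall 0 ρ) hX Metric.isOpen_ball
      Metric.ball_subset_closedBall
      (fun y hy => (hφc y (hKb hy)).continuousAt.continuousWithinAt)
      (fun y hy => hφc y (hKb (Metric.ball_subset_closedBall hy))) ?_ ?_ x
      (mem_closedBall_zero_iff.2 hx)
    · refine this.trans (EReal.coe_le_coe_iff.2 ?_)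
      have h1 := (abs_le.1 (hhk x (mem_closedBall_zero_iff.2 hx))).1
      have h2 : ρ ^ 2 ≤ 1 := by nlinarith
      have h3 : 0 ≤ δ * ‖x‖ ^ 2 := by positivity
      nlinarith
    · intro y hy
      have hy1 := hKb (Metric.ball_subset_closedBall hy)
      rw [hessian_add ((hk y hy1).1.add contDiffAt_const) (contDiffAt_const.mul hc2.contDiffAt),
        hessian_add (hk y hy1).1 contDiffAt_const, hessian_const,
        hessian_const_mul hc2.contDiffAt, hessian_norm_sq]
      simp only [mem_ofPred_eq, not_le, Matrix.trace_add, Matrix.trace_smul, (hk y hy1).2,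
        Matrix.trace_one, Fintype.card_fin, smul_eq_mul, Matrix.trace_zero]
      have : (0 : ℝ) < n := by exact_mod_cast Nat.pos_of_ne_zero (NeZero.ne n)
      have h5 : 0 < δ := by positivity
      nlinarith [mul_pos h5 this]
    · intro y hy hyO
      have hyρ : ‖y‖ = ρ := le_antisymm (mem_closedBall_zero_iff.1 hy)
        (not_lt.1 fun h => hyO (mem_ball_zero_iff.2 h))
      refine (hb y hyρ).trans (EReal.coe_le_coe_iff.2 ?_)
      have h1 := (abs_le.1 (hhk y hy)).2
      rw [hyρ]
      linarith
  refine EReal.le_of_forall_lt_iff_le.1 fun z hz => ?_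
  have hz' : h x < z := EReal.coe_lt_coe_iff.1 hz
  have := key (z - h x) (by linarith)
  rwa [add_sub_cancel] at this

/-- The integral is rotation invariant, hence constant on the sphere through `x`. A harmonic
approximant is nearly constant there, and the maximum principle applied to it and to its negative
shows that its value at the origin is nearly the same. At the origin the kernel is identically one.
-/
lemma integral_poissonKernel {n : ℕ} [NeZero n] {x : EuclideanSpace ℝ (Fin n)} (hx : ‖x‖ < 1) :
    ∫ σ, poissonKernel (σ : EuclideanSpace ℝ (Fin n)) x ∂(sphereProb n) = 1 := by
  set h : EuclideanSpace ℝ (Fin n) → ℝ := fun y =>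
    ∫ σ, poissonKernel (σ : EuclideanSpace ℝ (Fin n)) y ∂(sphereProb n) with hh
  have hlim : IsHarmonicLimit ‖x‖ h := by
    simpa using isHarmonicLimit_poisson (n := n) (ContinuousMap.const _ 1) hx
  have hinv : ∀ y : EuclideanSpace ℝ (Fin n), ‖y‖ = ‖x‖ → h y = h x := by
    intro y hy
    obtain ⟨g, hg⟩ := exists_isometry_map_eq hy.symm
    have h1 : ∫ σ, poissonKernel ((sphereMap g σ : Metric.sphere (0 : EuclideanSpace ℝ (Fin n)) 1) :
        EuclideanSpace ℝ (Fin n)) (g x) ∂(sphereProb n) = h (g x) :=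
      (measurePreserving_sphereMap g).integral_comp
        (g.toHomeomorph.sets (by simp)).measurableEmbedding
        (fun σ : Metric.sphere (0 : EuclideanSpace ℝ (Fin n)) 1 =>
          poissonKernel (σ : EuclideanSpace ℝ (Fin n)) (g x))
    rw [← hg, ← h1]
    exact integral_congr_ae (Eventually.of_forall fun σ => poissonKernel_comp_isometry g)
  have h0 : h 0 = 1 := by
    have : ∀ σ : Metric.sphere (0 : EuclideanSpace ℝ (Fin n)) 1,
        poissonKernel (σ : EuclideanSpace ℝ (Fin n)) 0 = 1 := fun σ => poissonKernel_zero (by simp)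
    simp [hh, this]
  have hle : ∀ ε : ℝ, 0 < ε → |h 0 - h x| ≤ 2 * ε := by
    intro ε hε
    obtain ⟨k, hk, hhk⟩ := hlim ε hε
    have hball : Metric.closedBall (0 : EuclideanSpace ℝ (Fin n)) ‖x‖ ⊆ Metric.ball 0 1 :=
      Metric.closedBall_subset_ball hx
    have hconst : ∀ c : ℝ, IsHarmonicLimit (n := n) ‖x‖ fun _ => c := fun c δ hδ =>
      ⟨fun _ => c, fun y _ => ⟨contDiffAt_const, by simp [hessian_const]⟩,
        fun y _ => by simp [hδ.le]⟩
    have hk1 := (isSubharmonicOn_of_trace_nonneg (h := k) (fun y hy => (hk y hy).1)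
      fun y hy => (hk y hy).2.ge).le_of_isHarmonicLimit hx hball (hconst (h x + ε)) (fun y hy => by
        have := (abs_le.1 (hhk y (mem_closedBall_zero_iff.2 hy.le))).1
        rw [hinv y hy] at this
        exact EReal.coe_le_coe_iff.2 (by linarith)) (x := 0) (by simp)
    have hk2 := (isSubharmonicOn_of_trace_nonneg (h := fun y => - k y)
      (fun y hy => (hk y hy).1.neg)
      fun y hy => by
        rw [hessian_neg (hk y hy).1, Matrix.trace_neg, (hk y hy).2, neg_zero]).le_of_isHarmonicLimit
          hx hball (hconst (-h x + ε)) (fun y hy => by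
        have := (abs_le.1 (hhk y (mem_closedBall_zero_iff.2 hy.le))).2
        rw [hinv y hy] at this
        exact EReal.coe_le_coe_iff.2 (by linarith)) (x := 0) (by simp)
    have hk1' := EReal.coe_le_coe_iff.1 hk1
    have hk2' := EReal.coe_le_coe_iff.1 hk2
    have := abs_le.1 (hhk 0 (by simp))
    rw [abs_le]
    constructor <;> linarith
  have : |h 0 - h x| = 0 := by
    refine le_antisymm (le_of_forall_pos_le_add fun ε hε => ?_) (abs_nonneg _)
    have := hle (ε / 2) (by positivity)
    linarith
  exact ((sub_eq_zero.1 (abs_eq_zero.1 this)).symm : h x = h 0).trans h0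

/-! ### Reflection of extended reals at a constant -/

/-- The non-negative part of `c - a`. -/
noncomputable def coFun (c : ℝ) (a : EReal) : ENNReal := ((c : EReal) - a).toENNReal

section coFun

variable {c : ℝ} {a b : EReal}

lemma continuous_coFun (c : ℝ) : Continuous (coFun c) := by
  refine EReal.continuous_toENNReal.comp (continuous_iff_continuousAt.2 fun a => ?_)
  have h : ContinuousAt (fun p : EReal × EReal => p.1 + p.2) ((c : EReal), -a) :=
    EReal.continuousAt_add (Or.inl (EReal.coe_ne_top _)) (Or.inl (EReal.coe_ne_bot _))
  exact h.comp (f := fun a : EReal => ((c : EReal), -a))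
    (continuousAt_const.prodMk continuous_neg.continuousAt)

lemma antitone_coFun (c : ℝ) : Antitone (coFun c) := fun _ _ h =>
  EReal.toENNReal_le_toENNReal (EReal.sub_le_sub le_rfl h)

lemma coFun_coe (c a : ℝ) : coFun c (a : EReal) = ENNReal.ofReal (c - a) := by
  rw [coFun, ← EReal.coe_sub, EReal.toENNReal_of_ne_top (EReal.coe_ne_top _), EReal.toReal_coe]

@[simp] lemma coFun_bot (c : ℝ) : coFun c ⊥ = ⊤ := by
  simp [coFun]

lemma coFun_eq_top_iff : coFun c a = ⊤ ↔ a = ⊥ := by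
  induction a with
  | bot => simp
  | top => simp [coFun]
  | coe a => simp [coFun_coe]

lemma eq_sub_coFun (h : a ≤ c) : a = (c : EReal) - (coFun c a : EReal) := by
  induction a with
  | bot => simp
  | top => simp at h
  | coe a =>
    have := EReal.coe_le_coe_iff.1 h
    rw [coFun_coe, EReal.coe_ennreal_ofReal, max_eq_left (by linarith), ← EReal.coe_sub]
    simp

lemma coFun_sub_coe (c : ℝ) (t : ENNReal) : coFun c ((c : EReal) - (t : EReal)) = t := by
  induction t with
  | top => simp [coFun]
  | coe t =>
    rw [show ((t : ENNReal) : EReal) = ((t : ℝ) : EReal) from rfl, ← EReal.coe_sub, coFun_coe]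
    simp

lemma lt_of_coFun_pos (h : 0 < coFun c a) : a < c := by
  induction a with
  | bot => exact EReal.bot_lt_coe c
  | top => simp [coFun] at h
  | coe a =>
    rw [coFun_coe, ENNReal.ofReal_pos] at h
    exact EReal.coe_lt_coe_iff.2 (by linarith)

lemma le_iff_coFun_le (ha : a ≤ c) : a ≤ b ↔ coFun c b ≤ coFun c a := by
  refine ⟨fun h => antitone_coFun c h, fun h => ?_⟩
  by_cases hb : b ≤ c
  · rw [eq_sub_coFun ha, eq_sub_coFun hb]
    exact EReal.sub_le_sub le_rfl (EReal.coe_ennreal_le_coe_ennreal_iff.2 h)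
  · exact ha.trans (le_of_not_ge hb)

lemma lowerSemicontinuousOn_coFun {α : Type*} [TopologicalSpace α] {u : α → EReal} {s : Set α}
    (h : UpperSemicontinuousOn u s) (c : ℝ) : LowerSemicontinuousOn (fun x => coFun c (u x)) s :=
  (continuous_coFun c).comp_upperSemicontinuousOn_antitone h (antitone_coFun c)

end coFun

/-! ### The Poisson inequality -/

/-- A lower semicontinuous function is a limit of Lipschitz functions from below. -/
lemma exists_lipschitz_approx {E : Type*} [PseudoMetricSpace E] {v : E → ENNReal} {K : Set E}
    (hv : LowerSemicontinuousOn v K) :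
    ∃ f : ℕ → E → ℝ, (∀ k x, 0 ≤ f k x) ∧ (∀ k, ∀ x ∈ K, f k x ≤ k) ∧
      (∀ k x y, f k x ≤ f k y + k * dist x y) ∧ (∀ k, ∀ x ∈ K, ENNReal.ofReal (f k x) ≤ v x) ∧
      ∀ x ∈ K, ∀ a < v x, ∀ᶠ k in atTop, a ≤ ENNReal.ofReal (f k x) := by
  rcases K.eq_empty_or_nonempty with rfl | hK
  · exact ⟨fun _ _ => 0, by simp, by simp, by intros; positivity, by simp, by simp⟩
  have : Nonempty K := hK.to_subtype
  -- The function is truncated at height `k`, and `f k` is the infimal convolution of the truncation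
  -- with a cone of slope `k`.
  set g : ℕ → E → ℝ := fun k y => (min (v y) k).toReal with hg
  have hgt : ∀ (k : ℕ) y, min (v y) (k : ENNReal) ≠ ⊤ := fun k y =>
    ne_top_of_le_ne_top (ENNReal.natCast_ne_top k) (min_le_right _ _)
  have hg0 : ∀ k y, 0 ≤ g k y := fun k y => ENNReal.toReal_nonneg
  have hgk : ∀ k y, g k y ≤ k := fun k y => by
    have := ENNReal.toReal_mono (ENNReal.natCast_ne_top k) (min_le_right (v y) (k : ENNReal))
    simpa using this
  have hbdd : ∀ (k : ℕ) (x : E), BddBelow (range fun y : K => g k y + k * dist x (y : E)) := fun k x =>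
    ⟨0, by rintro _ ⟨y, rfl⟩; have := hg0 k y; positivity⟩
  have hfg : ∀ k : ℕ, ∀ x ∈ K, (⨅ y : K, (g k y + k * dist x y)) ≤ g k x := fun k x hx => by
    simpa using ciInf_le (hbdd k x) ⟨x, hx⟩
  refine ⟨fun k x => ⨅ y : K, (g k y + k * dist x y), fun k x => ?_, fun k x hx => ?_,
    fun k x z => ?_, fun k x hx => ?_, fun x hx a ha => ?_⟩
  · exact le_ciInf fun y => by have := hg0 k y; positivity
  · exact (hfg k x hx).trans (hgk k x)
  · rw [← sub_le_iff_le_add]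
    refine le_ciInf fun y => ?_
    rw [sub_le_iff_le_add]
    refine (ciInf_le (hbdd k x) y).trans ?_
    have : dist x y ≤ dist x z + dist z y := dist_triangle _ _ _
    have := mul_le_mul_of_nonneg_left this (Nat.cast_nonneg (α := ℝ) k)
    linarith
  · refine (ENNReal.ofReal_le_ofReal (hfg k x hx)).trans ?_
    rw [hg, ENNReal.ofReal_toReal (hgt k x)]
    exact min_le_left _ _
  · have hat : a ≠ ⊤ := ha.ne_top
    obtain ⟨δ, hδ, hδv⟩ := Metric.mem_nhdsWithin_iff.1 (hv x hx a ha)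
    -- For such `k` the truncation lies above `a`, and points at distance at least `δ` are penalized
    -- by at least `a`, so only nearby points matter.
    obtain ⟨N, hN⟩ := exists_nat_ge (max a.toReal (a.toReal / δ))
    filter_upwards [eventually_ge_atTop N] with k hk
    have hkN : (N : ℝ) ≤ k := by exact_mod_cast hk
    have hk1 : a.toReal ≤ k := (le_max_left _ _).trans (hN.trans hkN)
    have hk2 : a.toReal ≤ k * δ := by
      rw [← div_le_iff₀ hδ]; exact (le_max_right _ _).trans (hN.trans hkN)
    rw [← ENNReal.ofReal_toReal hat]
    refine ENNReal.ofReal_le_ofReal (le_ciInf fun y => ?_)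
    by_cases hy : dist (y : E) x < δ
    · have h1 : a < v y := hδv ⟨hy, y.2⟩
      have h2 : a ≤ min (v y) k := le_min h1.le (by
        rw [← ENNReal.ofReal_toReal hat, ← ENNReal.ofReal_natCast]
        exact ENNReal.ofReal_le_ofReal hk1)
      have h3 : a.toReal ≤ g k y := ENNReal.toReal_mono (hgt k y) h2
      have : 0 ≤ (k : ℝ) * dist x y := by positivity
      linarith
    · have h1 : δ ≤ dist x y := by rw [dist_comm]; exact not_lt.1 hy
      have := mul_le_mul_of_nonneg_left h1 (Nat.cast_nonneg (α := ℝ) k)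
      have := hg0 k y
      linarith

lemma IsHarmonicLimit.const_sub {n : ℕ} {ρ : ℝ} {h : EuclideanSpace ℝ (Fin n) → ℝ}
    (hh : IsHarmonicLimit ρ h) (c : ℝ) : IsHarmonicLimit ρ fun x => c - h x := by
  intro ε hε
  obtain ⟨k, hk, hhk⟩ := hh ε hε
  refine ⟨fun x => c + - k x, fun x hx => ⟨contDiffAt_const.add (hk x hx).1.neg, ?_⟩,
    fun x hx => ?_⟩
  · rw [hessian_add contDiffAt_const (hk x hx).1.neg, hessian_const, hessian_neg (hk x hx).1,
      zero_add, Matrix.trace_neg, (hk x hx).2, neg_zero]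
  · have := hhk x hx
    rw [abs_sub_comm] at this
    convert this using 2
    ring

lemma integrable_mul_poissonKernel {n : ℕ} [NeZero n]
    {f : Metric.sphere (0 : EuclideanSpace ℝ (Fin n)) 1 → ℝ} (hf : Continuous f)
    {x : EuclideanSpace ℝ (Fin n)} (hx : ‖x‖ < 1) :
    Integrable (fun σ => f σ * poissonKernel (σ : EuclideanSpace ℝ (Fin n)) x) (sphereProb n) :=
  (hf.mul (continuous_poissonKernel_sphere hx)).integrable_of_hasCompactSupport
    (HasCompactSupport.of_compactSpace _)

/-- Boundary values of the Poisson integral of a Lipschitz function. -/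
lemma abs_poisson_sub_le {n : ℕ} [NeZero n] {f : EuclideanSpace ℝ (Fin n) → ℝ} {L M δ : ℝ}
    (hL0 : 0 ≤ L) (hL : ∀ x y, f x ≤ f y + L * dist x y) (hδ : 0 < δ)
    (hf0 : ∀ x, 0 ≤ f x) (hfM : ∀ x ∈ Metric.closedBall (0 : EuclideanSpace ℝ (Fin n)) 1, f x ≤ M)
    {x : EuclideanSpace ℝ (Fin n)} (hx : ‖x‖ < 1) :
    |(∫ σ, f σ * poissonKernel (σ : EuclideanSpace ℝ (Fin n)) x ∂(sphereProb n)) - f x| ≤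
      L * δ + M * ((1 - ‖x‖ ^ 2) / δ ^ n) := by
  have hfc : Continuous f := by
    refine LipschitzWith.continuous (K := L.toNNReal) (LipschitzWith.of_le_add_mul _ fun x y => ?_)
    rw [Real.coe_toNNReal _ hL0]; exact hL x y
  have hfc' : Continuous fun σ : Metric.sphere (0 : EuclideanSpace ℝ (Fin n)) 1 => f σ :=
    hfc.comp continuous_subtype_val
  have i1 := integrable_mul_poissonKernel hfc' hx
  have i2 : Integrable (fun σ : Metric.sphere (0 : EuclideanSpace ℝ (Fin n)) 1 =>
      f x * poissonKernel (σ : EuclideanSpace ℝ (Fin n)) x) (sphereProb n) :=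
    integrable_mul_poissonKernel continuous_const hx
  have i3 : Integrable (fun σ : Metric.sphere (0 : EuclideanSpace ℝ (Fin n)) 1 =>
      L * δ * poissonKernel (σ : EuclideanSpace ℝ (Fin n)) x) (sphereProb n) :=
    integrable_mul_poissonKernel continuous_const hx
  have h1 : f x = ∫ σ, f x * poissonKernel (σ : EuclideanSpace ℝ (Fin n)) x ∂(sphereProb n) := by
    rw [integral_const_mul, integral_poissonKernel hx, mul_one]
  have h2 : L * δ + M * ((1 - ‖x‖ ^ 2) / δ ^ n) = ∫ σ, (L * δ * poissonKernel (σ :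
      EuclideanSpace ℝ (Fin n)) x + M * ((1 - ‖x‖ ^ 2) / δ ^ n)) ∂(sphereProb n) := by
    rw [integral_add i3 (integrable_const _), integral_const_mul, integral_poissonKernel hx,
      mul_one]
    simp
  conv_lhs => rw [h1]
  rw [h2, ← integral_sub i1 i2, ← Real.norm_eq_abs]
  refine norm_integral_le_of_norm_le (i3.add (integrable_const _)) (Eventually.of_forall fun σ => ?_)
  have hσ : ‖(σ : EuclideanSpace ℝ (Fin n))‖ = 1 := by simp
  have hP := poissonKernel_pos hσ hx
  have hx2 : 0 < 1 - ‖x‖ ^ 2 := by nlinarith [norm_nonneg x]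
  have hfx := hfM x (mem_closedBall_zero_iff.2 hx.le)
  have hfσ := hfM σ (mem_closedBall_zero_iff.2 hσ.le)
  have hM : 0 ≤ M := (hf0 x).trans hfx
  rw [← sub_mul, Real.norm_eq_abs, abs_mul, abs_of_pos hP]
  -- Near `x` the Lipschitz bound controls the difference; far from `x` the kernel is at most `(1 -
  -- |x|²) / δ^n`.
  by_cases hd : dist x (σ : EuclideanSpace ℝ (Fin n)) ≤ δ
  · have h3 : |f σ - f x| ≤ L * δ := by
      have a1 := hL x σ
      have a2 := hL σ x
      rw [dist_comm] at a2
      have a3 := mul_le_mul_of_nonneg_left hd hL0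
      rw [abs_le]; constructor <;> linarith
    have h4 := mul_le_mul_of_nonneg_right h3 hP.le
    have : 0 ≤ M * ((1 - ‖x‖ ^ 2) / δ ^ n) := by positivity
    linarith
  · have h3 : |f σ - f x| ≤ M := by
      rw [abs_le]; constructor <;> linarith [hf0 x, hf0 σ]
    have h4 : poissonKernel (σ : EuclideanSpace ℝ (Fin n)) x ≤ (1 - ‖x‖ ^ 2) / δ ^ n := by
      unfold poissonKernel
      rw [← dist_eq_norm]
      gcongr
      exact (not_le.1 hd).le
    have h5 := mul_le_mul h3 h4 hP.le hM
    have : 0 ≤ L * δ * poissonKernel (σ : EuclideanSpace ℝ (Fin n)) x := by positivity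
    linarith

/-- Comparison takes place on a sphere of radius `ρ` slightly less than one, where the Poisson
integral is within `ε` of `f`. This is why the bound `u ≤ c - f` is assumed on the whole closed ball
and not only on its boundary. -/
lemma IsSubharmonicOn.le_sub_poisson {n : ℕ} [NeZero n]
    {u : EuclideanSpace ℝ (Fin n) → EReal} {X : Set (EuclideanSpace ℝ (Fin n))}
    (hu : IsSubharmonicOn {A | 0 ≤ A.trace} u X)
    (hX : Metric.closedBall 0 1 ⊆ X) {f : EuclideanSpace ℝ (Fin n) → ℝ} {L M c : ℝ}
    (hL0 : 0 ≤ L) (hL : ∀ x y, f x ≤ f y + L * dist x y)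
    (hf0 : ∀ x, 0 ≤ f x) (hfM : ∀ x ∈ Metric.closedBall (0 : EuclideanSpace ℝ (Fin n)) 1, f x ≤ M)
    (hb : ∀ x ∈ Metric.closedBall (0 : EuclideanSpace ℝ (Fin n)) 1, u x ≤ ((c - f x : ℝ) : EReal))
    {x : EuclideanSpace ℝ (Fin n)} (hx : ‖x‖ < 1) :
    u x ≤ ((c - ∫ σ, f σ * poissonKernel (σ : EuclideanSpace ℝ (Fin n)) x ∂(sphereProb n) : ℝ) :
      EReal) := by
  refine EReal.le_of_forall_lt_iff_le.1 fun z hz => ?_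
  set h : EuclideanSpace ℝ (Fin n) → ℝ := fun x =>
    ∫ σ, f σ * poissonKernel (σ : EuclideanSpace ℝ (Fin n)) x ∂(sphereProb n) with hh
  set ε : ℝ := z - (c - h x) with hε
  have hεpos : 0 < ε := by have := EReal.coe_lt_coe_iff.1 hz; simp only [hε]; linarith
  set δ : ℝ := ε / (2 * (L + 1)) with hδ
  have hδpos : 0 < δ := by positivity
  have hLδ : L * δ ≤ ε / 2 := by
    rw [hδ, mul_div_assoc', div_le_div_iff₀ (by positivity) (by positivity)]
    nlinarith
  have hcont : Tendsto (fun ρ : ℝ => M * ((1 - ρ ^ 2) / δ ^ n)) (𝓝[<] 1) (𝓝 0) := by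
    have : Continuous fun ρ : ℝ => M * ((1 - ρ ^ 2) / δ ^ n) := by fun_prop
    have h2 := this.tendsto 1
    simp only [one_pow, sub_self, zero_div, mul_zero] at h2
    exact h2.mono_left nhdsWithin_le_nhds
  obtain ⟨ρ, hρM, hρx, hρ1⟩ := ((hcont.eventually (gt_mem_nhds (half_pos hεpos))).and
    ((eventually_nhdsWithin_of_eventually_nhds (lt_mem_nhds hx)).and
      self_mem_nhdsWithin)).exists
  have hρ1' : ρ < 1 := hρ1
  have hfc : Continuous f := by
    refine LipschitzWith.continuous (K := L.toNNReal) (LipschitzWith.of_le_add_mul _ fun x y => ?_)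
    rw [Real.coe_toNNReal _ hL0]; exact hL x y
  have hlim : IsHarmonicLimit ρ h := isHarmonicLimit_poisson (n := n)
    ⟨fun σ => f (σ : EuclideanSpace ℝ (Fin n)), hfc.comp continuous_subtype_val⟩ hρ1'
  have := hu.le_of_isHarmonicLimit hρ1' ((Metric.closedBall_subset_closedBall hρ1'.le).trans hX)
    (hlim.const_sub (c + ε)) (fun y hy => ?_) (x := x) hρx.le
  · refine this.trans (EReal.coe_le_coe_iff.2 ?_)
    simp only [hε]; linarith
  · refine (hb y (mem_closedBall_zero_iff.2 (by linarith))).trans (EReal.coe_le_coe_iff.2 ?_)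
    have h1 := (abs_le.1 (abs_poisson_sub_le hL0 hL hδpos hf0 hfM (x := y) (by linarith))).2
    rw [hy] at h1
    change h y - f y ≤ _ at h1
    linarith

/-- **The Poisson inequality** for subharmonic functions on the unit ball. -/
theorem IsSubharmonicOn.lintegral_poissonKernel_le {n : ℕ} [NeZero n]
    {u : EuclideanSpace ℝ (Fin n) → EReal} {X : Set (EuclideanSpace ℝ (Fin n))}
    (hu : IsSubharmonicOn {A | 0 ≤ A.trace} u X)
    (hX : Metric.closedBall 0 1 ⊆ X) {c : ℝ}
    (hc : ∀ x ∈ Metric.closedBall (0 : EuclideanSpace ℝ (Fin n)) 1, u x ≤ c)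
    {x : EuclideanSpace ℝ (Fin n)} (hx : ‖x‖ < 1) :
    ∫⁻ σ, ENNReal.ofReal (poissonKernel (σ : EuclideanSpace ℝ (Fin n)) x) * coFun c (u σ)
      ∂(sphereProb n) ≤ coFun c (u x) := by
  obtain ⟨f, hf0, hfk, hfL, hfv, hflim⟩ :=
    exists_lipschitz_approx (lowerSemicontinuousOn_coFun (hu.usc.mono hX) c)
  have hfc : ∀ k, Continuous (f k) := fun k => by
    refine LipschitzWith.continuous (K := (k : ℝ).toNNReal)
      (LipschitzWith.of_le_add_mul _ fun x y => ?_)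
    rw [Real.coe_toNNReal _ (Nat.cast_nonneg k)]; exact hfL k x y
  have hmem : ∀ σ : Metric.sphere (0 : EuclideanSpace ℝ (Fin n)) 1,
      (σ : EuclideanSpace ℝ (Fin n)) ∈ Metric.closedBall (0 : EuclideanSpace ℝ (Fin n)) 1 :=
    fun σ => Metric.sphere_subset_closedBall σ.2
  have hP : ∀ σ : Metric.sphere (0 : EuclideanSpace ℝ (Fin n)) 1,
      0 < poissonKernel (σ : EuclideanSpace ℝ (Fin n)) x := fun σ =>
    poissonKernel_pos (by simp) hx
  have hk : ∀ k, ∫⁻ σ, ENNReal.ofReal (poissonKernel (σ : EuclideanSpace ℝ (Fin n)) x) *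
      ENNReal.ofReal (f k σ) ∂(sphereProb n) ≤ coFun c (u x) := by
    intro k
    have h1 := hu.le_sub_poisson hX (Nat.cast_nonneg k) (hfL k) (hf0 k) (hfk k) (c := c)
      (fun y hy => by
        have h2 := hfv k y hy
        by_cases hy0 : u y = ⊥
        · simp [hy0]
        obtain ⟨a, ha⟩ : ∃ a : ℝ, u y = a :=
          ⟨_, (EReal.coe_toReal (hu.ne_top y (hX hy)) hy0).symm⟩
        have h3 := hc y hy
        rw [ha, EReal.coe_le_coe_iff] at h3
        rw [ha, coFun_coe, ENNReal.ofReal_le_ofReal_iff (by linarith)] at h2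
        rw [ha, EReal.coe_le_coe_iff]
        linarith) hx
    have h2 := antitone_coFun c h1
    rw [coFun_coe, sub_sub_cancel, ofReal_integral_eq_lintegral_ofReal] at h2
    · refine le_trans (le_of_eq ?_) h2
      refine lintegral_congr fun σ => ?_
      rw [mul_comm, ← ENNReal.ofReal_mul (hf0 k σ)]
    · exact integrable_mul_poissonKernel ((hfc k).comp continuous_subtype_val) hx
    · exact Eventually.of_forall fun σ => mul_nonneg (hf0 k σ) (hP σ).le
  -- The approximants need not increase with `k`; Fatou's lemma and the pointwise lower bound on
  -- their limit inferior suffice.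
  calc _ ≤ ∫⁻ σ, liminf (fun k => ENNReal.ofReal (poissonKernel (σ : EuclideanSpace ℝ (Fin n)) x) *
        ENNReal.ofReal (f k σ)) atTop ∂(sphereProb n) := by
        refine lintegral_mono fun σ => ?_
        refine ENNReal.mul_le_of_forall_lt fun p hp a ha => ?_
        refine le_liminf_of_le (by isBoundedDefault) ?_
        filter_upwards [hflim σ (hmem σ) a ha] with k hka
        exact mul_le_mul' hp.le hka
    _ ≤ liminf (fun k => ∫⁻ σ, ENNReal.ofReal (poissonKernel (σ : EuclideanSpace ℝ (Fin n)) x) *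
        ENNReal.ofReal (f k σ) ∂(sphereProb n)) atTop := by
        refine lintegral_liminf_le fun k => ?_
        exact ((continuous_poissonKernel_sphere hx).measurable.ennreal_ofReal).mul
          ((hfc k).comp continuous_subtype_val).measurable.ennreal_ofReal
    _ ≤ _ := by
        refine liminf_le_of_le (by isBoundedDefault) fun b hb => ?_
        obtain ⟨k, hbk⟩ := hb.exists
        exact hbk.trans (hk k)

/-! ### Linear changes of variables -/

/-- The linear map on Euclidean space given by a matrix. -/
noncomputable abbrev matCLM {n : ℕ} (M : Matrix (Fin n) (Fin n) ℝ) :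
    EuclideanSpace ℝ (Fin n) →L[ℝ] EuclideanSpace ℝ (Fin n) :=
  Matrix.toEuclideanCLM (n := Fin n) (𝕜 := ℝ) M

lemma matCLM_mul_apply {n : ℕ} (M N : Matrix (Fin n) (Fin n) ℝ) (x : EuclideanSpace ℝ (Fin n)) :
    matCLM (M * N) x = matCLM M (matCLM N x) := by
  simp [matCLM]

lemma matCLM_one_apply {n : ℕ} (x : EuclideanSpace ℝ (Fin n)) :
    matCLM (1 : Matrix (Fin n) (Fin n) ℝ) x = x := by
  simp [matCLM]

lemma matCLM_smul_apply {n : ℕ} (r : ℝ) (M : Matrix (Fin n) (Fin n) ℝ)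
    (x : EuclideanSpace ℝ (Fin n)) : matCLM (r • M) x = r • matCLM M x := by
  simp [matCLM]

lemma hessian_comp_matCLM {n : ℕ} {φ : EuclideanSpace ℝ (Fin n) → ℝ}
    (M : Matrix (Fin n) (Fin n) ℝ) (b : EuclideanSpace ℝ (Fin n))
    {x : EuclideanSpace ℝ (Fin n)} (h : ContDiffAt ℝ 2 φ (matCLM M x + b)) :
    hessian (fun y => φ (matCLM M y + b)) x = M.transpose * hessian φ (matCLM M x + b) * M := by
  rw [hessian_comp_affine (matCLM M) b h]
  ext i j
  rw [Matrix.of_apply, ← dotProduct_hessian, Matrix.ofLp_toEuclideanCLM,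
    Matrix.ofLp_toEuclideanCLM, Matrix.mul_assoc, Matrix.mul_apply]
  simp [dotProduct, Matrix.mul_apply, Matrix.mulVec]

/-- A test function for the composition becomes one for `u` after composing with the inverse affine
map, and the Hessian transforms by congruence. -/
lemma IsSubharmonicOn.comp_matCLM {n : ℕ} {F F' : Set (Matrix (Fin n) (Fin n) ℝ)}
    {u : EuclideanSpace ℝ (Fin n) → EReal} {X : Set (EuclideanSpace ℝ (Fin n))}
    (hu : IsSubharmonicOn F u X) {M N : Matrix (Fin n) (Fin n) ℝ} (hMN : M * N = 1)
    (hF : ∀ H ∈ F, M.transpose * H * M ∈ F') (b : EuclideanSpace ℝ (Fin n)) :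
    IsSubharmonicOn F' (fun y => u (matCLM M y + b)) {y | matCLM M y + b ∈ X} := by
  have hNM : N * M = 1 := mul_eq_one_comm.1 hMN
  have hc : Continuous fun y => matCLM M y + b := by fun_prop
  refine ⟨?_, fun y hy => hu.ne_top _ hy, fun y hy φ hφ hle heq => ?_⟩
  · exact UpperSemicontinuousOn.comp hu.usc hc.continuousOn fun y hy => hy
  · set ψ : EuclideanSpace ℝ (Fin n) → ℝ := fun x => φ (matCLM N x + matCLM N (-b)) with hψ
    have hψφ : ∀ z, ψ (matCLM M z + b) = φ z := fun z => by
      simp only [hψ]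
      rw [map_add, ← matCLM_mul_apply, hNM, matCLM_one_apply, add_assoc, ← map_add, add_neg_cancel,
        map_zero, add_zero]
    have hinv : ∀ x, matCLM M (matCLM N x + matCLM N (-b)) + b = x := fun x => by
      rw [← map_add, ← matCLM_mul_apply, hMN, matCLM_one_apply]; abel
    have hinv' : ∀ z, matCLM N (matCLM M z + b) + matCLM N (-b) = z := fun z => by
      rw [← map_add, add_neg_cancel_right, ← matCLM_mul_apply, hNM, matCLM_one_apply]
    have hψc : ContDiffAt ℝ 2 ψ (matCLM M y + b) := by
      refine ContDiffAt.comp (f := fun x => matCLM N x + matCLM N (-b)) _ ?_ ?_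
      · rwa [hinv']
      · exact ((matCLM N).contDiff.add contDiff_const).contDiffAt
    have hmem : hessian ψ (matCLM M y + b) ∈ F := by
      refine hu.viscosity _ hy ψ hψc ?_ (by rw [hψφ]; exact heq)
      have hcont : ContinuousAt (fun x => matCLM N x + matCLM N (-b)) (matCLM M y + b) := by fun_prop
      have ht : Tendsto (fun x => matCLM N x + matCLM N (-b)) (𝓝 (matCLM M y + b)) (𝓝 y) := by
        have := hcont.tendsto
        rwa [hinv'] at this
      filter_upwards [ht.eventually hle] with x hx
      rwa [hinv] at hx
    have hfun : φ = fun z => ψ (matCLM M z + b) := funext fun z => (hψφ z).symm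
    rw [hfun, hessian_comp_matCLM M b hψc]
    exact hF _ hmem

/-- The mean value inequality over ellipsoids. -/
theorem IsSubharmonicOn.lintegral_ellipsoid_le {n : ℕ} [NeZero n]
    {F : Set (Matrix (Fin n) (Fin n) ℝ)}
    {u : EuclideanSpace ℝ (Fin n) → EReal} {X : Set (EuclideanSpace ℝ (Fin n))}
    (hu : IsSubharmonicOn F u X) {M N : Matrix (Fin n) (Fin n) ℝ} (hMN : M * N = 1)
    (hF : ∀ H ∈ F, 0 ≤ (M.transpose * H * M).trace) {b : EuclideanSpace ℝ (Fin n)} {c : ℝ}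
    (hX : ∀ y ∈ Metric.closedBall (0 : EuclideanSpace ℝ (Fin n)) 1,
      matCLM M y + b ∈ X ∧ u (matCLM M y + b) ≤ c) :
    ∫⁻ σ, coFun c (u (matCLM M (σ : EuclideanSpace ℝ (Fin n)) + b)) ∂(sphereProb n) ≤
      coFun c (u b) := by
  have h1 := (hu.comp_matCLM (F' := {A | 0 ≤ A.trace}) hMN hF b).lintegral_poissonKernel_le
    (fun y hy => (hX y hy).1) (fun y hy => (hX y hy).2) (x := 0) (by simp)
  simp only [map_zero, zero_add] at h1
  refine le_trans (le_of_eq (lintegral_congr fun σ => ?_)) h1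
  rw [poissonKernel_zero (by simp)]
  simp

/-- The Poisson inequality on a ball centred at the origin. -/
theorem IsSubharmonicOn.lintegral_poissonKernel_ball_le {n : ℕ} [NeZero n]
    {F : Set (Matrix (Fin n) (Fin n) ℝ)} (hF : ∀ H ∈ F, 0 ≤ H.trace)
    {u : EuclideanSpace ℝ (Fin n) → EReal} {X : Set (EuclideanSpace ℝ (Fin n))}
    (hu : IsSubharmonicOn F u X) {R : ℝ} (hR : 0 < R) (hX : Metric.closedBall 0 R ⊆ X) {c : ℝ}
    (hc : ∀ x ∈ Metric.closedBall (0 : EuclideanSpace ℝ (Fin n)) R, u x ≤ c)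
    {x : EuclideanSpace ℝ (Fin n)} (hx : ‖x‖ < 1) :
    ∫⁻ σ, ENNReal.ofReal (poissonKernel (σ : EuclideanSpace ℝ (Fin n)) x) *
      coFun c (u (R • (σ : EuclideanSpace ℝ (Fin n)))) ∂(sphereProb n) ≤ coFun c (u (R • x)) := by
  have hR1 : (R • (1 : Matrix (Fin n) (Fin n) ℝ)) * (R⁻¹ • 1) = 1 := by
    rw [Matrix.smul_mul, Matrix.one_mul, smul_smul, mul_inv_cancel₀ hR.ne', one_smul]
  have hmat : ∀ y : EuclideanSpace ℝ (Fin n), matCLM (R • 1) y + 0 = R • y := fun y => by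
    rw [matCLM_smul_apply, matCLM_one_apply, add_zero]
  have hball : ∀ y ∈ Metric.closedBall (0 : EuclideanSpace ℝ (Fin n)) 1,
      R • y ∈ Metric.closedBall (0 : EuclideanSpace ℝ (Fin n)) R := fun y hy => by
    rw [mem_closedBall_zero_iff] at hy ⊢
    rw [norm_smul, Real.norm_of_nonneg hR.le]
    nlinarith
  have h1 := (hu.comp_matCLM (F' := {A | 0 ≤ A.trace}) hR1 (fun H hH => by
    simp only [mem_ofPred_eq, Matrix.transpose_smul, Matrix.transpose_one, Matrix.smul_mul,
      Matrix.one_mul, Matrix.mul_smul, Matrix.mul_one, Matrix.trace_smul, smul_eq_mul]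
    have := hF H hH
    positivity) 0).lintegral_poissonKernel_le (c := c)
    (fun y hy => by
      simp only [mem_ofPred_eq, hmat]
      exact hX (hball y hy)) (fun y hy => by rw [hmat]; exact hc _ (hball y hy)) hx
  simpa only [hmat] using h1

/-! ### Averages over rotations -/

/-- The spherical mean of a non-negative function. -/
noncomputable def sphMean {n : ℕ} (f : EuclideanSpace ℝ (Fin n) → ENNReal) (r : ℝ) : ENNReal :=
  ∫⁻ σ, f (r • (σ : EuclideanSpace ℝ (Fin n))) ∂(sphereProb n)

/-- The linear isometry given by an orthogonal matrix. -/
noncomputable def rotIso {n : ℕ} (g : Matrix.unitaryGroup (Fin n) ℝ) :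
    EuclideanSpace ℝ (Fin n) ≃ₗᵢ[ℝ] EuclideanSpace ℝ (Fin n) :=
  LinearIsometry.toLinearIsometryEquiv
    ⟨(matCLM (g : Matrix (Fin n) (Fin n) ℝ) : EuclideanSpace ℝ (Fin n) →ₗ[ℝ] _), fun x => by
      have h : ‖matCLM (g : Matrix (Fin n) (Fin n) ℝ) x‖ ^ 2 = ‖x‖ ^ 2 := by
        have hg : (g : Matrix (Fin n) (Fin n) ℝ).transpose * (g : Matrix (Fin n) (Fin n) ℝ) = 1 :=
          by simpa [Matrix.star_eq_conjTranspose] using Matrix.UnitaryGroup.star_mul_self g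
        rw [← ofLp_dotProduct_self, ← ofLp_dotProduct_self, Matrix.ofLp_toEuclideanCLM,
          Matrix.dotProduct_mulVec, ← Matrix.mulVec_transpose, Matrix.mulVec_mulVec, hg,
          Matrix.one_mulVec]
      exact (sq_eq_sq₀ (norm_nonneg _) (norm_nonneg _)).1 h⟩ rfl

lemma rotIso_apply {n : ℕ} (g : Matrix.unitaryGroup (Fin n) ℝ) (x : EuclideanSpace ℝ (Fin n)) :
    rotIso g x = matCLM (g : Matrix (Fin n) (Fin n) ℝ) x := rfl

lemma rotIso_mul {n : ℕ} (g h : Matrix.unitaryGroup (Fin n) ℝ) (x : EuclideanSpace ℝ (Fin n)) :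
    rotIso (g * h) x = rotIso g (rotIso h x) := by
  simp only [rotIso_apply, Matrix.UnitaryGroup.mul_val, matCLM_mul_apply]

lemma continuous_rotIso {n : ℕ} : Continuous fun p : Matrix.unitaryGroup (Fin n) ℝ ×
    EuclideanSpace ℝ (Fin n) => rotIso p.1 p.2 := by
  refine (PiLp.continuous_toLp 2 _).comp (f := fun p : Matrix.unitaryGroup (Fin n) ℝ ×
    EuclideanSpace ℝ (Fin n) => (p.1 : Matrix (Fin n) (Fin n) ℝ).mulVec p.2.ofLp) ?_
  exact Continuous.matrix_mulVec (continuous_subtype_val.comp continuous_fst)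
    ((PiLp.continuous_ofLp 2 _).comp continuous_snd)

lemma lintegral_sphere_average {n : ℕ} {Ω : Type*} [MeasurableSpace Ω] {ν : Measure Ω}
    [IsProbabilityMeasure ν] [NeZero n]
    {T : Ω → EuclideanSpace ℝ (Fin n) ≃ₗᵢ[ℝ] EuclideanSpace ℝ (Fin n)}
    (hT : Measurable fun p : Ω × EuclideanSpace ℝ (Fin n) => T p.1 p.2)
    {f : EuclideanSpace ℝ (Fin n) → ENNReal} (hf : Measurable f) (r : ℝ) :
    ∫⁻ σ : Metric.sphere (0 : EuclideanSpace ℝ (Fin n)) 1,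
      ∫⁻ ω, f (T ω (r • (σ : EuclideanSpace ℝ (Fin n)))) ∂ν ∂(sphereProb n) = sphMean f r := by
  rw [lintegral_lintegral_swap]
  · have h1 : ∀ ω, ∫⁻ σ : Metric.sphere (0 : EuclideanSpace ℝ (Fin n)) 1,
        f (T ω (r • (σ : EuclideanSpace ℝ (Fin n)))) ∂(sphereProb n) = sphMean f r := by
      intro ω
      simp only [map_smul]
      exact lintegral_sphere_comp (T ω) (f := fun y => f (r • y)) (hf.comp (measurable_const_smul _))
    simp_rw [h1]
    simp
  · refine (hf.comp (hT.comp (measurable_snd.prodMk ?_))).aemeasurable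
    exact (measurable_const_smul r).comp (measurable_subtype_coe.comp measurable_fst)

/-- The spherical mean is an average over any closed group of rotations which is transitive on the
sphere. -/
theorem exists_rotation_average {n : ℕ} [NeZero n] (G : Subgroup (Matrix.unitaryGroup (Fin n) ℝ))
    (hG : IsClosed (G : Set (Matrix.unitaryGroup (Fin n) ℝ)))
    (htrans : ∀ x y : EuclideanSpace ℝ (Fin n), ‖x‖ = ‖y‖ → ∃ g ∈ G, rotIso g x = y) :
    ∃ (Ω : Type) (_ : MeasurableSpace Ω) (ν : Measure Ω) (_ : IsProbabilityMeasure ν)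
      (ρ : Ω → Matrix.unitaryGroup (Fin n) ℝ),
      (∀ ω, ρ ω ∈ G) ∧ Measurable (fun p : Ω × EuclideanSpace ℝ (Fin n) => rotIso (ρ p.1) p.2) ∧
      ∀ f : EuclideanSpace ℝ (Fin n) → ENNReal, Measurable f → ∀ x,
        ∫⁻ ω, f (rotIso (ρ ω) x) ∂ν = sphMean f ‖x‖ := by
  let _ : MeasurableSpace G := borel G
  have : BorelSpace G := ⟨rfl⟩
  have : SecondCountableTopology (Matrix (Fin n) (Fin n) ℝ) :=
    inferInstanceAs (SecondCountableTopology (Fin n → Fin n → ℝ))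
  have : SecondCountableTopology (Matrix.unitaryGroup (Fin n) ℝ) :=
    TopologicalSpace.Subtype.secondCountableTopology _
  have : SecondCountableTopology G :=
    TopologicalSpace.Subtype.secondCountableTopology _
  have : CompactSpace (Matrix.unitaryGroup (Fin n) ℝ) := by
    refine isCompact_iff_compactSpace.1 ?_
    have hbox : IsCompact {A : Matrix (Fin n) (Fin n) ℝ |
        ∀ i, A i ∈ {a : Fin n → ℝ | ∀ j, a j ∈ Icc (-1 : ℝ) 1}} :=
      isCompact_pi_infinite fun _ => isCompact_pi_infinite fun _ => isCompact_Icc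
    refine hbox.of_isClosed_subset ?_ fun A hA i j => ?_
    · exact isClosed_unitary (R := Matrix (Fin n) (Fin n) ℝ)
    · exact abs_le.1 (entry_norm_bound_of_unitary (𝕜 := ℝ) hA i j)
  have : CompactSpace G := isCompact_iff_compactSpace.1 hG.isCompact
  -- Normalizing on the whole compact group makes Haar measure a probability measure.
  set ν : Measure G := Measure.haarMeasure ⊤ with hν
  have hprob : IsProbabilityMeasure ν := ⟨Measure.haarMeasure_self (K₀ := ⊤)⟩
  have hcont : Continuous fun p : G × EuclideanSpace ℝ (Fin n) =>
      rotIso ((p.1⁻¹ : G) : Matrix.unitaryGroup (Fin n) ℝ) p.2 :=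
    continuous_rotIso.comp (f := fun p : G × EuclideanSpace ℝ (Fin n) =>
      (((p.1⁻¹ : G) : Matrix.unitaryGroup (Fin n) ℝ), p.2))
      ((continuous_subtype_val.comp continuous_fst.inv).prodMk continuous_snd)
  -- Rotating by `g⁻¹` turns left invariance of Haar measure into invariance of the average under
  -- moving the base point.
  refine ⟨G, inferInstance, ν, hprob, fun g => ((g⁻¹ : G) : Matrix.unitaryGroup (Fin n) ℝ),
    fun g => (g⁻¹ : G).2, hcont.measurable, fun f hf x => ?_⟩
  set I : EuclideanSpace ℝ (Fin n) → ENNReal := fun x =>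
    ∫⁻ g : G, f (rotIso ((g⁻¹ : G) : Matrix.unitaryGroup (Fin n) ℝ) x) ∂ν with hI
  have hinv : ∀ (h : G) (x : EuclideanSpace ℝ (Fin n)),
      I (rotIso (h : Matrix.unitaryGroup (Fin n) ℝ) x) = I x := by
    intro h x
    have h1 := lintegral_mul_left_eq_self (μ := ν)
      (fun g : G => f (rotIso ((g⁻¹ : G) : Matrix.unitaryGroup (Fin n) ℝ) x)) h⁻¹
    refine Eq.trans (lintegral_congr fun g => ?_) h1
    rw [mul_inv_rev, inv_inv, Subgroup.coe_mul, rotIso_mul]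
  have hconst : ∀ y, ‖x‖ = ‖y‖ → I y = I x := by
    intro y hy
    obtain ⟨g, hg, rfl⟩ := htrans x y hy
    exact hinv ⟨g, hg⟩ x
  -- The group average is constant on the sphere through `x`, hence equals its own spherical mean.
  -- After exchanging integrals each rotation disappears, since it preserves the surface measure.
  calc I x = ∫⁻ σ : Metric.sphere (0 : EuclideanSpace ℝ (Fin n)) 1,
        I (‖x‖ • (σ : EuclideanSpace ℝ (Fin n))) ∂(sphereProb n) := by
        rw [lintegral_congr (g := fun _ => I x) fun σ => hconst _ (by simp [norm_smul])]
        simp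
    _ = sphMean f ‖x‖ := lintegral_sphere_average
        (T := fun g : G => rotIso ((g⁻¹ : G) : Matrix.unitaryGroup (Fin n) ℝ)) hcont.measurable
        hf ‖x‖

/-! ### The invariance group of a subequation -/

/-- The group of all orthogonal matrices which preserve `F` under conjugation. -/
def invGroup {n : ℕ} (F : Set (Matrix (Fin n) (Fin n) ℝ)) :
    Subgroup (Matrix.unitaryGroup (Fin n) ℝ) where
  carrier := {g | ∀ A ∈ F,
    (g : Matrix (Fin n) (Fin n) ℝ) * A * (g : Matrix (Fin n) (Fin n) ℝ).transpose ∈ F ∧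
    (g : Matrix (Fin n) (Fin n) ℝ).transpose * A * (g : Matrix (Fin n) (Fin n) ℝ) ∈ F}
  mul_mem' := by
    intro a b ha hb A hA
    constructor
    · have := (ha _ (hb A hA).1).1
      simpa only [Matrix.UnitaryGroup.mul_val, Matrix.transpose_mul, Matrix.mul_assoc] using this
    · have := (hb _ (ha A hA).2).2
      simpa only [Matrix.UnitaryGroup.mul_val, Matrix.transpose_mul, Matrix.mul_assoc] using this
  one_mem' := by intro A hA; simpa using hA
  inv_mem' := by
    intro a ha A hA
    have h : ((a⁻¹ : Matrix.unitaryGroup (Fin n) ℝ) : Matrix (Fin n) (Fin n) ℝ) =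
        (a : Matrix (Fin n) (Fin n) ℝ).transpose := by
      rw [Matrix.UnitaryGroup.inv_val, Matrix.star_eq_conjTranspose,
        Matrix.conjTranspose_eq_transpose_of_trivial]
    rw [h, Matrix.transpose_transpose]
    exact ⟨(ha A hA).2, (ha A hA).1⟩

lemma isClosed_invGroup {n : ℕ} {F : Set (Matrix (Fin n) (Fin n) ℝ)} (hF : IsClosed F) :
    IsClosed (invGroup F : Set (Matrix.unitaryGroup (Fin n) ℝ)) := by
  have h : (invGroup F : Set (Matrix.unitaryGroup (Fin n) ℝ)) = ⋂ A ∈ F,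
      {g : Matrix.unitaryGroup (Fin n) ℝ |
        (g : Matrix (Fin n) (Fin n) ℝ) * A * (g : Matrix (Fin n) (Fin n) ℝ).transpose ∈ F} ∩
      {g : Matrix.unitaryGroup (Fin n) ℝ |
        (g : Matrix (Fin n) (Fin n) ℝ).transpose * A * (g : Matrix (Fin n) (Fin n) ℝ) ∈ F} := by
    ext g
    simp only [mem_iInter]
    rfl
  rw [h]
  have hc : Continuous fun g : Matrix.unitaryGroup (Fin n) ℝ => (g : Matrix (Fin n) (Fin n) ℝ) :=
    continuous_subtype_val
  refine isClosed_biInter fun A _ => (hF.preimage ?_).inter (hF.preimage ?_)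
  · exact (hc.matrix_mul continuous_const).matrix_mul hc.matrix_transpose
  · exact (hc.matrix_transpose.matrix_mul continuous_const).matrix_mul hc

/-- The given transitive group need not be closed. The full stabilizer of `F` contains it and is
closed, so it is the group that carries a Haar measure. -/
lemma IsSTInvariant.exists_mem_invGroup {n : ℕ} {F : Set (Matrix (Fin n) (Fin n) ℝ)}
    (hST : IsSTInvariant F) {x y : EuclideanSpace ℝ (Fin n)} (hxy : ‖x‖ = ‖y‖) :
    ∃ g ∈ invGroup F, rotIso g x = y := by
  by_cases hx : x = 0
  · refine ⟨1, one_mem _, ?_⟩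
    subst hx
    rw [norm_zero, eq_comm, norm_eq_zero] at hxy
    simp [hxy]
  obtain ⟨G, htrans, hGF⟩ := hST
  have hx0 : ‖x‖ ≠ 0 := norm_ne_zero_iff.2 hx
  have hunit : ∀ z : EuclideanSpace ℝ (Fin n), ‖z‖ = ‖x‖ →
      (‖x‖⁻¹ • z).ofLp ⬝ᵥ (‖x‖⁻¹ • z).ofLp = 1 := fun z hz => by
    rw [ofLp_dotProduct_self, norm_smul, hz, norm_inv, norm_norm, inv_mul_cancel₀ hx0, one_pow]
  obtain ⟨g, hg, hgx⟩ := htrans _ _ (hunit x rfl) (hunit y hxy.symm)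
  have hmem : (g : Matrix (Fin n) (Fin n) ℝ) ∈ Matrix.unitaryGroup (Fin n) ℝ := by
    rw [Matrix.mem_unitaryGroup_iff, Matrix.star_eq_conjTranspose,
      Matrix.conjTranspose_eq_transpose_of_trivial]
    exact (Matrix.mem_orthogonalGroup_iff _ _).1 g.2
  refine ⟨⟨g, hmem⟩, fun A hA => ⟨hGF g hg A hA, ?_⟩, ?_⟩
  · have := hGF g⁻¹ (inv_mem hg) A hA
    have h : ((g⁻¹ : Matrix.orthogonalGroup (Fin n) ℝ) : Matrix (Fin n) (Fin n) ℝ) =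
        (g : Matrix (Fin n) (Fin n) ℝ).transpose := rfl
    rwa [h, Matrix.transpose_transpose] at this
  · have h2 : ∀ z : EuclideanSpace ℝ (Fin n), z = ‖x‖ • ‖x‖⁻¹ • z := fun z => by
      rw [smul_smul, mul_inv_cancel₀ hx0, one_smul]
    rw [h2 x, h2 y, map_smul]
    congr 1
    rw [rotIso_apply]
    ext i
    exact congrFun hgx i

/-- A family of rotations, parametrized by a probability space, whose averages are the spherical
means. -/
structure IsRotationAverage {n : ℕ} {Ω : Type*} [MeasurableSpace Ω] (ν : Measure Ω)
    (T : Ω → EuclideanSpace ℝ (Fin n) ≃ₗᵢ[ℝ] EuclideanSpace ℝ (Fin n)) : Prop where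
  prob : IsProbabilityMeasure ν
  measurable : Measurable fun p : Ω × EuclideanSpace ℝ (Fin n) => T p.1 p.2
  lintegral_eq : ∀ f : EuclideanSpace ℝ (Fin n) → ENNReal, Measurable f → ∀ x,
    ∫⁻ ω, f (T ω x) ∂ν = sphMean f ‖x‖

theorem IsConeSubequation.exists_isRotationAverage {n : ℕ} [NeZero n]
    {F : Set (Matrix (Fin n) (Fin n) ℝ)} (hF : IsConeSubequation F) (hST : IsSTInvariant F) :
    ∃ (Ω : Type) (_ : MeasurableSpace Ω) (ν : Measure Ω) (g : Ω → Matrix.unitaryGroup (Fin n) ℝ),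
      IsRotationAverage ν (fun ω => rotIso (g ω)) ∧ ∀ ω, g ω ∈ invGroup F := by
  obtain ⟨Ω, mΩ, ν, hν, ρ, hρ, hm, hav⟩ := exists_rotation_average (invGroup F)
    (isClosed_invGroup hF.closed) fun x y hxy => hST.exists_mem_invGroup hxy
  exact ⟨Ω, mΩ, ν, ρ, ⟨hν, hm, hav⟩, hρ⟩

/-! ### Spherical means and ball averages of nonnegative functions -/

section sphMean

variable {n : ℕ} {f g : EuclideanSpace ℝ (Fin n) → ENNReal}

lemma measurable_sphMean_norm [NeZero n] (hf : Measurable f) :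
    Measurable fun x : EuclideanSpace ℝ (Fin n) => sphMean f ‖x‖ := by
  refine Measurable.lintegral_prod_right' (f := fun p : EuclideanSpace ℝ (Fin n) ×
    Metric.sphere (0 : EuclideanSpace ℝ (Fin n)) 1 => f (‖p.1‖ • (p.2 : EuclideanSpace ℝ (Fin n))))
    (hf.comp ?_)
  exact (measurable_fst.norm).smul (measurable_subtype_coe.comp measurable_snd)

lemma sphMean_congr {r : ℝ} (h : ∀ x, ‖x‖ = |r| → f x = g x) : sphMean f r = sphMean g r :=
  lintegral_congr fun σ => h _ (by simp [norm_smul])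

lemma sphMean_mono {r : ℝ} (h : ∀ x, ‖x‖ = |r| → f x ≤ g x) : sphMean f r ≤ sphMean g r :=
  lintegral_mono fun σ => h _ (by simp [norm_smul])

end sphMean

/-- The average over the ball of radius `s` about `x`. -/
noncomputable def ballAvg {n : ℕ} (f : EuclideanSpace ℝ (Fin n) → ENNReal) (s : ℝ)
    (x : EuclideanSpace ℝ (Fin n)) : ENNReal :=
  (volume (Metric.ball (0 : EuclideanSpace ℝ (Fin n)) 1))⁻¹ *
    ∫⁻ y in Metric.ball (0 : EuclideanSpace ℝ (Fin n)) 1, f (x + s • y)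

lemma volume_unitBall_ne_zero (n : ℕ) :
    volume (Metric.ball (0 : EuclideanSpace ℝ (Fin n)) 1) ≠ 0 :=
  (Metric.measure_ball_pos _ _ one_pos).ne'

lemma volume_unitBall_ne_top (n : ℕ) :
    volume (Metric.ball (0 : EuclideanSpace ℝ (Fin n)) 1) ≠ ⊤ := measure_ball_lt_top.ne

lemma setLIntegral_ball_comp {n : ℕ}
    (T : EuclideanSpace ℝ (Fin n) ≃ₗᵢ[ℝ] EuclideanSpace ℝ (Fin n))
    (f : EuclideanSpace ℝ (Fin n) → ENNReal) :
    ∫⁻ y in Metric.ball (0 : EuclideanSpace ℝ (Fin n)) 1, f (T y) =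
      ∫⁻ y in Metric.ball (0 : EuclideanSpace ℝ (Fin n)) 1, f y := by
  have h := T.measurePreserving.setLIntegral_comp_preimage_emb T.toHomeomorph.measurableEmbedding f
    (Metric.ball (0 : EuclideanSpace ℝ (Fin n)) 1)
  have h2 : T ⁻¹' (Metric.ball (0 : EuclideanSpace ℝ (Fin n)) 1) = Metric.ball 0 1 := by
    ext y; simp
  rwa [h2] at h

namespace IsRotationAverage

variable {n : ℕ} {Ω : Type*} [MeasurableSpace Ω] {ν : Measure Ω}
  {T : Ω → EuclideanSpace ℝ (Fin n) ≃ₗᵢ[ℝ] EuclideanSpace ℝ (Fin n)}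
  {f : EuclideanSpace ℝ (Fin n) → ENNReal}

/-- The ball is invariant under each rotation, so averaging over rotations replaces `f` by its
spherical means. This takes the place of polar coordinates. -/
lemma setLIntegral_ball (h : IsRotationAverage ν T) (hf : Measurable f) :
    ∫⁻ y in Metric.ball (0 : EuclideanSpace ℝ (Fin n)) 1, f y =
      ∫⁻ y in Metric.ball (0 : EuclideanSpace ℝ (Fin n)) 1, sphMean f ‖y‖ := by
  have := h.prob
  calc ∫⁻ y in Metric.ball (0 : EuclideanSpace ℝ (Fin n)) 1, f y
      = ∫⁻ ω, (∫⁻ y in Metric.ball (0 : EuclideanSpace ℝ (Fin n)) 1, f (T ω y)) ∂ν := by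
        simp_rw [setLIntegral_ball_comp]; simp
    _ = _ := by
        rw [lintegral_lintegral_swap]
        · exact lintegral_congr fun y => h.lintegral_eq f hf y
        · exact (hf.comp h.measurable).aemeasurable

lemma ballAvg_eq (h : IsRotationAverage ν T) (hf : Measurable f) (s : ℝ)
    (x : EuclideanSpace ℝ (Fin n)) :
    ballAvg f s x = (volume (Metric.ball (0 : EuclideanSpace ℝ (Fin n)) 1))⁻¹ *
      ∫⁻ y in Metric.ball (0 : EuclideanSpace ℝ (Fin n)) 1,
        sphMean (fun z => f (x + z)) (s * ‖y‖) := by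
  rw [ballAvg]
  congr 1
  rw [h.setLIntegral_ball (f := fun y => f (x + s • y)) (by fun_prop)]
  refine lintegral_congr fun y => ?_
  simp only [sphMean, smul_smul]

/-- Spherical means commute with ball averages. -/
lemma sphMean_ballAvg (h : IsRotationAverage ν T) (hf : Measurable f) (s : ℝ)
    (x : EuclideanSpace ℝ (Fin n)) :
    sphMean (ballAvg f s) ‖x‖ = ballAvg (fun y => sphMean f ‖y‖) s x := by
  have := h.prob
  have hm : Measurable (ballAvg f s) := by
    refine Measurable.const_mul ?_ _
    refine Measurable.lintegral_prod_right' (f := fun p : EuclideanSpace ℝ (Fin n) ×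
      EuclideanSpace ℝ (Fin n) => f (p.1 + s • p.2)) (by fun_prop)
  rw [← h.lintegral_eq _ hm]
  calc ∫⁻ ω, ballAvg f s (T ω x) ∂ν
      = ∫⁻ ω, ((volume (Metric.ball (0 : EuclideanSpace ℝ (Fin n)) 1))⁻¹ *
          ∫⁻ y in Metric.ball (0 : EuclideanSpace ℝ (Fin n)) 1, f (T ω (x + s • y))) ∂ν := by
        refine lintegral_congr fun ω => ?_
        -- Rotating the integration variable along with the centre pulls the rotation out of the
        -- argument of `f`.
        rw [ballAvg, ← setLIntegral_ball_comp (T ω)]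
        simp only [map_add, map_smul]
    _ = (volume (Metric.ball (0 : EuclideanSpace ℝ (Fin n)) 1))⁻¹ *
          ∫⁻ ω, (∫⁻ y in Metric.ball (0 : EuclideanSpace ℝ (Fin n)) 1,
            f (T ω (x + s • y))) ∂ν := by
        refine lintegral_const_mul' _ _ (ENNReal.inv_ne_top.2 (volume_unitBall_ne_zero n))
    _ = _ := by
        rw [ballAvg, lintegral_lintegral_swap]
        · congr 1
          exact lintegral_congr fun y => h.lintegral_eq f hf _
        · exact (hf.comp (h.measurable.comp (measurable_fst.prodMk
            ((measurable_snd.const_smul s).const_add x)))).aemeasurable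

end IsRotationAverage

/-! ### Spherical means of subharmonic functions are subharmonic -/

lemma integral_le_of_lintegral_ofReal_le {α : Type*} [MeasurableSpace α] {μ : Measure α}
    {f : α → ℝ} (hf : Integrable f μ) {a : ℝ} (ha : 0 ≤ a)
    (h : ∫⁻ x, ENNReal.ofReal (f x) ∂μ ≤ ENNReal.ofReal a) : ∫ x, f x ∂μ ≤ a := by
  have hfp : Integrable (fun x => max (f x) 0) μ := hf.pos_part
  have h1 : ∫ x, f x ∂μ ≤ ∫ x, max (f x) 0 ∂μ := integral_mono hf hfp fun x => le_max_left _ _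
  refine h1.trans ?_
  rw [integral_eq_lintegral_of_nonneg_ae (f := fun x => max (f x) 0)
    (Eventually.of_forall fun x => le_max_right _ _) hfp.aestronglyMeasurable]
  refine ENNReal.toReal_le_of_le_ofReal ha (le_trans (le_of_eq ?_) h)
  refine lintegral_congr fun x => ?_
  rcases le_total 0 (f x) with h0 | h0
  · rw [max_eq_left h0]
  · rw [max_eq_right h0, ENNReal.ofReal_of_nonpos h0, ENNReal.ofReal_zero]

lemma integrable_sphere_of_continuous {n : ℕ}
    {f : Metric.sphere (0 : EuclideanSpace ℝ (Fin n)) 1 → ℝ} (hf : Continuous f) :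
    Integrable f (sphereProb n) := by
  by_cases hn : n = 0
  · subst hn
    have : IsEmpty (Metric.sphere (0 : EuclideanSpace ℝ (Fin 0)) 1) :=
      ⟨fun σ => by
        have h := σ.2
        rw [mem_sphere_zero_iff_norm, Subsingleton.elim (σ : EuclideanSpace ℝ (Fin 0)) 0] at h
        simp at h⟩
    rw [Measure.eq_zero_of_isEmpty (sphereProb 0)]
    exact integrable_zero_measure
  · have : NeZero n := ⟨hn⟩
    exact hf.integrable_of_hasCompactSupport (HasCompactSupport.of_compactSpace _)

/-- A `C²` function with negative Laplacian at the origin is larger there than its means over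
small spheres. -/
lemma exists_integral_sphere_lt {n : ℕ} [NeZero n] {ψ : EuclideanSpace ℝ (Fin n) → ℝ}
    (hψ : ContDiffAt ℝ 2 ψ 0) (htr : (hessian ψ 0).trace < 0) :
    ∃ r₀ : ℝ, 0 < r₀ ∧ ∀ ρ : ℝ, 0 < ρ → ρ < r₀ →
      Continuous (fun σ : Metric.sphere (0 : EuclideanSpace ℝ (Fin n)) 1 =>
        ψ (ρ • (σ : EuclideanSpace ℝ (Fin n)))) ∧
      ∫ σ, ψ (ρ • (σ : EuclideanSpace ℝ (Fin n))) ∂(sphereProb n) < ψ 0 := by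
  have hn : (0 : ℝ) < n := by exact_mod_cast Nat.pos_of_ne_zero (NeZero.ne n)
  -- The Laplacian of `δ |y|²` is minus half the Laplacian of `ψ` at the origin, so near the origin
  -- it can be absorbed.
  set δ : ℝ := -(hessian ψ 0).trace / (4 * n) with hδ
  have hδpos : 0 < δ := div_pos (by linarith) (by positivity)
  have hev : ∀ᶠ y in 𝓝 (0 : EuclideanSpace ℝ (Fin n)),
      ContDiffAt ℝ 2 ψ y ∧ (hessian ψ y).trace < (hessian ψ 0).trace / 2 :=
    (hψ.eventually (by simp)).and
      ((continuousAt_trace_hessian hψ).eventually (gt_mem_nhds (by linarith)))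
  obtain ⟨r₀, hr₀, hball⟩ := Metric.eventually_nhds_iff_ball.1 hev
  refine ⟨r₀, hr₀, fun ρ hρ hρr => ?_⟩
  have hmem : ∀ y : EuclideanSpace ℝ (Fin n), ‖y‖ ≤ 1 → ρ • y ∈ Metric.ball (0 :
      EuclideanSpace ℝ (Fin n)) r₀ := fun y hy => by
    rw [mem_ball_zero_iff, norm_smul, Real.norm_of_nonneg hρ.le]
    nlinarith
  have hcont : Continuous (fun σ : Metric.sphere (0 : EuclideanSpace ℝ (Fin n)) 1 =>
      ψ (ρ • (σ : EuclideanSpace ℝ (Fin n)))) := by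
    refine continuous_iff_continuousAt.2 fun σ => ?_
    have h1 : ContinuousAt ψ (ρ • (σ : EuclideanSpace ℝ (Fin n))) :=
      (hball _ (hmem σ (by simp))).1.continuousAt
    exact ContinuousAt.comp (f := fun σ : Metric.sphere (0 : EuclideanSpace ℝ (Fin n)) 1 =>
      ρ • (σ : EuclideanSpace ℝ (Fin n))) h1 (by fun_prop)
  refine ⟨hcont, ?_⟩
  have hns : ContDiff ℝ 2 fun y : EuclideanSpace ℝ (Fin n) => ‖y‖ ^ 2 := contDiff_norm_sq ℝ
  -- This function is subharmonic near the origin; its mean value inequality says that the mean of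
  -- `ψ` plus `δ ρ²` is at most `ψ 0`, and `δ ρ² > 0` gives strictness.
  set h : EuclideanSpace ℝ (Fin n) → ℝ := fun y => -ψ y + (-δ) * ‖y‖ ^ 2 with hh
  have hhc : ∀ y ∈ Metric.ball (0 : EuclideanSpace ℝ (Fin n)) r₀, ContDiffAt ℝ 2 h y := fun y hy =>
    (hball y hy).1.neg.add (contDiffAt_const.mul hns.contDiffAt)
  have hsub : IsSubharmonicOn {A | 0 ≤ A.trace} (fun y => (h y : EReal))
      (Metric.ball (0 : EuclideanSpace ℝ (Fin n)) r₀) := by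
    refine isSubharmonicOn_of_trace_nonneg hhc fun y hy => ?_
    rw [hessian_add (hball y hy).1.neg (contDiffAt_const.mul hns.contDiffAt),
      hessian_neg (hball y hy).1, hessian_const_mul hns.contDiffAt, hessian_norm_sq]
    simp only [Matrix.trace_add, Matrix.trace_neg, Matrix.trace_smul, Matrix.trace_one,
      Fintype.card_fin, smul_eq_mul]
    have h1 := (hball y hy).2
    have h2 : δ * (2 * n) = -(hessian ψ 0).trace / 2 := by rw [hδ]; field_simp; norm_num
    linarith
  obtain ⟨C, hC⟩ : ∃ C, ∀ y ∈ Metric.closedBall (0 : EuclideanSpace ℝ (Fin n)) 1, h (ρ • y) ≤ C := by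
    obtain ⟨C, hC⟩ := (isCompact_closedBall (0 : EuclideanSpace ℝ (Fin n)) 1).bddAbove_image
      (f := fun y => h (ρ • y)) fun y hy => by
        have h1 : ContinuousAt h (ρ • y) :=
          (hhc _ (hmem y (mem_closedBall_zero_iff.1 hy))).continuousAt
        exact (ContinuousAt.comp (f := fun y : EuclideanSpace ℝ (Fin n) => ρ • y) h1
          (by fun_prop)).continuousWithinAt
    exact ⟨C, fun y hy => hC ⟨y, hy, rfl⟩⟩
  have hmat : ∀ y : EuclideanSpace ℝ (Fin n), matCLM (ρ • 1) y + 0 = ρ • y := fun y => by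
    rw [matCLM_smul_apply, matCLM_one_apply, add_zero]
  have hM : (ρ • (1 : Matrix (Fin n) (Fin n) ℝ)) * (ρ⁻¹ • 1) = 1 := by
    rw [Matrix.smul_mul, Matrix.one_mul, smul_smul, mul_inv_cancel₀ hρ.ne', one_smul]
  have hmean := hsub.lintegral_ellipsoid_le (b := 0) (c := C) hM (fun H hH => by
    have : 0 ≤ H.trace := hH
    simp only [Matrix.transpose_smul, Matrix.transpose_one, Matrix.smul_mul,
      Matrix.one_mul, Matrix.mul_smul, Matrix.mul_one, Matrix.trace_smul, smul_eq_mul]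
    positivity) fun y hy => by
      rw [hmat]
      exact ⟨hmem y (mem_closedBall_zero_iff.1 hy), EReal.coe_le_coe_iff.2 (hC y hy)⟩
  simp only [hmat, coFun_coe] at hmean
  have hCh : Continuous fun σ : Metric.sphere (0 : EuclideanSpace ℝ (Fin n)) 1 =>
      C - h (ρ • (σ : EuclideanSpace ℝ (Fin n))) := by
    have hσ : ∀ σ : Metric.sphere (0 : EuclideanSpace ℝ (Fin n)) 1,
        C - h (ρ • (σ : EuclideanSpace ℝ (Fin n))) =
          ψ (ρ • (σ : EuclideanSpace ℝ (Fin n))) + (C + δ * ρ ^ 2) := fun σ => by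
      simp only [hh, norm_smul, norm_eq_of_mem_sphere, mul_one, Real.norm_eq_abs, sq_abs]; ring
    simp only [hσ]
    exact hcont.add continuous_const
  have hint := integral_le_of_lintegral_ofReal_le (integrable_sphere_of_continuous hCh)
    (by have := hC 0 (by simp); rw [smul_zero] at this; linarith) hmean
  have heq : ∫ σ, (C - h (ρ • (σ : EuclideanSpace ℝ (Fin n)))) ∂(sphereProb n) =
      ∫ σ, ψ (ρ • (σ : EuclideanSpace ℝ (Fin n))) ∂(sphereProb n) + (C + δ * ρ ^ 2) := by
    have : (C + δ * ρ ^ 2) = ∫ _, (C + δ * ρ ^ 2) ∂(sphereProb n) := by simp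
    rw [this, ← integral_add (integrable_sphere_of_continuous hcont) (integrable_const _)]
    refine integral_congr_ae (Eventually.of_forall fun σ => ?_)
    simp only [hh, norm_smul, norm_eq_of_mem_sphere, mul_one, Real.norm_eq_abs, sq_abs]; ring
  rw [heq] at hint
  simp only [hh, norm_zero] at hint
  have : 0 < δ * ρ ^ 2 := by positivity
  linarith

/-- The reflection of `u` at `c`, extended by zero outside of `O`. -/
noncomputable def coOn {n : ℕ} (O : Set (EuclideanSpace ℝ (Fin n))) (c : ℝ)
    (u : EuclideanSpace ℝ (Fin n) → EReal) : EuclideanSpace ℝ (Fin n) → ENNReal :=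
  O.indicator fun x => coFun c (u x)

lemma coOn_of_mem {n : ℕ} {O : Set (EuclideanSpace ℝ (Fin n))} {c : ℝ}
    {u : EuclideanSpace ℝ (Fin n) → EReal} {x : EuclideanSpace ℝ (Fin n)} (hx : x ∈ O) :
    coOn O c u x = coFun c (u x) := indicator_of_mem hx _

lemma lowerSemicontinuous_coOn {n : ℕ} {O : Set (EuclideanSpace ℝ (Fin n))} (hO : IsOpen O) {c : ℝ}
    {u : EuclideanSpace ℝ (Fin n) → EReal} (hu : UpperSemicontinuousOn u O) :
    LowerSemicontinuous (coOn O c u) := by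
  intro x a ha
  by_cases hx : x ∈ O
  · rw [coOn_of_mem hx] at ha
    have h1 := lowerSemicontinuousOn_coFun hu c x hx a ha
    rw [hO.nhdsWithin_eq hx] at h1
    filter_upwards [h1, hO.mem_nhds hx] with y hy hyO
    rwa [coOn_of_mem hyO]
  · simp [coOn, hx] at ha

namespace IsRotationAverage

variable {n : ℕ} {Ω : Type*} [MeasurableSpace Ω] {ν : Measure Ω}
  {T : Ω → EuclideanSpace ℝ (Fin n) ≃ₗᵢ[ℝ] EuclideanSpace ℝ (Fin n)}
  {f : EuclideanSpace ℝ (Fin n) → ENNReal}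

lemma lowerSemicontinuous_sphMean (h : IsRotationAverage ν T) (hf : LowerSemicontinuous f) :
    LowerSemicontinuous fun x : EuclideanSpace ℝ (Fin n) => sphMean f ‖x‖ := by
  refine lowerSemicontinuous_iff_le_liminf.2 fun x => ?_
  simp only [← h.lintegral_eq f hf.measurable]
  refine le_trans (lintegral_mono fun ω => ?_) (lintegral_liminf_le fun y => ?_)
  · exact ((hf.comp (T ω).continuous).le_liminf x)
  · exact (hf.measurable.comp h.measurable).comp (measurable_id.prodMk measurable_const)

end IsRotationAverage

open scoped MatrixOrder Matrix.Norms.L2Operator in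
lemma _root_.Matrix.PosSemidef.exists_eq_transpose_mul_self {m : Type*} [Fintype m] [DecidableEq m]
    {B : Matrix m m ℝ} (hB : B.PosSemidef) : ∃ L : Matrix m m ℝ, B = L.transpose * L := by
  obtain ⟨L, hL⟩ := CStarAlgebra.nonneg_iff_eq_star_mul_self.mp hB.nonneg
  rw [Matrix.star_eq_conjTranspose, Matrix.conjTranspose_eq_transpose_of_trivial] at hL
  exact ⟨L, hL⟩

/-- The spherical means of an `F`-subharmonic function form an `F`-subharmonic function. -/
theorem IsSubharmonicOn.sphMean {n : ℕ} [NeZero n] {F : Set (Matrix (Fin n) (Fin n) ℝ)}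
    (hF : IsConeSubequation F) (hST : IsSTInvariant F) (hconv : Convex ℝ F)
    {u : EuclideanSpace ℝ (Fin n) → EReal} {X : Set (EuclideanSpace ℝ (Fin n))}
    (hu : IsSubharmonicOn F u X) {R : ℝ} (hX : Metric.ball 0 R ⊆ X) {c : ℝ}
    (hc : ∀ x ∈ Metric.ball (0 : EuclideanSpace ℝ (Fin n)) R, u x ≤ c) :
    IsSubharmonicOn F (fun x => (c : EReal) - (Tangents.sphMean (coOn (Metric.ball 0 R) c u) ‖x‖ :
      ENNReal)) (Metric.ball 0 R) := by
  obtain ⟨Ω, mΩ, ν, g, hav, hg⟩ := hF.exists_isRotationAverage hST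
  have hprob := hav.prob
  have hv : LowerSemicontinuous (coOn (Metric.ball 0 R) c u) :=
    lowerSemicontinuous_coOn Metric.isOpen_ball (hu.usc.mono hX)
  set v := coOn (Metric.ball 0 R) c u with hvdef
  have hvm := hv.measurable
  set W : EuclideanSpace ℝ (Fin n) → ENNReal := fun x => Tangents.sphMean v ‖x‖ with hW
  have hWl : LowerSemicontinuous W := hav.lowerSemicontinuous_sphMean hv
  have hcont : Continuous fun t : ENNReal => (c : EReal) - (t : EReal) := by
    refine continuous_iff_continuousAt.2 fun a => ?_
    have h : ContinuousAt (fun p : EReal × EReal => p.1 + p.2) ((c : EReal), -(a : EReal)) :=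
      EReal.continuousAt_add (Or.inl (EReal.coe_ne_top _)) (Or.inl (EReal.coe_ne_bot _))
    exact h.comp (f := fun a : ENNReal => ((c : EReal), -(a : EReal)))
      (continuousAt_const.prodMk (continuous_neg.comp continuous_coe_ennreal_ereal).continuousAt)
  refine ⟨?_, fun x _ => ?_, ?_⟩
  · refine (hcont.comp_lowerSemicontinuous_antitone hWl fun a b hab => ?_).upperSemicontinuousOn _
    exact EReal.sub_le_sub le_rfl (EReal.coe_ennreal_le_coe_ennreal_iff.2 hab)
  · rw [sub_eq_add_neg]
    refine EReal.add_ne_top (EReal.coe_ne_top _) ?_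
    rw [Ne, EReal.neg_eq_top_iff]
    exact EReal.coe_ennreal_ne_bot _
  intro x₀ hx₀ φ hφ hle heq
  by_contra hHF
  -- The pairing with `B` is a linear elliptic operator, nonnegative on `F` but negative on the
  -- Hessian of the test function.
  obtain ⟨B, hB, hBF, hBH⟩ := hF.exists_posDef_separating hconv
    (fun A hA => hF.trace_nonneg hST hconv hA) (hessian_isSymm hφ) hHF
  obtain ⟨L, hBL⟩ := hB.posSemidef.exists_eq_transpose_mul_self
  have hLu : IsUnit L := by
    rw [Matrix.isUnit_iff_isUnit_det]
    have h1 := (Matrix.isUnit_iff_isUnit_det _).1 hB.isUnit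
    rw [hBL, Matrix.det_mul] at h1
    exact isUnit_of_mul_isUnit_right h1
  -- With `B = M Mᵀ`, the pairing with `B` becomes the Laplacian in the coordinates `y ↦ M y + x₀`.
  set M := L.transpose with hM
  have hBM : B = M * M.transpose := by rw [hBL, hM, Matrix.transpose_transpose]
  obtain ⟨N, hMN⟩ : ∃ N, M * N = 1 := by
    have : IsUnit M := by
      rw [Matrix.isUnit_iff_isUnit_det, hM, Matrix.det_transpose,
        ← Matrix.isUnit_iff_isUnit_det]; exact hLu
    obtain ⟨N, hN⟩ := this.exists_right_inv
    exact ⟨N, hN⟩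
  have htrM : ∀ H : Matrix (Fin n) (Fin n) ℝ, (M.transpose * H * M).trace = (B * H).trace := by
    intro H
    rw [hBM, Matrix.mul_assoc, Matrix.trace_mul_comm, Matrix.mul_assoc, Matrix.trace_mul_comm]
  -- the test function in the new coordinates
  set ψ : EuclideanSpace ℝ (Fin n) → ℝ := fun y => φ (matCLM M y + x₀) with hψ
  have hφ0 : ContDiffAt ℝ 2 φ (matCLM M 0 + x₀) := by rwa [map_zero, zero_add]
  have hψc : ContDiffAt ℝ 2 ψ 0 :=
    ContDiffAt.comp (f := fun y => matCLM M y + x₀) _ hφ0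
      ((matCLM M).contDiff.add contDiff_const).contDiffAt
  have hψtr : (hessian ψ 0).trace < 0 := by
    rw [hψ, hessian_comp_matCLM M x₀ hφ0, htrM, map_zero, zero_add]
    exact hBH
  obtain ⟨r₀, hr₀, hmean⟩ := exists_integral_sphere_lt hψc hψtr
  have htend : Tendsto (fun y => matCLM M y + x₀) (𝓝 0) (𝓝 x₀) := by
    have : Continuous fun y => matCLM M y + x₀ := by fun_prop
    simpa using this.tendsto 0
  have hball : Metric.ball (0 : EuclideanSpace ℝ (Fin n)) R ∈ 𝓝 x₀ := Metric.isOpen_ball.mem_nhds hx₀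
  obtain ⟨r₁, hr₁, hnear⟩ := Metric.eventually_nhds_iff_ball.1
    ((htend.eventually hle).and (htend.eventually hball))
  set ρ : ℝ := min r₀ r₁ / 2 with hρ
  have hρpos : 0 < ρ := by have := lt_min hr₀ hr₁; positivity
  have hρ0 : ρ < r₀ := by
    have := lt_min hr₀ hr₁
    have := min_le_left r₀ r₁
    linarith
  have hρ1 : ρ < r₁ := by
    have := lt_min hr₀ hr₁
    have := min_le_right r₀ r₁
    linarith
  obtain ⟨hψcont, hlt⟩ := hmean ρ hρpos hρ0
  have hmem : ∀ y : EuclideanSpace ℝ (Fin n), ‖y‖ ≤ 1 → ρ • y ∈ Metric.ball (0 :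
      EuclideanSpace ℝ (Fin n)) r₁ := fun y hy => by
    rw [mem_ball_zero_iff, norm_smul, Real.norm_of_nonneg hρpos.le]
    nlinarith
  have hrotball : ∀ (ω : Ω) (z : EuclideanSpace ℝ (Fin n)), z ∈ Metric.ball (0 :
      EuclideanSpace ℝ (Fin n)) R → rotIso (g ω) z ∈ Metric.ball (0 :
      EuclideanSpace ℝ (Fin n)) R := fun ω z hz => by
    rw [mem_ball_zero_iff] at hz ⊢
    rwa [LinearIsometryEquiv.norm_map]
  -- mean value inequality for `W`
  have hWmean : ∫⁻ σ, W (matCLM M (ρ • (σ : EuclideanSpace ℝ (Fin n))) + x₀) ∂(sphereProb n) ≤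
      W x₀ := by
    simp only [hW, ← hav.lintegral_eq v hvm]
    rw [lintegral_lintegral_swap]
    · refine lintegral_mono fun ω => ?_
      have hgω : ((g ω : Matrix (Fin n) (Fin n) ℝ)).transpose * (g ω : Matrix (Fin n) (Fin n) ℝ) =
        1 := by simpa [Matrix.star_eq_conjTranspose] using Matrix.UnitaryGroup.star_mul_self (g ω)
      have hgω' : (g ω : Matrix (Fin n) (Fin n) ℝ) * ((g ω : Matrix (Fin n) (Fin n) ℝ)).transpose =
        1 := mul_eq_one_comm.1 hgω
      have hpt : ∀ y, matCLM ((g ω : Matrix (Fin n) (Fin n) ℝ) * (ρ • M)) y + rotIso (g ω) x₀ =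
          rotIso (g ω) (matCLM M (ρ • y) + x₀) := fun y => by
        rw [matCLM_mul_apply, matCLM_smul_apply, ← rotIso_apply, ← map_add, ← map_smul]
      -- For each rotation, the mean value inequality for `u` is applied over the rotated ellipsoid
      -- centred at the rotated point.
      have := hu.lintegral_ellipsoid_le (M := (g ω : Matrix (Fin n) (Fin n) ℝ) * (ρ • M))
        (N := (ρ⁻¹ • N) * ((g ω : Matrix (Fin n) (Fin n) ℝ)).transpose)
        (b := rotIso (g ω) x₀) (c := c) ?_ ?_ ?_
      · simp only [hpt] at this
        rw [hvdef, coOn_of_mem (hrotball ω _ hx₀)]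
        refine le_trans (le_of_eq (lintegral_congr fun σ => ?_)) this
        rw [coOn_of_mem (hrotball ω _ (hnear _ (hmem σ (by simp))).2)]
      · calc (g ω : Matrix (Fin n) (Fin n) ℝ) * (ρ • M) *
              (ρ⁻¹ • N * ((g ω : Matrix (Fin n) (Fin n) ℝ)).transpose)
            = (g ω : Matrix (Fin n) (Fin n) ℝ) * ((ρ • M) * (ρ⁻¹ • N)) *
              ((g ω : Matrix (Fin n) (Fin n) ℝ)).transpose := by simp only [Matrix.mul_assoc]
          _ = 1 := by
            rw [Matrix.smul_mul ρ M, Matrix.mul_smul M, hMN, smul_smul, mul_inv_cancel₀ hρpos.ne',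
              one_smul, Matrix.mul_one, hgω']
      -- Here invariance of `F` enters: conjugating `H` back by the rotation stays in `F`, where the
      -- pairing with `B` is nonnegative.
      · intro H hH
        have h1 := hBF _ (hg ω H hH).2
        rw [← htrM] at h1
        have h2 : ((g ω : Matrix (Fin n) (Fin n) ℝ) * (ρ • M)).transpose * H *
            ((g ω : Matrix (Fin n) (Fin n) ℝ) * (ρ • M)) =
            (ρ * ρ) • (M.transpose * (((g ω : Matrix (Fin n) (Fin n) ℝ)).transpose * H *
              (g ω : Matrix (Fin n) (Fin n) ℝ)) * M) := by
          rw [Matrix.transpose_mul, Matrix.transpose_smul]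
          simp only [Matrix.smul_mul, Matrix.mul_smul, smul_smul, Matrix.mul_assoc]
        rw [h2, Matrix.trace_smul, smul_eq_mul]
        positivity
      · intro y hy
        rw [hpt]
        have := hrotball ω _ (hnear _ (hmem y (mem_closedBall_zero_iff.1 hy))).2
        exact ⟨hX this, hc _ this⟩
    · refine (hvm.comp (hav.measurable.comp (measurable_snd.prodMk ?_))).aemeasurable
      have : Continuous fun y : EuclideanSpace ℝ (Fin n) => matCLM M (ρ • y) + x₀ := by fun_prop
      exact this.measurable.comp (measurable_subtype_coe.comp measurable_fst)
  have hW0 : W x₀ = ENNReal.ofReal (c - φ x₀) := by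
    rw [← coFun_coe, ← heq, coFun_sub_coe]
  have hφpos : 0 ≤ c - φ x₀ := by
    by_contra! hneg
    have h1 : (φ x₀ : EReal) ≤ c := by
      rw [← heq]
      conv_rhs => rw [← sub_zero (c : EReal)]
      exact EReal.sub_le_sub le_rfl (EReal.coe_ennreal_nonneg _)
    have := EReal.coe_le_coe_iff.1 h1
    linarith
  have hfin : ∫⁻ σ, ENNReal.ofReal (c - ψ (ρ • (σ : EuclideanSpace ℝ (Fin n)))) ∂(sphereProb n) ≤
      ENNReal.ofReal (c - ψ 0) := by
    have h0 : ψ 0 = φ x₀ := by simp [hψ]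
    rw [h0, ← hW0]
    refine le_trans (lintegral_mono fun σ => ?_) hWmean
    have h1 := (hnear _ (hmem σ (by simp))).1
    have h2 := antitone_coFun c h1
    rwa [coFun_sub_coe, coFun_coe] at h2
  have h0 : ψ 0 = φ x₀ := by simp [hψ]
  have hreal := integral_le_of_lintegral_ofReal_le
    (f := fun σ : Metric.sphere (0 : EuclideanSpace ℝ (Fin n)) 1 =>
      c - ψ (ρ • (σ : EuclideanSpace ℝ (Fin n))))
    (integrable_sphere_of_continuous (continuous_const.sub hψcont)) (by rw [h0]; exact hφpos) hfin
  -- The means of the test function are thus at least its value at the centre, against the strict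
  -- inequality `hlt` coming from the negative Laplacian.
  rw [integral_sub (integrable_const _) (integrable_sphere_of_continuous hψcont)] at hreal
  simp only [integral_const, probReal_univ, smul_eq_mul, one_mul] at hreal
  linarith

/-! ### The Riesz kernel -/

/-- The constant `γ` with `K_p'(t) = γ t^(1-p)`. -/
noncomputable def rieszSlope (p : ℝ) : ℝ := if p = 2 then 1 else |p - 2|

lemma rieszSlope_pos (p : ℝ) : 0 < rieszSlope p := by
  rw [rieszSlope]
  split_ifs with h
  · exact one_pos
  · exact abs_pos.2 (sub_ne_zero.2 h)

lemma rieszK_of_lt {p : ℝ} (hp : p < 2) : rieszK p = fun t => t ^ (2 - p) := by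
  funext t; simp [rieszK, hp]

lemma rieszK_two : rieszK 2 = Real.log := by
  funext t; simp [rieszK]

lemma rieszK_of_gt {p : ℝ} (hp : 2 < p) {t : ℝ} (ht : 0 < t) : rieszK p t = -t ^ (2 - p) := by
  rw [rieszK, if_neg (not_lt.2 hp.le), if_neg hp.ne', one_div, ← Real.rpow_neg ht.le, neg_sub]

lemma hasDerivAt_rieszK (p : ℝ) {t : ℝ} (ht : 0 < t) :
    HasDerivAt (rieszK p) (rieszSlope p * t ^ (1 - p)) t := by
  rcases lt_trichotomy p 2 with hp | rfl | hp
  · rw [rieszK_of_lt hp, rieszSlope, if_neg hp.ne, abs_of_neg (by linarith)]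
    convert Real.hasDerivAt_rpow_const (p := 2 - p) (Or.inl ht.ne') using 1
    rw [neg_sub, show 2 - p - 1 = 1 - p by ring]
  · rw [rieszK_two, rieszSlope, if_pos rfl]
    convert Real.hasDerivAt_log ht.ne' using 1
    rw [show (1 : ℝ) - 2 = -1 by norm_num, Real.rpow_neg_one, one_mul]
  · rw [rieszSlope, if_neg hp.ne', abs_of_pos (by linarith)]
    have h := (Real.hasDerivAt_rpow_const (p := 2 - p) (Or.inl ht.ne')).neg
    rw [show 2 - p - 1 = 1 - p by ring, ← neg_mul, neg_sub] at h
    refine h.congr_of_eventuallyEq ?_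
    filter_upwards [lt_mem_nhds ht] with s hs using rieszK_of_gt hp hs

lemma contDiffAt_rieszK (p : ℝ) {t : ℝ} (ht : 0 < t) : ContDiffAt ℝ 2 (rieszK p) t := by
  rcases lt_trichotomy p 2 with hp | rfl | hp
  · rw [rieszK_of_lt hp]
    exact contDiffAt_id.rpow_const_of_ne ht.ne'
  · rw [rieszK_two]
    exact Real.contDiffAt_log.2 ht.ne'
  · have h : ContDiffAt ℝ 2 (fun t : ℝ => -t ^ (2 - p)) t :=
      (contDiffAt_id.rpow_const_of_ne ht.ne').neg
    refine h.congr_of_eventuallyEq ?_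
    filter_upwards [lt_mem_nhds ht] with s hs using rieszK_of_gt hp hs

lemma rieszK_strictMonoOn (p : ℝ) : StrictMonoOn (rieszK p) (Ioi 0) := by
  refine strictMonoOn_of_deriv_pos (convex_Ioi 0)
    (fun t ht => (hasDerivAt_rieszK p ht).continuousAt.continuousWithinAt) fun t ht => ?_
  rw [interior_Ioi] at ht
  rw [(hasDerivAt_rieszK p ht).deriv]
  exact mul_pos (rieszSlope_pos p) (Real.rpow_pos_of_pos ht _)

lemma rieszK_lt {p s r : ℝ} (hs : 0 < s) (hsr : s < r) : rieszK p s < rieszK p r :=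
  rieszK_strictMonoOn p hs (hs.trans hsr) hsr

/-- Homogeneity is stated for differences because in this form it includes the logarithm, for which
the exponent `2 - p` is zero. -/
lemma rieszK_mul_sub (p : ℝ) {r s t : ℝ} (hr : 0 < r) (hs : 0 < s) (ht : 0 < t) :
    rieszK p (r * t) - rieszK p (s * t) = t ^ (2 - p) * (rieszK p r - rieszK p s) := by
  rcases lt_trichotomy p 2 with hp | rfl | hp
  · simp only [rieszK_of_lt hp]
    rw [Real.mul_rpow hr.le ht.le, Real.mul_rpow hs.le ht.le]; ring
  · rw [rieszK_two, Real.log_mul hr.ne' ht.ne', Real.log_mul hs.ne' ht.ne', sub_self,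
      Real.rpow_zero]; ring
  · rw [rieszK_of_gt hp (mul_pos hr ht), rieszK_of_gt hp (mul_pos hs ht), rieszK_of_gt hp hr,
      rieszK_of_gt hp hs, Real.mul_rpow hr.le ht.le, Real.mul_rpow hs.le ht.le]; ring

lemma rieszK_mul {p : ℝ} (hp : p ≠ 2) {r t : ℝ} (hr : 0 < r) (ht : 0 < t) :
    rieszK p (r * t) = r ^ (2 - p) * rieszK p t := by
  rcases lt_or_gt_of_ne hp with hp | hp
  · simp only [rieszK_of_lt hp]
    rw [Real.mul_rpow hr.le ht.le]
  · rw [rieszK_of_gt hp (mul_pos hr ht), rieszK_of_gt hp ht, Real.mul_rpow hr.le ht.le]; ring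

lemma hasDerivAt_rieszK_sqrt (p : ℝ) {q : ℝ} (hq : 0 < q) :
    HasDerivAt (fun q => rieszK p √q) (rieszSlope p / 2 * q ^ (-p / 2)) q := by
  have hs := Real.sqrt_pos.2 hq
  refine ((hasDerivAt_rieszK p hs).comp q (Real.hasDerivAt_sqrt hq.ne')).congr_deriv ?_
  rw [Real.sqrt_eq_rpow, ← Real.rpow_mul hq.le, one_div (2 * _), mul_inv,
    ← Real.rpow_neg hq.le, show -p / 2 = 1 / 2 * (1 - p) + -(1 / 2) by ring, Real.rpow_add hq]
  ring

lemma contDiffAt_rieszK_norm {n : ℕ} (p : ℝ) {x : EuclideanSpace ℝ (Fin n)} (hx : x ≠ 0) :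
    ContDiffAt ℝ 2 (fun y : EuclideanSpace ℝ (Fin n) => rieszK p ‖y‖) x :=
  ContDiffAt.comp (f := fun y : EuclideanSpace ℝ (Fin n) => ‖y‖) x
    (contDiffAt_rieszK p (norm_pos_iff.2 hx)) (contDiffAt_norm ℝ hx)

/-! ### Comparison with multiples of the Riesz kernel on annuli -/

/-- Since `K'` is a multiple of `t^(1-p)`, the radial eigenvalue is `-(p-1)` times the tangential
one, which produces the matrix in the definition of the Riesz characteristic. -/
lemma hessian_rieszK_perturbed {n : ℕ} (p a b ε ρ : ℝ) {x : EuclideanSpace ℝ (Fin n)} (hx : x ≠ 0) :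
    hessian (fun y => a + b * rieszK p ‖y‖ + ε * (ρ - ‖y‖ ^ 2)) x =
      (b * rieszSlope p * (‖x‖ ^ 2) ^ (-p / 2)) •
        (1 - p • lineProj (‖x‖⁻¹ • x.ofLp)) - (2 * ε) • 1 := by
  have hq : 0 < ‖x‖ ^ 2 := pow_pos (norm_pos_iff.2 hx) 2
  have hfun : (fun y : EuclideanSpace ℝ (Fin n) => a + b * rieszK p ‖y‖ + ε * (ρ - ‖y‖ ^ 2)) =
      fun y => (fun q => a + b * rieszK p √q + ε * (ρ - q)) (‖y‖ ^ 2) := by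
    funext y
    simp only [Real.sqrt_sq (norm_nonneg y)]
  rw [hfun, hessian_radial (g := fun q => a + b * rieszK p √q + ε * (ρ - q)) (g₁ := fun q => b * (rieszSlope p / 2 * q ^ (-p / 2)) - ε)
    (g₂ := b * (rieszSlope p / 2 * (-p / 2 * (‖x‖ ^ 2) ^ (-p / 2 - 1))))]
  · have h1 : lineProj (‖x‖⁻¹ • x.ofLp) = (‖x‖ ^ 2)⁻¹ • Matrix.vecMulVec x.ofLp x.ofLp := by
      rw [lineProj, Matrix.smul_vecMulVec, Matrix.vecMulVec_smul, smul_smul, ← mul_inv, sq]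
    have h2 : (‖x‖ ^ 2) ^ (-p / 2 - 1) = (‖x‖ ^ 2) ^ (-p / 2) * (‖x‖ ^ 2)⁻¹ := by
      rw [Real.rpow_sub hq, Real.rpow_one, div_eq_mul_inv]
    rw [h1, h2]
    ext i j
    simp only [Matrix.add_apply, Matrix.smul_apply, Matrix.sub_apply, smul_eq_mul]
    ring
  · filter_upwards [lt_mem_nhds hq] with q hq'
    refine (((hasDerivAt_const q a).add ((hasDerivAt_rieszK_sqrt p hq').const_mul b)).add
      (((hasDerivAt_const q ρ).sub (hasDerivAt_id q)).const_mul ε)).congr_deriv ?_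
    ring
  · exact (((Real.hasDerivAt_rpow_const (p := -p / 2) (Or.inl hq.ne')).const_mul
      (rieszSlope p / 2)).const_mul b).sub_const ε

/-- The barrier is `a + b K + ε (r₂² - |y|²)`. It lies above `a + b K` on the boundary of the
annulus, its Hessian is never in `F`, and `ε` tends to zero at the end. -/
theorem IsSubharmonicOn.le_add_mul_rieszK {n : ℕ} {F : Set (Matrix (Fin n) (Fin n) ℝ)}
    (hF : IsConeSubequation F) (hST : IsSTInvariant F) (hconv : Convex ℝ F)
    {u : EuclideanSpace ℝ (Fin n) → EReal} {X : Set (EuclideanSpace ℝ (Fin n))}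
    (hu : IsSubharmonicOn F u X) {r₁ r₂ : ℝ} (hr₁ : 0 < r₁) (hX : Metric.closedBall 0 r₂ ⊆ X)
    {a b : ℝ} (hb : 0 ≤ b)
    (h₁ : ∀ x : EuclideanSpace ℝ (Fin n), ‖x‖ = r₁ →
      u x ≤ ((a + b * rieszK (rieszChar F) r₁ : ℝ) : EReal))
    (h₂ : ∀ x : EuclideanSpace ℝ (Fin n), ‖x‖ = r₂ →
      u x ≤ ((a + b * rieszK (rieszChar F) r₂ : ℝ) : EReal))
    {x : EuclideanSpace ℝ (Fin n)} (hx₁ : r₁ ≤ ‖x‖) (hx₂ : ‖x‖ ≤ r₂) :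
    u x ≤ ((a + b * rieszK (rieszChar F) ‖x‖ : ℝ) : EReal) := by
  set p := rieszChar F with hp
  have hp1 : 1 ≤ p := hF.one_le_rieszChar hconv
  have key : ∀ ε : ℝ, 0 < ε →
      u x ≤ ((a + b * rieszK p ‖x‖ + ε * (r₂ ^ 2 - ‖x‖ ^ 2) : ℝ) : EReal) := by
    intro ε hε
    have hne : ∀ y : EuclideanSpace ℝ (Fin n), r₁ ≤ ‖y‖ → y ≠ 0 := fun y hy h0 => by
      rw [h0, norm_zero] at hy; linarith
    have hsm : ∀ y : EuclideanSpace ℝ (Fin n), r₁ ≤ ‖y‖ →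
        ContDiffAt ℝ 2 (fun y : EuclideanSpace ℝ (Fin n) =>
          a + b * rieszK p ‖y‖ + ε * (r₂ ^ 2 - ‖y‖ ^ 2)) y := fun y hy =>
      (contDiffAt_const.add (contDiffAt_const.mul (contDiffAt_rieszK_norm p (hne y hy)))).add
        (contDiffAt_const.mul (contDiffAt_const.sub (contDiff_norm_sq ℝ).contDiffAt))
    refine hu.le_of_hessian_notMem (K := {y | r₁ ≤ ‖y‖} ∩ Metric.closedBall 0 r₂)
      (O := {y | r₁ < ‖y‖} ∩ Metric.ball 0 r₂)
      (φ := fun y => a + b * rieszK p ‖y‖ + ε * (r₂ ^ 2 - ‖y‖ ^ 2))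
      ((isCompact_closedBall 0 r₂).inter_left (isClosed_le continuous_const continuous_norm))
      (fun y hy => hX hy.2)
      ((isOpen_lt continuous_const continuous_norm).inter Metric.isOpen_ball)
      (fun y hy => ⟨mem_ofPred.2 (le_of_lt (mem_ofPred.1 hy.1)), Metric.ball_subset_closedBall hy.2⟩)
      (fun y hy => (hsm y hy.1).continuousAt.continuousWithinAt)
      (fun y hy => hsm y (le_of_lt hy.1)) ?_ ?_ x ⟨hx₁, mem_closedBall_zero_iff.2 hx₂⟩
    · intro y hy hmem
      have hy1 : r₁ < ‖y‖ := hy.1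
      have hy0 : 0 < ‖y‖ := hr₁.trans hy1
      rw [hessian_rieszK_perturbed p a b ε _ (hne y hy1.le)] at hmem
      set d := b * rieszSlope p * (‖y‖ ^ 2) ^ (-p / 2) with hd
      have hd0 : 0 ≤ d := mul_nonneg (mul_nonneg hb (rieszSlope_pos p).le) (by positivity)
      set e := ‖y‖⁻¹ • y.ofLp with he
      have he1 : e ⬝ᵥ e = 1 := by
        rw [he, smul_dotProduct, dotProduct_smul, ofLp_dotProduct_self]
        simp only [smul_eq_mul]; field_simp
      -- If `d > 2ε`, the Hessian is a positive multiple of `I - q P_e` with `q = d p / (d - 2ε)`,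
      -- which exceeds `p`. If `d ≤ 2ε`, its trace is negative because `p ≥ 1`.
      rcases lt_or_ge (2 * ε) d with hlt | hge
      · have hs : 0 < d - 2 * ε := by linarith
        refine hF.one_sub_smul_lineProj_notMem hST hconv (q := d * p / (d - 2 * ε)) ?_ he1 ?_
        · rw [← hp, lt_div_iff₀ hs]; nlinarith
        · have := hF.cone _ hmem (d - 2 * ε)⁻¹ (inv_nonneg.2 hs.le)
          convert this using 1
          ext i j
          simp only [Matrix.smul_apply, Matrix.sub_apply, smul_eq_mul]
          field_simp
          ring
      · have htr := hF.trace_nonneg hST hconv hmem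
        rw [Matrix.trace_sub, Matrix.trace_smul, Matrix.trace_sub, Matrix.trace_smul,
          Matrix.trace_smul, trace_lineProj, he1, Matrix.trace_one] at htr
        simp only [Fintype.card_fin, smul_eq_mul, mul_one] at htr
        have hn : (1 : ℝ) ≤ n := by exact_mod_cast Nat.one_le_iff_ne_zero.2 hF.dim_ne_zero
        rcases hd0.eq_or_lt with h0 | h0
        · rw [← h0] at htr; nlinarith
        · nlinarith
    · intro y hy hyO
      have hy2 : ‖y‖ ≤ r₂ := mem_closedBall_zero_iff.1 hy.2
      have hy1 : r₁ ≤ ‖y‖ := hy.1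
      have hpos : 0 ≤ ε * (r₂ ^ 2 - ‖y‖ ^ 2) := mul_nonneg hε.le (by nlinarith)
      have hcase : ‖y‖ = r₁ ∨ ‖y‖ = r₂ := by
        by_contra! h
        exact hyO ⟨lt_of_le_of_ne hy1 (Ne.symm h.1),
          mem_ball_zero_iff.2 (lt_of_le_of_ne hy2 h.2)⟩
      rcases hcase with h | h
      · exact (h₁ y h).trans (EReal.coe_le_coe_iff.2 (by rw [h] at hpos ⊢; linarith))
      · exact (h₂ y h).trans (EReal.coe_le_coe_iff.2 (by rw [h] at hpos ⊢; linarith))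
  have htend : Tendsto (fun ε : ℝ => ((a + b * rieszK p ‖x‖ + ε * (r₂ ^ 2 - ‖x‖ ^ 2) : ℝ) : EReal))
      (𝓝[>] 0) (𝓝 ((a + b * rieszK p ‖x‖ : ℝ) : EReal)) := by
    have h1 : Continuous fun ε : ℝ =>
        ((a + b * rieszK p ‖x‖ + ε * (r₂ ^ 2 - ‖x‖ ^ 2) : ℝ) : EReal) :=
      continuous_coe_real_ereal.comp (by fun_prop)
    have h2 := h1.tendsto 0
    simp only [zero_mul, add_zero] at h2
    exact h2.mono_left nhdsWithin_le_nhds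
  refine ge_of_tendsto htend ?_
  filter_upwards [self_mem_nhdsWithin] with ε hε using key ε hε

/-- The maximum principle on balls. -/
lemma IsSubharmonicOn.le_of_le_sphere {n : ℕ} {F : Set (Matrix (Fin n) (Fin n) ℝ)}
    (hF : IsConeSubequation F)
    {u : EuclideanSpace ℝ (Fin n) → EReal} {X : Set (EuclideanSpace ℝ (Fin n))}
    (hu : IsSubharmonicOn F u X) {r : ℝ} (hX : Metric.closedBall 0 r ⊆ X) {a : ℝ}
    (h : ∀ x : EuclideanSpace ℝ (Fin n), ‖x‖ = r → u x ≤ (a : EReal))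
    {x : EuclideanSpace ℝ (Fin n)} (hx : ‖x‖ ≤ r) : u x ≤ (a : EReal) := by
  have hns : ContDiff ℝ 2 fun y : EuclideanSpace ℝ (Fin n) => ‖y‖ ^ 2 := contDiff_norm_sq ℝ
  have key : ∀ ε : ℝ, 0 < ε → u x ≤ ((a + ε * r ^ 2 + (-ε) * ‖x‖ ^ 2 : ℝ) : EReal) := by
    intro ε hε
    have hsm : ContDiff ℝ 2 fun y : EuclideanSpace ℝ (Fin n) => a + ε * r ^ 2 + (-ε) * ‖y‖ ^ 2 :=
      contDiff_const.add (contDiff_const.mul hns)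
    refine hu.le_of_hessian_notMem (K := Metric.closedBall 0 r)
      (O := Metric.ball 0 r) (φ := fun y => a + ε * r ^ 2 + (-ε) * ‖y‖ ^ 2)
      (isCompact_closedBall 0 r) hX Metric.isOpen_ball Metric.ball_subset_closedBall
      hsm.continuous.continuousOn (fun y _ => hsm.contDiffAt) ?_ ?_ x
      (mem_closedBall_zero_iff.2 hx)
    · intro y _
      rw [hessian_add contDiffAt_const (contDiffAt_const.mul hns.contDiffAt), hessian_const,
        hessian_const_mul hns.contDiffAt, hessian_norm_sq, zero_add, smul_smul]
      exact hF.smul_one_notMem (by linarith)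
    · intro y hy hyO
      have hy2 : ‖y‖ = r := le_antisymm (mem_closedBall_zero_iff.1 hy)
        (not_lt.1 fun h => hyO (mem_ball_zero_iff.2 h))
      refine (h y hy2).trans (EReal.coe_le_coe_iff.2 ?_)
      rw [hy2]; linarith
  have htend : Tendsto (fun ε : ℝ => ((a + ε * r ^ 2 + (-ε) * ‖x‖ ^ 2 : ℝ) : EReal))
      (𝓝[>] 0) (𝓝 (a : EReal)) := by
    have h1 : Continuous fun ε : ℝ => ((a + ε * r ^ 2 + (-ε) * ‖x‖ ^ 2 : ℝ) : EReal) :=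
      continuous_coe_real_ereal.comp (by fun_prop)
    have h2 := h1.tendsto 0
    simp only [zero_mul, neg_zero, add_zero] at h2
    exact h2.mono_left nhdsWithin_le_nhds
  refine ge_of_tendsto htend ?_
  filter_upwards [self_mem_nhdsWithin] with ε hε using key ε hε

/-! ### Spherical maxima -/

section sphereMax

variable {n : ℕ} {u : EuclideanSpace ℝ (Fin n) → EReal} {r : ℝ}

lemma le_sphereMax (hr : 0 < r) {x : EuclideanSpace ℝ (Fin n)} (hx : ‖x‖ = r) :
    u x ≤ sphereMax u r := by
  have h : r⁻¹ • x ∈ Metric.sphere (0 : EuclideanSpace ℝ (Fin n)) 1 := by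
    rw [mem_sphere_zero_iff_norm, norm_smul, Real.norm_of_nonneg (inv_nonneg.2 hr.le), hx,
      inv_mul_cancel₀ hr.ne']
  have h2 := le_iSup₂ (f := fun σ (_ : σ ∈ Metric.sphere (0 : EuclideanSpace ℝ (Fin n)) 1) =>
    u (r • σ)) _ h
  simp only [smul_smul, mul_inv_cancel₀ hr.ne', one_smul] at h2
  exact h2

lemma sphereMax_le_iff (hr : 0 < r) {a : EReal} :
    sphereMax u r ≤ a ↔ ∀ x : EuclideanSpace ℝ (Fin n), ‖x‖ = r → u x ≤ a := by
  refine ⟨fun h x hx => (le_sphereMax hr hx).trans h, fun h => iSup₂_le fun σ hσ => h _ ?_⟩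
  rw [norm_smul, mem_sphere_zero_iff_norm.1 hσ, mul_one, Real.norm_of_nonneg hr.le]

lemma exists_norm_eq_of_neZero [NeZero n] (hr : 0 ≤ r) :
    ∃ x : EuclideanSpace ℝ (Fin n), ‖x‖ = r := by
  have : Nontrivial (EuclideanSpace ℝ (Fin n)) := by
    have := Nat.pos_of_ne_zero (NeZero.ne n)
    have : Nonempty (Fin n) := ⟨⟨0, this⟩⟩
    infer_instance
  exact exists_norm_eq _ hr

lemma sphereMax_radial [NeZero n] (g : ℝ → EReal) (hr : 0 < r) :
    sphereMax (fun x : EuclideanSpace ℝ (Fin n) => g ‖x‖) r = g r := by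
  refine le_antisymm ((sphereMax_le_iff hr).2 fun x hx => by rw [hx]) ?_
  obtain ⟨x, hx⟩ := exists_norm_eq_of_neZero (n := n) hr.le
  conv_lhs => rw [← hx]
  exact le_sphereMax (u := fun x : EuclideanSpace ℝ (Fin n) => g ‖x‖) hr hx

end sphereMax

/-! ### Convexity with respect to the Riesz kernel -/

/-- `ψ` is nondecreasing and `K_p`-convex on `(0, R)`. -/
structure IsRieszConvex (p : ℝ) (ψ : ℝ → ℝ) (R : ℝ) : Prop where
  mono : ∀ r ∈ Ioo 0 R, ∀ s ∈ Ioo 0 R, r ≤ s → ψ r ≤ ψ s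
  convex : ∀ ⦃r₁ r r₂⦄, 0 < r₁ → r₁ < r → r < r₂ → r₂ < R →
    ψ r ≤ ψ r₁ + (ψ r₂ - ψ r₁) / (rieszK p r₂ - rieszK p r₁) * (rieszK p r - rieszK p r₁)

/-- Monotonicity comes first, from the maximum principle on balls: it makes the slope of the
interpolating multiple of `K` nonnegative, as the annulus comparison requires. -/
theorem IsSubharmonicOn.isRieszConvex_sphereMax {n : ℕ} {F : Set (Matrix (Fin n) (Fin n) ℝ)}
    (hF : IsConeSubequation F) (hST : IsSTInvariant F) (hconv : Convex ℝ F)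
    {u : EuclideanSpace ℝ (Fin n) → EReal} {X : Set (EuclideanSpace ℝ (Fin n))}
    (hu : IsSubharmonicOn F u X) {R : ℝ} (hX : Metric.ball 0 R ⊆ X) {ψ : ℝ → ℝ}
    (hψ : ∀ r ∈ Ioo 0 R, sphereMax u r = ψ r) : IsRieszConvex (rieszChar F) ψ R := by
  have hsub : ∀ r < R, Metric.closedBall (0 : EuclideanSpace ℝ (Fin n)) r ⊆ X := fun r hr =>
    (Metric.closedBall_subset_ball hr).trans hX
  have hle : ∀ r ∈ Ioo 0 R, ∀ x : EuclideanSpace ℝ (Fin n), ‖x‖ = r → u x ≤ ψ r :=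
    fun r hr => (sphereMax_le_iff hr.1).1 (hψ r hr).le
  have hmono : ∀ r ∈ Ioo 0 R, ∀ s ∈ Ioo 0 R, r ≤ s → ψ r ≤ ψ s := by
    intro r hr s hs hrs
    rw [← EReal.coe_le_coe_iff, ← hψ r hr, sphereMax_le_iff hr.1]
    exact fun x hx => hu.le_of_le_sphere hF (hsub s hs.2) (hle s hs) (hx.trans_le hrs)
  refine ⟨hmono, fun r₁ r r₂ h1 h2 h3 h4 => ?_⟩
  have hr₁ : r₁ ∈ Ioo 0 R := ⟨h1, by linarith⟩
  have hr₂ : r₂ ∈ Ioo 0 R := ⟨by linarith, h4⟩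
  have hr : r ∈ Ioo 0 R := ⟨by linarith, by linarith⟩
  have hK := rieszK_lt (p := rieszChar F) h1 (h2.trans h3)
  set b := (ψ r₂ - ψ r₁) / (rieszK (rieszChar F) r₂ - rieszK (rieszChar F) r₁) with hb
  have hb0 : 0 ≤ b := div_nonneg (sub_nonneg.2 (hmono _ hr₁ _ hr₂ (by linarith)))
    (sub_nonneg.2 hK.le)
  have hb2 : b * (rieszK (rieszChar F) r₂ - rieszK (rieszChar F) r₁) = ψ r₂ - ψ r₁ :=
    div_mul_cancel₀ _ (sub_pos.2 hK).ne'
  rw [← EReal.coe_le_coe_iff, ← hψ r hr, sphereMax_le_iff hr.1]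
  intro x hx
  have := hu.le_add_mul_rieszK hF hST hconv h1 (hsub r₂ h4)
    (a := ψ r₁ - b * rieszK (rieszChar F) r₁) hb0
    (fun y hy => by rw [sub_add_cancel]; exact hle r₁ hr₁ y hy)
    (fun y hy => by
      rw [show ψ r₁ - b * rieszK (rieszChar F) r₁ + b * rieszK (rieszChar F) r₂ = ψ r₂ by
        linarith]
      exact hle r₂ hr₂ y hy) (x := x) (by rw [hx]; exact h2.le) (by rw [hx]; exact h3.le)
  rw [hx] at this
  refine this.trans (EReal.coe_le_coe_iff.2 (le_of_eq ?_))
  ring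

/-! ### Densities -/

/-- The filter of pairs `(r, s)` with `0 < s < r ↓ 0`. -/
def pairFilter : Filter (ℝ × ℝ) :=
  (𝓝[>] (0 : ℝ) ×ˢ 𝓝[>] (0 : ℝ)) ⊓ 𝓟 {q : ℝ × ℝ | q.2 < q.1}

lemma eventually_pairFilter {P : ℝ × ℝ → Prop} {δ : ℝ} (hδ : 0 < δ)
    (h : ∀ r s : ℝ, 0 < s → s < r → r < δ → P (r, s)) : ∀ᶠ q in pairFilter, P q := by
  rw [pairFilter, eventually_inf_principal]
  have hI : Ioo 0 δ ∈ 𝓝[>] (0 : ℝ) := Ioo_mem_nhdsGT hδ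
  filter_upwards [prod_mem_prod hI hI] with q hq hlt
  exact h q.1 q.2 hq.2.1 hlt hq.1.2

/-- Density in terms of real functions. -/
def HasRealDensity (p : ℝ) (ψ : ℝ → ℝ) (Θ : ℝ) : Prop :=
  ∀ ε : ℝ, 0 < ε → ∃ δ : ℝ, 0 < δ ∧ ∀ s r : ℝ, 0 < s → s < r → r < δ →
    |ψ r - ψ s - Θ * (rieszK p r - rieszK p s)| ≤ ε * (rieszK p r - rieszK p s)

lemma HasRealDensity.hasDensity {p : ℝ} {ψ : ℝ → ℝ} {Θ : ℝ} (h : HasRealDensity p ψ Θ)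
    {Ψ : ℝ → EReal} {R : ℝ} (hR : 0 < R) (hΨ : ∀ r ∈ Ioo 0 R, Ψ r = ψ r) :
    HasDensity p Ψ Θ := by
  have h1 : Tendsto (fun q : ℝ × ℝ => (ψ q.1 - ψ q.2) / (rieszK p q.1 - rieszK p q.2))
      pairFilter (𝓝 Θ) := by
    refine Metric.tendsto_nhds.2 fun ε hε => ?_
    obtain ⟨δ, hδ, hd⟩ := h (ε / 2) (by positivity)
    refine eventually_pairFilter hδ fun r s hs hsr hr => ?_
    have hK : 0 < rieszK p r - rieszK p s := sub_pos.2 (rieszK_lt hs hsr)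
    have h2 := hd s r hs hsr hr
    rw [Real.dist_eq, show (ψ r - ψ s) / (rieszK p r - rieszK p s) - Θ =
      (ψ r - ψ s - Θ * (rieszK p r - rieszK p s)) / (rieszK p r - rieszK p s) by field_simp,
      abs_div, abs_of_pos hK, div_lt_iff₀ hK]
    nlinarith
  refine ((continuous_coe_real_ereal.tendsto Θ).comp h1).congr' ?_
  refine eventually_pairFilter hR fun r s hs hsr hr => ?_
  simp only [Function.comp]
  rw [hΨ r ⟨hs.trans hsr, hr⟩, hΨ s ⟨hs, hsr.trans hr⟩, ← EReal.coe_sub, EReal.coe_div]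

lemma hasRealDensity_of_eq {p Θ c : ℝ} {ψ : ℝ → ℝ} {R : ℝ} (hR : 0 < R)
    (h : ∀ r ∈ Ioo 0 R, ψ r = Θ * rieszK p r + c) : HasRealDensity p ψ Θ := by
  refine fun ε hε => ⟨R, hR, fun s r hs hsr hr => ?_⟩
  have hK : 0 < rieszK p r - rieszK p s := sub_pos.2 (rieszK_lt hs hsr)
  rw [h r ⟨hs.trans hsr, hr⟩, h s ⟨hs, hsr.trans hr⟩,
    show Θ * rieszK p r + c - (Θ * rieszK p s + c) - Θ * (rieszK p r - rieszK p s) = 0 by ring,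
    abs_zero]
  positivity

/-- Convexity says that the chordal slopes increase as the interval moves outward, and monotonicity
bounds them below by zero. The density is their infimum. -/
theorem IsRieszConvex.exists_hasRealDensity {p R : ℝ} {ψ : ℝ → ℝ} (h : IsRieszConvex p ψ R)
    (hR : 0 < R) : ∃ Θ : ℝ, 0 ≤ Θ ∧ HasRealDensity p ψ Θ := by
  set q : ℝ → ℝ → ℝ := fun s r => (ψ r - ψ s) / (rieszK p r - rieszK p s) with hq
  have hK : ∀ {s r : ℝ}, 0 < s → s < r → 0 < rieszK p r - rieszK p s := fun hs hsr =>
    sub_pos.2 (rieszK_lt hs hsr)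
  have hq0 : ∀ {s r : ℝ}, 0 < s → s < r → r < R → 0 ≤ q s r := fun hs hsr hr =>
    div_nonneg (sub_nonneg.2 (h.mono _ ⟨hs, hsr.trans hr⟩ _ ⟨hs.trans hsr, hr⟩ hsr.le))
      (hK hs hsr).le
  have hqq : ∀ {s r t : ℝ}, 0 < s → s < r → r < t → t < R → q s r ≤ q r t := by
    intro s r t hs hsr hrt ht
    have h1 := h.convex hs hsr hrt ht
    have k1 := hK hs hsr
    have k2 := hK (hs.trans hsr) hrt
    have k3 := hK hs (hsr.trans hrt)
    rw [hq, div_le_div_iff₀ k1 k2]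
    rw [← sub_le_iff_le_add', div_mul_eq_mul_div, le_div_iff₀ k3] at h1
    nlinarith
  set A : Set ℝ := {a | ∃ s r : ℝ, 0 < s ∧ s < r ∧ r < R ∧ a = q s r} with hA
  have hAne : A.Nonempty := ⟨_, R / 3, R / 2, by linarith, by linarith, by linarith, rfl⟩
  have hAb : BddBelow A := ⟨0, fun a => by
    rintro ⟨s, r, hs, hsr, hr, rfl⟩; exact hq0 hs hsr hr⟩
  refine ⟨sInf A, le_csInf hAne fun a => by
    rintro ⟨s, r, hs, hsr, hr, rfl⟩; exact hq0 hs hsr hr, fun ε hε => ?_⟩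
  obtain ⟨a, ⟨s₀, r₀, hs₀, hsr₀, hr₀, rfl⟩, ha⟩ := exists_lt_of_csInf_lt hAne
    (lt_add_of_pos_right (sInf A) hε)
  refine ⟨s₀, hs₀, fun s r hs hsr hr => ?_⟩
  have h1 : sInf A ≤ q s r := csInf_le hAb ⟨s, r, hs, hsr, by linarith, rfl⟩
  have h2 : q s r ≤ q s₀ r₀ :=
    -- The slopes over `(s, r)`, `(r, s₀)` and `(s₀, r₀)` increase in this order; the middle
    -- interval exists because `δ` was taken to be `s₀`.
    (hqq hs hsr hr (hsr₀.trans hr₀)).trans (hqq (hs.trans hsr) hr hsr₀ hr₀)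
  have h3 : q s r * (rieszK p r - rieszK p s) = ψ r - ψ s := div_mul_cancel₀ _ (hK hs hsr).ne'
  have k := hK hs hsr
  rw [← h3, ← sub_mul, abs_mul, abs_of_pos k, abs_of_nonneg (by linarith)]
  exact mul_le_mul_of_nonneg_right (by linarith) k.le

/-! ### Averages of extended real valued functions -/

/-- The identity `f⁺ + (c - f) + c⁻ = f⁻ + c⁺` holds in `[0, ∞]` and can be integrated without any
finiteness. Subtraction is performed only at the end, where the average of `f⁺` is finite because `f
≤ c`. -/
lemma eAverage_eq {α : Type*} [MeasurableSpace α] {μ : Measure α} (h0 : μ univ ≠ 0)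
    (htop : μ univ ≠ ⊤) {f : α → EReal} {c : ℝ} (hf : AEMeasurable f μ) (hc : ∀ᵐ x ∂μ, f x ≤ c) :
    eAverage μ f = (c : EReal) - ((μ univ)⁻¹ * ∫⁻ x, coFun c (f x) ∂μ : ENNReal) := by
  have hpt : ∀ᵐ x ∂μ, (f x).toENNReal + (coFun c (f x) + ENNReal.ofReal (-c)) =
      (-f x).toENNReal + ENNReal.ofReal c := by
    filter_upwards [hc] with x hx
    generalize f x = a at hx
    induction a with
    | bot => simp
    | top => simp at hx
    | coe a =>
      have h1 := EReal.coe_le_coe_iff.1 hx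
      rw [coFun_coe, ← EReal.coe_neg, EReal.toENNReal_of_ne_top (EReal.coe_ne_top _),
        EReal.toENNReal_of_ne_top (EReal.coe_ne_top _), EReal.toReal_coe, EReal.toReal_coe]
      rcases le_total 0 c with h2 | h2 <;> rcases le_total 0 a with h3 | h3
      · rw [ENNReal.ofReal_of_nonpos (by linarith : -c ≤ 0),
          ENNReal.ofReal_of_nonpos (by linarith : -a ≤ 0), add_zero, zero_add,
          ← ENNReal.ofReal_add h3 (by linarith)]; congr 1; ring
      · rw [ENNReal.ofReal_of_nonpos (by linarith : -c ≤ 0),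
          ENNReal.ofReal_of_nonpos h3, add_zero, zero_add,
          ← ENNReal.ofReal_add (by linarith) h2]; congr 1; ring
      · simp [show c = 0 by linarith, show a = 0 by linarith]
      · rw [ENNReal.ofReal_of_nonpos h2, ENNReal.ofReal_of_nonpos h3, add_zero, zero_add,
          ← ENNReal.ofReal_add (by linarith) (by linarith)]; congr 1; ring
  have hm1 : AEMeasurable (fun x => (f x).toENNReal) μ :=
    EReal.continuous_toENNReal.measurable.comp_aemeasurable hf
  have hm2 : AEMeasurable (fun x => (-f x).toENNReal) μ :=
    (EReal.continuous_toENNReal.comp continuous_neg).measurable.comp_aemeasurable hf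
  have hint := lintegral_congr_ae hpt
  rw [lintegral_add_left' hm1, lintegral_add_right _ measurable_const, lintegral_add_left' hm2,
    lintegral_const, lintegral_const] at hint
  have hinv : (μ univ)⁻¹ * μ univ = 1 := ENNReal.inv_mul_cancel h0 htop
  have hpos : (μ univ)⁻¹ * ∫⁻ x, (f x).toENNReal ∂μ ≤ ENNReal.ofReal c := by
    calc (μ univ)⁻¹ * ∫⁻ x, (f x).toENNReal ∂μ
        ≤ (μ univ)⁻¹ * ∫⁻ _, ENNReal.ofReal c ∂μ := by
          refine mul_le_mul_right (lintegral_mono_ae ?_) _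
          filter_upwards [hc] with x hx
          have := EReal.toENNReal_le_toENNReal hx
          rwa [EReal.toENNReal_of_ne_top (EReal.coe_ne_top _), EReal.toReal_coe] at this
      _ = ENNReal.ofReal c := by rw [lintegral_const, mul_left_comm, hinv, mul_one]
  replace hint := congrArg (fun t => (μ univ)⁻¹ * t) hint
  simp only [mul_add] at hint
  rw [mul_left_comm _ (ENNReal.ofReal (-c)), mul_left_comm _ (ENNReal.ofReal c), hinv, mul_one, mul_one] at hint
  rw [eAverage]
  generalize (μ univ)⁻¹ * ∫⁻ x, (f x).toENNReal ∂μ = A at hint hpos ⊢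
  generalize (μ univ)⁻¹ * ∫⁻ x, (-f x).toENNReal ∂μ = B at hint ⊢
  generalize (μ univ)⁻¹ * ∫⁻ x, coFun c (f x) ∂μ = T at hint ⊢
  have hAtop : A ≠ ⊤ := (hpos.trans_lt ENNReal.ofReal_lt_top).ne
  lift A to NNReal using hAtop
  by_cases hTtop : T = ⊤
  · have hBtop : B = ⊤ := by
      rw [hTtop] at hint
      by_contra hne
      exact ENNReal.add_ne_top.2 ⟨hne, ENNReal.ofReal_ne_top⟩ (by rw [← hint]; simp)
    rw [hTtop, hBtop]
    simp
  · have hBtop : B ≠ ⊤ := by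
      intro hne
      rw [hne, top_add] at hint
      exact ENNReal.add_ne_top.2 ⟨ENNReal.coe_ne_top, ENNReal.add_ne_top.2
        ⟨hTtop, ENNReal.ofReal_ne_top⟩⟩ hint
    lift T to NNReal using hTtop
    lift B to NNReal using hBtop
    have h1 := congrArg ENNReal.toReal hint
    rw [ENNReal.toReal_add ENNReal.coe_ne_top (by simp), ENNReal.toReal_add ENNReal.coe_ne_top
      (by simp), ENNReal.toReal_add ENNReal.coe_ne_top (by simp), ENNReal.toReal_ofReal',
      ENNReal.toReal_ofReal'] at h1
    simp only [ENNReal.coe_toReal] at h1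
    rw [show ((A : ENNReal) : EReal) = ((A : ℝ) : EReal) from rfl,
      show ((B : ENNReal) : EReal) = ((B : ℝ) : EReal) from rfl,
      show ((T : ENNReal) : EReal) = ((T : ℝ) : EReal) from rfl,
      ← EReal.coe_sub, ← EReal.coe_sub, EReal.coe_eq_coe_iff]
    have h2 : max c 0 - max (-c) 0 = c := by
      rcases le_total 0 c with h | h
      · rw [max_eq_left h, max_eq_right (by linarith)]; ring
      · rw [max_eq_right h, max_eq_left (by linarith)]; ring
    linarith

/-! ### The normalized volume measure on the unit ball -/

/-- The normalized volume measure on the unit ball. -/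
noncomputable def ballProb (n : ℕ) : Measure (EuclideanSpace ℝ (Fin n)) :=
  (volume (Metric.ball (0 : EuclideanSpace ℝ (Fin n)) 1))⁻¹ •
    volume.restrict (Metric.ball (0 : EuclideanSpace ℝ (Fin n)) 1)

instance (n : ℕ) : IsProbabilityMeasure (ballProb n) where
  measure_univ := by
    rw [ballProb, Measure.smul_apply, smul_eq_mul, Measure.restrict_apply_univ,
      ENNReal.inv_mul_cancel (volume_unitBall_ne_zero n) (volume_unitBall_ne_top n)]

lemma lintegral_ballProb {n : ℕ} (f : EuclideanSpace ℝ (Fin n) → ENNReal) :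
    ∫⁻ y, f y ∂(ballProb n) = (volume (Metric.ball (0 : EuclideanSpace ℝ (Fin n)) 1))⁻¹ *
      ∫⁻ y in Metric.ball (0 : EuclideanSpace ℝ (Fin n)) 1, f y := by
  rw [ballProb, lintegral_smul_measure, smul_eq_mul]

lemma ae_ballProb (n : ℕ) [NeZero n] : ∀ᵐ y ∂(ballProb n), 0 < ‖y‖ ∧ ‖y‖ < 1 := by
  have : Nonempty (Fin n) := ⟨⟨0, Nat.pos_of_ne_zero (NeZero.ne n)⟩⟩
  rw [ballProb, Measure.ae_ennreal_smul_measure_iff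
    (ENNReal.inv_ne_zero.2 (volume_unitBall_ne_top n))]
  have h1 : ∀ᵐ y ∂(volume.restrict (Metric.ball (0 : EuclideanSpace ℝ (Fin n)) 1)),
      y ∈ ({0} : Set (EuclideanSpace ℝ (Fin n)))ᶜ :=
    ae_restrict_of_ae (measure_eq_zero_iff_ae_notMem.1 (measure_singleton 0))
  filter_upwards [h1, ae_restrict_mem measurableSet_ball] with y hy hy1
  exact ⟨norm_pos_iff.2 hy, mem_ball_zero_iff.1 hy1⟩

lemma integrable_ballProb_norm_iff {n : ℕ} [NeZero n] {f : ℝ → ℝ} :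
    Integrable (fun y => f ‖y‖) (ballProb n) ↔
      IntegrableOn (fun t : ℝ => t ^ (n - 1) * f t) (Ioo 0 1) := by
  have : Nonempty (Fin n) := ⟨⟨0, Nat.pos_of_ne_zero (NeZero.ne n)⟩⟩
  rw [ballProb, integrable_smul_measure (ENNReal.inv_ne_zero.2 (volume_unitBall_ne_top n))
    (ENNReal.inv_ne_top.2 (volume_unitBall_ne_zero n)), ← IntegrableOn,
    ← integrable_indicator_iff measurableSet_ball]
  have h1 : (Metric.ball (0 : EuclideanSpace ℝ (Fin n)) 1).indicator (fun y => f ‖y‖) =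
      fun y => (Iio (1 : ℝ)).indicator f ‖y‖ := by
    funext y
    by_cases hy : ‖y‖ < 1
    · rw [indicator_of_mem (mem_ball_zero_iff.2 hy), indicator_of_mem (mem_Iio.2 hy)]
    · rw [indicator_of_notMem (fun h => hy (mem_ball_zero_iff.1 h)),
        indicator_of_notMem (fun h => hy (mem_Iio.1 h))]
  rw [h1, integrable_fun_norm_addHaar]
  have h2 : (fun y : ℝ => y ^ (Module.finrank ℝ (EuclideanSpace ℝ (Fin n)) - 1) •
      (Iio (1 : ℝ)).indicator f y) = (Iio (1 : ℝ)).indicator fun t => t ^ (n - 1) * f t := by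
    funext t
    by_cases ht : t ∈ Iio (1 : ℝ) <;> simp [ht]
  rw [h2, IntegrableOn, integrable_indicator_iff measurableSet_Iio, IntegrableOn,
    Measure.restrict_restrict measurableSet_Iio, IntegrableOn, inter_comm, Ioi_inter_Iio]

lemma integral_ballProb_norm {n : ℕ} [NeZero n] (f : ℝ → ℝ) :
    ∫ y, f ‖y‖ ∂(ballProb n) = n * ∫ t in Ioo (0 : ℝ) 1, t ^ (n - 1) * f t := by
  have : Nonempty (Fin n) := ⟨⟨0, Nat.pos_of_ne_zero (NeZero.ne n)⟩⟩
  rw [ballProb, integral_smul_measure, ← integral_indicator measurableSet_ball]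
  have h1 : (Metric.ball (0 : EuclideanSpace ℝ (Fin n)) 1).indicator (fun y => f ‖y‖) =
      fun y => (Iio (1 : ℝ)).indicator f ‖y‖ := by
    funext y
    by_cases hy : ‖y‖ < 1
    · rw [indicator_of_mem (mem_ball_zero_iff.2 hy), indicator_of_mem (mem_Iio.2 hy)]
    · rw [indicator_of_notMem (fun h => hy (mem_ball_zero_iff.1 h)),
        indicator_of_notMem (fun h => hy (mem_Iio.1 h))]
  rw [h1, integral_fun_norm_addHaar]
  have h2 : (fun y : ℝ => y ^ (Module.finrank ℝ (EuclideanSpace ℝ (Fin n)) - 1) •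
      (Iio (1 : ℝ)).indicator f y) = (Iio (1 : ℝ)).indicator fun t => t ^ (n - 1) * f t := by
    funext t
    by_cases ht : t ∈ Iio (1 : ℝ) <;> simp [ht]
  rw [h2, integral_indicator measurableSet_Iio, Measure.restrict_restrict measurableSet_Iio,
    inter_comm, Ioi_inter_Iio, finrank_euclideanSpace_fin, Measure.real, nsmul_eq_mul, smul_eq_mul,
    ENNReal.toReal_inv, smul_eq_mul]
  have : (volume (Metric.ball (0 : EuclideanSpace ℝ (Fin n)) 1)).toReal ≠ 0 :=
    ENNReal.toReal_ne_zero.2 ⟨volume_unitBall_ne_zero n, volume_unitBall_ne_top n⟩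
  field_simp

lemma integrable_norm_rpow_ballProb {n : ℕ} [NeZero n] {α : ℝ} (hα : -(n : ℝ) < α) :
    Integrable (fun y => ‖y‖ ^ α) (ballProb n) := by
  refine (integrable_ballProb_norm_iff (n := n) (f := fun t => t ^ α)).2 ?_
  have h1 : IntegrableOn (fun t : ℝ => t ^ ((n : ℝ) - 1 + α)) (Ioo 0 1) :=
    (intervalIntegral.integrableOn_Ioo_rpow_iff one_pos).2 (by linarith)
  refine h1.congr_fun (fun t ht => ?_) measurableSet_Ioo
  have hn : ((n - 1 : ℕ) : ℝ) = n - 1 := by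
    rw [Nat.cast_sub (Nat.one_le_iff_ne_zero.2 (NeZero.ne n)), Nat.cast_one]
  simp only
  rw [Real.rpow_add ht.1, ← Real.rpow_natCast, hn]

lemma continuous_pow_mul_log (k : ℕ) : Continuous fun t : ℝ => t ^ k * (t * Real.log t) :=
  (continuous_pow k).mul Real.continuous_mul_log

lemma integrable_log_norm_ballProb {n : ℕ} [NeZero n] :
    Integrable (fun y => Real.log ‖y‖) (ballProb n) := by
  refine (integrable_ballProb_norm_iff (f := Real.log)).2 ?_
  have h1 : IntegrableOn Real.log (Ioo 0 1) :=
    ((intervalIntegrable_iff_integrableOn_Ioo_of_le zero_le_one).1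
      intervalIntegral.intervalIntegrable_log')
  refine h1.bdd_mul (c := 1) (continuous_pow _).aestronglyMeasurable ?_
  filter_upwards [ae_restrict_mem measurableSet_Ioo] with t ht
  rw [norm_pow, Real.norm_of_nonneg ht.1.le]
  exact pow_le_one₀ ht.1.le ht.2.le

lemma integral_log_norm_ballProb {n : ℕ} [NeZero n] :
    ∫ y, Real.log ‖y‖ ∂(ballProb n) = -(1 / n) := by
  have hn : (0 : ℝ) < n := by exact_mod_cast Nat.pos_of_ne_zero (NeZero.ne n)
  obtain ⟨k, hk⟩ : ∃ k, n = k + 1 := Nat.exists_eq_succ_of_ne_zero (NeZero.ne n)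
  rw [integral_ballProb_norm, ← integral_Ioc_eq_integral_Ioo,
    ← intervalIntegral.integral_of_le zero_le_one]
  have hint : IntervalIntegrable (fun t : ℝ => t ^ (n - 1) * Real.log t) volume 0 1 :=
    (intervalIntegrable_iff_integrableOn_Ioo_of_le zero_le_one).2
      (integrable_ballProb_norm_iff.1 (integrable_log_norm_ballProb (n := n)))
  rw [intervalIntegral.integral_eq_sub_of_hasDerivAt_of_le zero_le_one
    -- The antiderivative is written with a factor `t log t`, which is continuous at the left
    -- endpoint.
    (f := fun t => (n : ℝ)⁻¹ * (t ^ k * (t * Real.log t)) - ((n : ℝ) ^ 2)⁻¹ * t ^ n) ?_ ?_ hint]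
  · have h0 : (0 : ℝ) ^ n = 0 := zero_pow (NeZero.ne n)
    simp only [Real.log_one, Real.log_zero, mul_zero, one_pow, h0]
    field_simp
    ring
  · exact ((continuous_const.mul (continuous_pow_mul_log k)).sub
      (continuous_const.mul (continuous_pow n))).continuousOn
  · intro t ht
    have ht0 : t ≠ 0 := ht.1.ne'
    have hfun : (fun t : ℝ => (n : ℝ)⁻¹ * (t ^ k * (t * Real.log t)) - ((n : ℝ) ^ 2)⁻¹ * t ^ n) =
        fun t : ℝ => (n : ℝ)⁻¹ * (t ^ n * Real.log t) - ((n : ℝ) ^ 2)⁻¹ * t ^ n := by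
      funext t; rw [hk, pow_succ]; ring
    rw [hfun]
    refine (((((hasDerivAt_pow n t).mul (Real.hasDerivAt_log ht0)).const_mul (n : ℝ)⁻¹).sub
      ((hasDerivAt_pow n t).const_mul ((n : ℝ) ^ 2)⁻¹))).congr_deriv ?_
    have : t ^ n = t ^ (n - 1) * t := by rw [hk, Nat.add_sub_cancel, pow_succ]
    rw [this]
    field_simp
    ring

lemma integrable_rieszK_norm_ballProb {n : ℕ} [NeZero n] {p : ℝ} (hp : p ≤ n) :
    Integrable (fun y => rieszK p ‖y‖) (ballProb n) := by
  rcases lt_trichotomy p 2 with h | rfl | h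
  · rw [rieszK_of_lt h]
    exact integrable_norm_rpow_ballProb (by linarith)
  · rw [rieszK_two]
    exact integrable_log_norm_ballProb
  · refine (integrable_norm_rpow_ballProb (α := 2 - p) (by linarith)).neg.congr ?_
    filter_upwards [ae_ballProb n] with y hy
    rw [rieszK_of_gt h hy.1]; rfl

/-- The radial volume average. -/
noncomputable def ballRadial (n : ℕ) (ψ : ℝ → ℝ) (r : ℝ) : ℝ := ∫ y, ψ (r * ‖y‖) ∂(ballProb n)

/-- By homogeneity the increment of `K` at radii scaled by `|y|` is `|y|^(2-p)` times the unscaled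
one, so integrating the density estimate yields the factor `∫ |y|^(2-p)`. Integrability needs `2 - p
> -n`, which `p ≤ n` provides. -/
theorem HasRealDensity.ballRadial {n : ℕ} [NeZero n] {p Θ : ℝ} (hp : p ≤ n) {ψ : ℝ → ℝ}
    (h : HasRealDensity p ψ Θ)
    (hm : Measurable fun x : EuclideanSpace ℝ (Fin n) => ψ ‖x‖) :
    HasRealDensity p (Tangents.ballRadial n ψ) (Θ * ∫ y, ‖y‖ ^ (2 - p) ∂(ballProb n)) ∧
      ∃ δ : ℝ, 0 < δ ∧ ∀ r ∈ Ioo 0 δ,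
        Integrable (fun y => ψ (r * ‖y‖)) (ballProb n) := by
  have hκi : Integrable (fun y => ‖y‖ ^ (2 - p)) (ballProb n) :=
    integrable_norm_rpow_ballProb (by linarith)
  have hKi : ∀ r : ℝ, 0 < r → Integrable (fun y => rieszK p (r * ‖y‖)) (ballProb n) := by
    intro r hr
    have h1 : Integrable (fun y => ‖y‖ ^ (2 - p) * (rieszK p r - rieszK p 1) + rieszK p ‖y‖)
        (ballProb n) := (hκi.mul_const _).add (integrable_rieszK_norm_ballProb hp)
    refine h1.congr ?_
    filter_upwards [ae_ballProb n] with y hy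
    have := rieszK_mul_sub p hr one_pos hy.1
    rw [one_mul] at this
    linarith
  have hmr : ∀ r : ℝ, 0 < r → Measurable fun y : EuclideanSpace ℝ (Fin n) => ψ (r * ‖y‖) := by
    intro r hr
    have h1 : Measurable fun y : EuclideanSpace ℝ (Fin n) => ψ ‖r • y‖ :=
      hm.comp (measurable_const_smul r)
    simpa only [norm_smul, Real.norm_of_nonneg hr.le] using h1
  have hψi : ∃ δ : ℝ, 0 < δ ∧ ∀ r ∈ Ioo 0 δ,
      Integrable (fun y => ψ (r * ‖y‖)) (ballProb n) := by
    -- The density estimate with `ε = 1` already dominates `ψ` by a constant plus a multiple of the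
    -- integrable kernel.
    obtain ⟨δ, hδ, hd⟩ := h 1 one_pos
    refine ⟨δ, hδ, fun r hr => ?_⟩
    have h1 : Integrable (fun y => |ψ r| + (|Θ| + 1) * (|rieszK p r| + |rieszK p (r * ‖y‖)|))
        (ballProb n) :=
      (integrable_const _).add (((integrable_const _).add (hKi r hr.1).abs).const_mul _)
    refine h1.mono' (hmr r hr.1).aestronglyMeasurable ?_
    filter_upwards [ae_ballProb n] with y hy
    have hlt : r * ‖y‖ < r := by nlinarith [hr.1, hy.2]
    have h2 := hd (r * ‖y‖) r (mul_pos hr.1 hy.1) hlt hr.2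
    have hK := rieszK_lt (p := p) (mul_pos hr.1 hy.1) hlt
    set k := rieszK p r - rieszK p (r * ‖y‖) with hk
    have h3 : k ≤ |rieszK p r| + |rieszK p (r * ‖y‖)| := (le_abs_self _).trans (abs_sub _ _)
    have h4 : |ψ r - ψ (r * ‖y‖)| ≤ (|Θ| + 1) * k := by
      have h5 : |Θ * k| = |Θ| * k := by rw [abs_mul, abs_of_pos (sub_pos.2 hK)]
      calc |ψ r - ψ (r * ‖y‖)| = |(ψ r - ψ (r * ‖y‖) - Θ * k) + Θ * k| := by ring_nf
        _ ≤ |ψ r - ψ (r * ‖y‖) - Θ * k| + |Θ * k| := abs_add_le _ _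
        _ ≤ (|Θ| + 1) * k := by rw [h5]; linarith
    rw [Real.norm_eq_abs]
    calc |ψ (r * ‖y‖)| = |ψ r - (ψ r - ψ (r * ‖y‖))| := by ring_nf
      _ ≤ |ψ r| + |ψ r - ψ (r * ‖y‖)| := abs_sub _ _
      _ ≤ |ψ r| + (|Θ| + 1) * (|rieszK p r| + |rieszK p (r * ‖y‖)|) := by
        have := mul_le_mul_of_nonneg_left h3 (by positivity : 0 ≤ |Θ| + 1)
        linarith
  refine ⟨fun ε hε => ?_, hψi⟩
  obtain ⟨δ₁, hδ₁, hint⟩ := hψi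
  set κ := ∫ y, ‖y‖ ^ (2 - p) ∂(ballProb n) with hκ
  have hκ0 : 0 ≤ κ := integral_nonneg fun y => Real.rpow_nonneg (norm_nonneg y) _
  obtain ⟨δ, hδ, hd⟩ := h (ε / (κ + 1)) (by positivity)
  refine ⟨min δ δ₁, lt_min hδ hδ₁, fun s r hs hsr hr => ?_⟩
  have hr0 : 0 < r := hs.trans hsr
  have hrδ := hr.trans_le (min_le_left _ _)
  have hrδ₁ := hr.trans_le (min_le_right _ _)
  have hir := hint r ⟨hr0, hrδ₁⟩
  have his := hint s ⟨hs, hsr.trans hrδ₁⟩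
  set k := rieszK p r - rieszK p s with hk
  have hk0 : 0 < k := sub_pos.2 (rieszK_lt hs hsr)
  have heq : Tangents.ballRadial n ψ r - Tangents.ballRadial n ψ s - Θ * κ * k =
      ∫ y, (ψ (r * ‖y‖) - ψ (s * ‖y‖) - Θ * k * ‖y‖ ^ (2 - p)) ∂(ballProb n) := by
    have h1 : Integrable (fun y => ψ (r * ‖y‖) - ψ (s * ‖y‖)) (ballProb n) := hir.sub his
    rw [integral_sub h1 (hκi.const_mul _), integral_sub hir his, integral_const_mul,
      Tangents.ballRadial, Tangents.ballRadial]
    ring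
  rw [heq]
  have hbound : ‖∫ y, (ψ (r * ‖y‖) - ψ (s * ‖y‖) - Θ * k * ‖y‖ ^ (2 - p)) ∂(ballProb n)‖ ≤
      ∫ y, (ε / (κ + 1) * k) * ‖y‖ ^ (2 - p) ∂(ballProb n) := by
    refine norm_integral_le_of_norm_le (hκi.const_mul _) ?_
    filter_upwards [ae_ballProb n] with y hy
    have h1 := hd (s * ‖y‖) (r * ‖y‖) (mul_pos hs hy.1) (mul_lt_mul_of_pos_right hsr hy.1)
      (by nlinarith [hy.2])
    rw [rieszK_mul_sub p hr0 hs hy.1] at h1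
    rw [Real.norm_eq_abs]
    convert h1 using 1
    · congr 1; rw [hk]; ring
    · rw [hk]; ring
  rw [Real.norm_eq_abs, integral_const_mul, ← hκ] at hbound
  refine hbound.trans ?_
  have h5 : ε / (κ + 1) * κ ≤ ε := by
    rw [div_mul_eq_mul_div, div_le_iff₀ (by positivity)]; nlinarith
  calc ε / (κ + 1) * k * κ = ε / (κ + 1) * κ * k := by ring
    _ ≤ ε * k := mul_le_mul_of_nonneg_right h5 hk0.le

/-! ### Spherical and volume means as real functions -/

section means

variable {n : ℕ} {f : EuclideanSpace ℝ (Fin n) → EReal} {R c : ℝ}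

/-- The functions with values in `[-∞, c]` on the ball of radius `R`, with spherical means `ψ`. -/
structure HasMeans (f : EuclideanSpace ℝ (Fin n) → EReal) (R c : ℝ) (ψ : ℝ → ℝ) : Prop where
  measurable : Measurable (coOn (Metric.ball 0 R) c f)
  le : ∀ x ∈ Metric.ball (0 : EuclideanSpace ℝ (Fin n)) R, f x ≤ c
  sphMean_eq : ∀ r ∈ Ioo 0 R, sphMean (coOn (Metric.ball 0 R) c f) r = ENNReal.ofReal (c - ψ r)
  le_const : ∀ r ∈ Ioo 0 R, ψ r ≤ c

lemma eq_sub_coOn {x : EuclideanSpace ℝ (Fin n)} (hx : x ∈ Metric.ball 0 R) (h : f x ≤ c) :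
    f x = (c : EReal) - (coOn (Metric.ball 0 R) c f x : EReal) := by
  rw [coOn_of_mem hx]; exact eq_sub_coFun h

lemma continuous_const_sub_coe_ennreal (c : ℝ) :
    Continuous fun t : ENNReal => (c : EReal) - (t : EReal) := by
  refine continuous_iff_continuousAt.2 fun a => ?_
  have h : ContinuousAt (fun p : EReal × EReal => p.1 + p.2) ((c : EReal), -(a : EReal)) :=
    EReal.continuousAt_add (Or.inl (EReal.coe_ne_top _)) (Or.inl (EReal.coe_ne_bot _))
  exact h.comp (f := fun a : ENNReal => ((c : EReal), -(a : EReal)))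
    (continuousAt_const.prodMk (continuous_neg.comp continuous_coe_ennreal_ereal).continuousAt)

lemma coe_sub_ofReal {c a : ℝ} (h : a ≤ c) :
    (c : EReal) - (ENNReal.ofReal (c - a) : EReal) = a := by
  rw [EReal.coe_ennreal_ofReal, max_eq_left (by linarith), ← EReal.coe_sub]; simp

/-- The bound `m` on the single sphere may differ from the global bound `c`. With `m` the spherical
maximum, the reflected mean becomes `M - S`, as in Harnack's inequality. -/
lemma sphereMean_eq_sub [NeZero n] (hm : Measurable (coOn (Metric.ball 0 R) c f))
    (hle : ∀ x ∈ Metric.ball (0 : EuclideanSpace ℝ (Fin n)) R, f x ≤ c) {r : ℝ}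
    (hr : r ∈ Ioo 0 R) {m : ℝ} (hfm : ∀ x : EuclideanSpace ℝ (Fin n), ‖x‖ = r → f x ≤ m) :
    sphereMean f r = (m : EReal) - (sphMean (fun x => coFun m (f x)) r : EReal) := by
  have : Nonempty (Fin n) := ⟨⟨0, Nat.pos_of_ne_zero (NeZero.ne n)⟩⟩
  have hnorm : ∀ σ : Metric.sphere (0 : EuclideanSpace ℝ (Fin n)) 1,
      ‖r • (σ : EuclideanSpace ℝ (Fin n))‖ = r := fun σ => by
    rw [norm_smul, norm_eq_of_mem_sphere, mul_one, Real.norm_of_nonneg hr.1.le]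
  have hmem : ∀ σ : Metric.sphere (0 : EuclideanSpace ℝ (Fin n)) 1,
      r • (σ : EuclideanSpace ℝ (Fin n)) ∈ Metric.ball (0 : EuclideanSpace ℝ (Fin n)) R :=
    fun σ => by rw [mem_ball_zero_iff, hnorm]; exact hr.2
  rw [sphereMean, eAverage_eq (c := m) _ (measure_ne_top _ _) _
    (Eventually.of_forall fun σ => hfm _ (hnorm σ)), sphMean, sphereProb, lintegral_smul_measure,
    smul_eq_mul]
  · rw [Ne, Measure.measure_univ_eq_zero]
    exact Measure.toSphere_ne_zero _
  · refine Measurable.aemeasurable ?_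
    have h1 : (fun σ : Metric.sphere (0 : EuclideanSpace ℝ (Fin n)) 1 =>
        f (r • (σ : EuclideanSpace ℝ (Fin n)))) =
        fun σ : Metric.sphere (0 : EuclideanSpace ℝ (Fin n)) 1 => (c : EReal) - (coOn (Metric.ball 0 R) c f (r • (σ : EuclideanSpace ℝ (Fin n))) : EReal) :=
      funext fun σ => eq_sub_coOn (hmem σ) (hle _ (hmem σ))
    rw [h1]
    exact (continuous_const_sub_coe_ennreal c).measurable.comp
      (hm.comp (measurable_subtype_coe.const_smul r))

lemma sphMean_coOn {r : ℝ} (hr : r ∈ Ioo 0 R) :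
    sphMean (coOn (Metric.ball 0 R) c f) r = sphMean (fun x => coFun c (f x)) r :=
  sphMean_congr fun x hx => coOn_of_mem (mem_ball_zero_iff.2 (by
    rw [hx, abs_of_pos hr.1]; exact hr.2))

lemma HasMeans.sphereMean_eq [NeZero n] {ψ : ℝ → ℝ} (h : HasMeans f R c ψ) {r : ℝ}
    (hr : r ∈ Ioo 0 R) : sphereMean f r = ψ r := by
  rw [sphereMean_eq_sub h.measurable h.le hr fun x hx => h.le x (mem_ball_zero_iff.2
    (hx.trans_lt hr.2)), ← sphMean_coOn hr, h.sphMean_eq r hr, coe_sub_ofReal (h.le_const r hr)]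

lemma restrict_closedBall (n : ℕ) [NeZero n] :
    (volume : Measure (EuclideanSpace ℝ (Fin n))).restrict (Metric.closedBall 0 1) =
      volume.restrict (Metric.ball 0 1) := by
  have : Nonempty (Fin n) := ⟨⟨0, Nat.pos_of_ne_zero (NeZero.ne n)⟩⟩
  refine (Measure.restrict_congr_set (ae_eq_set.2 ⟨?_, ?_⟩)).symm
  · rw [sdiff_eq_empty.2 Metric.ball_subset_closedBall, measure_empty]
  · rw [Metric.closedBall_sdiff_ball]
    exact Measure.addHaar_sphere _ _ _

/-- By averaging over rotations, the ball average only sees the spherical means at the radii `r|y|`.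
-/
lemma HasMeans.ballMean_eq [NeZero n] {Ω : Type*} [MeasurableSpace Ω] {ν : Measure Ω}
    {T : Ω → EuclideanSpace ℝ (Fin n) ≃ₗᵢ[ℝ] EuclideanSpace ℝ (Fin n)}
    (hT : IsRotationAverage ν T) {ψ : ℝ → ℝ} (h : HasMeans f R c ψ) {r : ℝ}
    (hr : r ∈ Ioo 0 R) (hint : Integrable (fun y => ψ (r * ‖y‖)) (ballProb n)) :
    ballMean f r = ballRadial n ψ r := by
  have hmem : ∀ y ∈ Metric.ball (0 : EuclideanSpace ℝ (Fin n)) 1,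
      r • y ∈ Metric.ball (0 : EuclideanSpace ℝ (Fin n)) R := fun y hy => by
    rw [mem_ball_zero_iff] at hy ⊢
    rw [norm_smul, Real.norm_of_nonneg hr.1.le]
    nlinarith [hr.1, hr.2]
  rw [ballMean, restrict_closedBall, eAverage_eq (c := c) _ _ _ _]
  · have h1 : ∫⁻ y in Metric.ball (0 : EuclideanSpace ℝ (Fin n)) 1, coFun c (f (r • y)) =
        ∫⁻ y in Metric.ball (0 : EuclideanSpace ℝ (Fin n)) 1,
          coOn (Metric.ball 0 R) c f (0 + r • y) :=
      setLIntegral_congr_fun measurableSet_ball fun y hy => by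
        simp only [zero_add]; rw [coOn_of_mem (hmem y hy)]
    have h2 : ballAvg (coOn (Metric.ball 0 R) c f) r 0 =
        ENNReal.ofReal (c - ballRadial n ψ r) := by
      rw [hT.ballAvg_eq h.measurable, ← lintegral_ballProb, ballRadial]
      have h3 : c - ∫ y, ψ (r * ‖y‖) ∂(ballProb n) = ∫ y, (c - ψ (r * ‖y‖)) ∂(ballProb n) := by
        rw [integral_sub (integrable_const _) hint]; simp
      rw [h3, ofReal_integral_eq_lintegral_ofReal (f := fun y => c - ψ (r * ‖y‖))
        ((integrable_const _).sub hint)]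
      · refine lintegral_congr_ae ?_
        filter_upwards [ae_ballProb n] with y hy
        simp only [zero_add]
        exact h.sphMean_eq _ ⟨mul_pos hr.1 hy.1, by nlinarith [hr.1, hr.2, hy.2]⟩
      · filter_upwards [ae_ballProb n] with y hy
        have := h.le_const (r * ‖y‖) ⟨mul_pos hr.1 hy.1, by nlinarith [hr.1, hr.2, hy.2]⟩
        simp only [Pi.zero_apply]
        linarith
    rw [Measure.restrict_apply_univ, h1, ← ballAvg, h2, coe_sub_ofReal]
    rw [ballRadial]
    calc ∫ y, ψ (r * ‖y‖) ∂(ballProb n) ≤ ∫ _, c ∂(ballProb n) := by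
          refine integral_mono_ae hint (integrable_const _) ?_
          filter_upwards [ae_ballProb n] with y hy
          exact h.le_const (r * ‖y‖) ⟨mul_pos hr.1 hy.1, by nlinarith [hr.1, hr.2, hy.2]⟩
      _ = c := by simp
  · rw [Measure.restrict_apply_univ]; exact volume_unitBall_ne_zero n
  · rw [Measure.restrict_apply_univ]; exact volume_unitBall_ne_top n
  · have h1 : Measurable fun y : EuclideanSpace ℝ (Fin n) =>
        (c : EReal) - (coOn (Metric.ball 0 R) c f (r • y) : EReal) :=
      (continuous_const_sub_coe_ennreal c).measurable.comp
        (h.measurable.comp (measurable_const_smul r))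
    refine h1.aemeasurable.congr ?_
    filter_upwards [ae_restrict_mem measurableSet_ball] with y hy
    exact (eq_sub_coOn (hmem y hy) (h.le _ (hmem y hy))).symm
  · filter_upwards [ae_restrict_mem measurableSet_ball] with y hy
    exact h.le _ (hmem y hy)

end means

/-! ### The Harnack inequality -/

/-- The denominator of the kernel is largest at `|x - σ| = 1 + |x|`, and one factor `1 + |x|`
cancels against `1 - |x|²`. -/
lemma harnackφ_le_poissonKernel {n : ℕ} {σ x : EuclideanSpace ℝ (Fin n)} (hσ : ‖σ‖ = 1)
    (hx : ‖x‖ < 1) : harnackφ n ‖x‖ ≤ poissonKernel σ x := by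
  have h1 : 0 < 1 + ‖x‖ := by positivity
  have hd : 0 < ‖x - σ‖ := norm_pos_iff.2 fun h => by
    rw [sub_eq_zero] at h; rw [h, hσ] at hx; exact lt_irrefl _ hx
  have h2 : ‖x - σ‖ ≤ 1 + ‖x‖ := by
    have := norm_sub_le x σ
    rw [hσ] at this; linarith
  have h3 : harnackφ n ‖x‖ = (1 - ‖x‖ ^ 2) / (1 + ‖x‖) ^ n := by
    rw [harnackφ, zpow_sub_one₀ h1.ne', zpow_natCast]
    field_simp
    ring
  rw [h3, poissonKernel]
  refine div_le_div_of_nonneg_left ?_ (pow_pos hd n) (pow_le_pow_left₀ hd.le h2 n)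
  nlinarith [norm_nonneg x]

lemma harnackφ_pos {n : ℕ} {l : ℝ} (h0 : 0 ≤ l) (h1 : l < 1) : 0 < harnackφ n l :=
  div_pos (by linarith) (zpow_pos (by linarith) _)

lemma harnackφ_zero (n : ℕ) : harnackφ n 0 = 1 := by simp [harnackφ]

theorem IsSubharmonicOn.harnackφ_mul_sphMean_le {n : ℕ} [NeZero n]
    {F : Set (Matrix (Fin n) (Fin n) ℝ)} (hF : ∀ H ∈ F, 0 ≤ H.trace)
    {u : EuclideanSpace ℝ (Fin n) → EReal} {X : Set (EuclideanSpace ℝ (Fin n))}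
    (hu : IsSubharmonicOn F u X) {R : ℝ} (hR : 0 < R) (hX : Metric.closedBall 0 R ⊆ X) {c : ℝ}
    (hc : ∀ x ∈ Metric.closedBall (0 : EuclideanSpace ℝ (Fin n)) R, u x ≤ c)
    {x : EuclideanSpace ℝ (Fin n)} (hx : ‖x‖ < 1) :
    ENNReal.ofReal (harnackφ n ‖x‖) * Tangents.sphMean (fun y => coFun c (u y)) R ≤
      coFun c (u (R • x)) := by
  refine le_trans ?_ (hu.lintegral_poissonKernel_ball_le hF hR hX hc hx)
  rw [Tangents.sphMean, ← lintegral_const_mul' _ _ ENNReal.ofReal_ne_top]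
  refine lintegral_mono fun σ => ?_
  refine mul_le_mul_left (ENNReal.ofReal_le_ofReal ?_) _
  exact harnackφ_le_poissonKernel (norm_eq_of_mem_sphere σ) hx

/-! ### Subharmonic functions near a point -/

lemma IsSubharmonicOn.exists_le {n : ℕ} {F : Set (Matrix (Fin n) (Fin n) ℝ)}
    {u : EuclideanSpace ℝ (Fin n) → EReal} {X : Set (EuclideanSpace ℝ (Fin n))}
    (hu : IsSubharmonicOn F u X) (hX : IsOpen X) (h0 : 0 ∈ X) :
    ∃ R c : ℝ, 0 < R ∧ Metric.closedBall 0 R ⊆ X ∧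
      ∀ x ∈ Metric.closedBall (0 : EuclideanSpace ℝ (Fin n)) R, u x ≤ (c : EReal) := by
  obtain ⟨c, hc⟩ : ∃ c : ℝ, u 0 < c := EReal.lt_iff_exists_real_btwn.1
    (lt_top_iff_ne_top.2 (hu.ne_top 0 h0)) |>.imp fun c hc => hc.1
  have h1 := hu.usc 0 h0 _ hc
  rw [hX.nhdsWithin_eq h0] at h1
  obtain ⟨R, hR, hb⟩ := Metric.nhds_basis_closedBall.eventually_iff.1
    (h1.and (hX.mem_nhds h0))
  exact ⟨R, c, hR, fun x hx => (hb hx).2, fun x hx => (hb hx).1.le⟩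

/-- The setting of a subharmonic function which is bounded above near the origin and not
identically `-∞`. -/
structure IsLocalSubharmonic {n : ℕ} (F : Set (Matrix (Fin n) (Fin n) ℝ))
    (u : EuclideanSpace ℝ (Fin n) → EReal) (R c : ℝ) : Prop where
  cone : IsConeSubequation F
  st : IsSTInvariant F
  conv : Convex ℝ F
  pos : 0 < R
  sub : IsSubharmonicOn F u (Metric.ball 0 R)
  le : ∀ x ∈ Metric.ball (0 : EuclideanSpace ℝ (Fin n)) R, u x ≤ (c : EReal)
  sphMean_ne_top : ∀ r ∈ Ioo 0 R, sphMean (coOn (Metric.ball 0 R) c u) r ≠ ⊤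

/-- If some spherical mean were `-∞`, Harnack's inequality would force `u = -∞` on the whole ball
inside that sphere, and hence near the origin. -/
theorem IsSubharmonicOn.exists_isLocalSubharmonic {n : ℕ} {F : Set (Matrix (Fin n) (Fin n) ℝ)}
    (hF : IsConeSubequation F) (hST : IsSTInvariant F) (hconv : Convex ℝ F)
    {u : EuclideanSpace ℝ (Fin n) → EReal} {X : Set (EuclideanSpace ℝ (Fin n))}
    (hu : IsSubharmonicOn F u X) (hX : IsOpen X) (h0 : 0 ∈ X)
    (hbot : ¬ ∀ᶠ x in 𝓝 (0 : EuclideanSpace ℝ (Fin n)), u x = ⊥) :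
    ∃ R c : ℝ, IsLocalSubharmonic F u R c := by
  have : NeZero n := ⟨hF.dim_ne_zero⟩
  obtain ⟨R, c, hR, hRX, hc⟩ := hu.exists_le hX h0
  have hb := Metric.ball_subset_closedBall (x := (0 : EuclideanSpace ℝ (Fin n))) (ε := R)
  refine ⟨R, c, hF, hST, hconv, hR, hu.mono subset_rfl (hb.trans hRX), fun x hx => hc x (hb hx),
    fun r hr htop => hbot ?_⟩
  have hr' : Metric.closedBall (0 : EuclideanSpace ℝ (Fin n)) r ⊆ Metric.closedBall 0 R :=
    Metric.closedBall_subset_closedBall hr.2.le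
  filter_upwards [Metric.ball_mem_nhds (0 : EuclideanSpace ℝ (Fin n)) hr.1] with x hx
  have hx1 : ‖r⁻¹ • x‖ < 1 := by
    rw [norm_smul, Real.norm_of_nonneg (inv_nonneg.2 hr.1.le), inv_mul_lt_iff₀ hr.1, mul_one]
    exact mem_ball_zero_iff.1 hx
  have h1 := hu.harnackφ_mul_sphMean_le (fun H hH => hF.trace_nonneg hST hconv hH) hr.1
    (hr'.trans hRX) (fun y hy => hc y (hr' hy)) hx1
  rw [← sphMean_coOn hr, htop, ENNReal.mul_top, smul_smul, mul_inv_cancel₀ hr.1.ne', one_smul,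
    top_le_iff, coFun_eq_top_iff] at h1
  · exact h1
  · exact (ENNReal.ofReal_pos.2 (harnackφ_pos (norm_nonneg _) hx1)).ne'

namespace IsLocalSubharmonic

variable {n : ℕ} {F : Set (Matrix (Fin n) (Fin n) ℝ)} {u : EuclideanSpace ℝ (Fin n) → EReal}
  {R c : ℝ}

lemma neZero (h : IsLocalSubharmonic F u R c) : NeZero n := ⟨h.cone.dim_ne_zero⟩

lemma lowerSemicontinuous (h : IsLocalSubharmonic F u R c) :
    LowerSemicontinuous (coOn (Metric.ball 0 R) c u) :=
  lowerSemicontinuous_coOn Metric.isOpen_ball h.sub.usc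

lemma closedBall_subset {r : ℝ} (hr : r < R) :
    Metric.closedBall (0 : EuclideanSpace ℝ (Fin n)) r ⊆ Metric.ball 0 R :=
  Metric.closedBall_subset_ball hr

/-- The spherical mean as a real number. -/
noncomputable def meanFun (u : EuclideanSpace ℝ (Fin n) → EReal) (R c : ℝ) (r : ℝ) : ℝ :=
  c - (Tangents.sphMean (coOn (Metric.ball 0 R) c u) r).toReal

lemma meanFun_le (r : ℝ) : meanFun u R c r ≤ c := by
  rw [meanFun]
  have := ENNReal.toReal_nonneg (a := Tangents.sphMean (coOn (Metric.ball 0 R) c u) r)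
  linarith

lemma hasMeans (h : IsLocalSubharmonic F u R c) : HasMeans u R c (meanFun u R c) where
  measurable := h.lowerSemicontinuous.measurable
  le := h.le
  sphMean_eq r hr := by
    rw [meanFun, sub_sub_cancel, ENNReal.ofReal_toReal (h.sphMean_ne_top r hr)]
  le_const r _ := meanFun_le r

lemma sphereMean_eq (h : IsLocalSubharmonic F u R c) {r : ℝ} (hr : r ∈ Ioo 0 R) :
    sphereMean u r = meanFun u R c r :=
  have := h.neZero
  h.hasMeans.sphereMean_eq hr

lemma measurable_meanFun (h : IsLocalSubharmonic F u R c) :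
    Measurable fun x : EuclideanSpace ℝ (Fin n) => meanFun u R c ‖x‖ :=
  have := h.neZero
  (measurable_sphMean_norm h.lowerSemicontinuous.measurable).ennreal_toReal.const_sub c

/-- The mean is an `F`-subharmonic radial function, and a radial function equals its own spherical
maximum. -/
lemma isRieszConvex_meanFun (h : IsLocalSubharmonic F u R c) :
    IsRieszConvex (rieszChar F) (meanFun u R c) R := by
  have := h.neZero
  refine (h.sub.sphMean h.cone h.st h.conv subset_rfl h.le).isRieszConvex_sphereMax h.cone h.st
    h.conv subset_rfl fun r hr => ?_
  rw [sphereMax_radial (fun t => (c : EReal) - (Tangents.sphMean (coOn (Metric.ball 0 R) c u) t :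
    ENNReal)) hr.1, h.hasMeans.sphMean_eq r hr, coe_sub_ofReal (meanFun_le r)]

/-- The maximum principle for the radial mean; unlike the monotonicity in `IsRieszConvex` it also
covers `x = 0`. -/
lemma sphMean_norm_antitone (h : IsLocalSubharmonic F u R c) {x : EuclideanSpace ℝ (Fin n)} {r : ℝ}
    (hr : r ∈ Ioo 0 R) (hx : ‖x‖ ≤ r) :
    Tangents.sphMean (coOn (Metric.ball 0 R) c u) r ≤
      Tangents.sphMean (coOn (Metric.ball 0 R) c u) ‖x‖ := by
  have := h.neZero
  have h1 := (h.sub.sphMean h.cone h.st h.conv subset_rfl h.le).le_of_le_sphere h.cone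
    (closedBall_subset hr.2) (a := meanFun u R c r) (fun y hy => by
      rw [hy, h.hasMeans.sphMean_eq r hr, coe_sub_ofReal (meanFun_le r)]) hx
  have h2 := antitone_coFun c h1
  rwa [coFun_sub_coe, coFun_coe, ← h.hasMeans.sphMean_eq r hr] at h2

lemma exists_sphereMax_eq (h : IsLocalSubharmonic F u R c) {r : ℝ} (hr : r ∈ Ioo 0 R) :
    ∃ m : ℝ, sphereMax u r = m ∧ meanFun u R c r ≤ m := by
  have := h.neZero
  have htop : sphereMax u r ≠ ⊤ := by
    have : sphereMax u r ≤ c := (sphereMax_le_iff hr.1).2 fun x hx => h.le x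
      (mem_ball_zero_iff.2 (hx.trans_lt hr.2))
    exact (this.trans_lt (EReal.coe_lt_top c)).ne
  have hmean : coFun c (sphereMax u r) ≤ Tangents.sphMean (coOn (Metric.ball 0 R) c u) r := by
    rw [sphMean_coOn hr, Tangents.sphMean]
    calc coFun c (sphereMax u r) = ∫⁻ _, coFun c (sphereMax u r) ∂(sphereProb n) := by simp
      _ ≤ _ := lintegral_mono fun σ => antitone_coFun c (le_sphereMax hr.1 (by
        rw [norm_smul, norm_eq_of_mem_sphere, mul_one, Real.norm_of_nonneg hr.1.le]))
  have hbot : sphereMax u r ≠ ⊥ := fun hb => by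
    rw [hb, coFun_bot, top_le_iff] at hmean
    exact h.sphMean_ne_top r hr hmean
  refine ⟨(sphereMax u r).toReal, (EReal.coe_toReal htop hbot).symm, ?_⟩
  rw [← EReal.coe_toReal htop hbot, coFun_coe, h.hasMeans.sphMean_eq r hr] at hmean
  rw [ENNReal.ofReal_le_ofReal_iff (sub_nonneg.2 (meanFun_le r))] at hmean
  linarith

/-- The spherical maximum as a real number. -/
noncomputable def maxFun (u : EuclideanSpace ℝ (Fin n) → EReal) (r : ℝ) : ℝ :=
  (sphereMax u r).toReal

lemma sphereMax_eq (h : IsLocalSubharmonic F u R c) {r : ℝ} (hr : r ∈ Ioo 0 R) :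
    sphereMax u r = maxFun u r := by
  obtain ⟨m, hm, _⟩ := h.exists_sphereMax_eq hr
  rw [maxFun, hm, EReal.toReal_coe]

lemma meanFun_le_maxFun (h : IsLocalSubharmonic F u R c) {r : ℝ} (hr : r ∈ Ioo 0 R) :
    meanFun u R c r ≤ maxFun u r := by
  obtain ⟨m, hm, hle⟩ := h.exists_sphereMax_eq hr
  rwa [maxFun, hm, EReal.toReal_coe]

lemma isRieszConvex_maxFun (h : IsLocalSubharmonic F u R c) :
    IsRieszConvex (rieszChar F) (maxFun u) R :=
  h.sub.isRieszConvex_sphereMax h.cone h.st h.conv subset_rfl fun _ hr => h.sphereMax_eq hr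

lemma le_maxFun (h : IsLocalSubharmonic F u R c) {r : ℝ} (hr : r ∈ Ioo 0 R)
    {x : EuclideanSpace ℝ (Fin n)} (hx : ‖x‖ ≤ r) : u x ≤ (maxFun u r : EReal) :=
  h.sub.le_of_le_sphere h.cone (closedBall_subset hr.2)
    ((sphereMax_le_iff hr.1).1 (h.sphereMax_eq hr).le) hx

/-- Harnack's inequality. -/
lemma maxFun_mul_le (h : IsLocalSubharmonic F u R c) {r : ℝ} (hr : r ∈ Ioo 0 R)
    {x : EuclideanSpace ℝ (Fin n)} (hx : ‖x‖ < 1) :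
    u (r • x) ≤ ((maxFun u r - harnackφ n ‖x‖ * (maxFun u r - meanFun u R c r) : ℝ) : EReal) := by
  have := h.neZero
  have hle : ∀ y ∈ Metric.closedBall (0 : EuclideanSpace ℝ (Fin n)) r, u y ≤ (maxFun u r : EReal) :=
    fun y hy => h.le_maxFun hr (mem_closedBall_zero_iff.1 hy)
  have h1 := h.sub.harnackφ_mul_sphMean_le
    (fun H hH => h.cone.trace_nonneg h.st h.conv hH) hr.1 (closedBall_subset hr.2) hle hx
  have h2 := sphereMean_eq_sub h.hasMeans.measurable h.le hr
    fun y hy => h.le_maxFun hr (le_of_eq hy)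
  rw [h.sphereMean_eq hr] at h2
  -- Reflecting at the maximum instead of at `c` turns the spherical mean of the reflection into the
  -- gap `M - S`.
  have h3 := coFun_sub_coe (maxFun u r) (Tangents.sphMean (fun y => coFun (maxFun u r) (u y)) r)
  rw [← h2, coFun_coe] at h3
  have hφ := harnackφ_pos (n := n) (norm_nonneg x) hx
  have hmm := h.meanFun_le_maxFun hr
  rw [← h3, ← ENNReal.ofReal_mul hφ.le] at h1
  have hxr : r • x ∈ Metric.closedBall (0 : EuclideanSpace ℝ (Fin n)) r := by
    rw [mem_closedBall_zero_iff, norm_smul, Real.norm_of_nonneg hr.1.le]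
    nlinarith [hr.1]
  rw [le_iff_coFun_le (hle _ hxr), coFun_coe]
  refine le_trans (le_of_eq ?_) h1
  congr 1; ring

end IsLocalSubharmonic

/-! ### Rescaling -/

lemma ereal_affine_le_iff {l : ℝ} (hl : 0 < l) (b : ℝ) {a : EReal} {t : ℝ} :
    (l : EReal) * a + b ≤ t ↔ a ≤ ((l⁻¹ * (t - b) : ℝ) : EReal) := by
  induction a with
  | bot => simp [EReal.coe_mul_bot_of_pos hl]
  | top =>
    rw [EReal.coe_mul_top_of_pos hl, EReal.top_add_coe]
    simp [-EReal.coe_mul]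
  | coe a =>
    rw [← EReal.coe_mul, ← EReal.coe_add, EReal.coe_le_coe_iff, EReal.coe_le_coe_iff,
      le_inv_mul_iff₀ hl]
    constructor <;> intro h <;> linarith

lemma ereal_affine_eq_iff {l : ℝ} (hl : 0 < l) (b : ℝ) {a : EReal} {t : ℝ} :
    (l : EReal) * a + b = t ↔ a = ((l⁻¹ * (t - b) : ℝ) : EReal) := by
  induction a with
  | bot =>
    rw [EReal.coe_mul_bot_of_pos hl, EReal.bot_add]
    exact ⟨fun h => absurd h (EReal.bot_ne_coe _), fun h => absurd h (EReal.bot_ne_coe _)⟩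
  | top =>
    rw [EReal.coe_mul_top_of_pos hl, EReal.top_add_coe]
    exact ⟨fun h => absurd h (EReal.top_ne_coe _), fun h => absurd h (EReal.top_ne_coe _)⟩
  | coe a =>
    rw [← EReal.coe_mul, ← EReal.coe_add, EReal.coe_eq_coe_iff, EReal.coe_eq_coe_iff,
      eq_inv_mul_iff_mul_eq₀ hl.ne']
    constructor <;> intro h <;> linarith

lemma ereal_affine_mono {l : ℝ} (hl : 0 < l) (b : ℝ) :
    Monotone fun a : EReal => (l : EReal) * a + b := fun _ _ h =>
  add_le_add (mul_le_mul_of_nonneg_left h (EReal.coe_nonneg.2 hl.le)) le_rfl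

lemma continuous_ereal_affine {l : ℝ} (hl : 0 < l) (b : ℝ) :
    Continuous fun a : EReal => (l : EReal) * a + b := by
  refine continuous_iff_continuousAt.2 fun a => ?_
  have h1 : ContinuousAt (fun a : EReal => (l : EReal) * a) a := by
    have h := EReal.continuousAt_mul (p := ((l : EReal), a)) (by simp [hl.ne']) (by simp [hl.ne'])
      (by simp) (by simp)
    exact h.comp (f := fun a : EReal => ((l : EReal), a))
      (continuousAt_const.prodMk continuousAt_id)
  have h2 : ContinuousAt (fun p : EReal × EReal => p.1 + p.2) ((l : EReal) * a, (b : EReal)) :=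
    EReal.continuousAt_add (Or.inr (EReal.coe_ne_bot _)) (Or.inr (EReal.coe_ne_top _))
  exact h2.comp (f := fun a : EReal => ((l : EReal) * a, (b : EReal)))
    (h1.prodMk continuousAt_const)

lemma coFun_affine {l : ℝ} (hl : 0 < l) (b c : ℝ) (a : EReal) :
    coFun (l * c + b) ((l : EReal) * a + b) = ENNReal.ofReal l * coFun c a := by
  induction a with
  | bot =>
    rw [EReal.coe_mul_bot_of_pos hl, EReal.bot_add, coFun_bot, coFun_bot, ENNReal.mul_top]
    simpa using hl
  | top =>
    rw [EReal.coe_mul_top_of_pos hl, EReal.top_add_coe]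
    simp [coFun]
  | coe a =>
    rw [← EReal.coe_mul, ← EReal.coe_add, coFun_coe, coFun_coe, ← ENNReal.ofReal_mul hl.le]
    congr 1; ring

lemma IsSubharmonicOn.affine {n : ℕ} {F : Set (Matrix (Fin n) (Fin n) ℝ)}
    (hF : IsConeSubequation F) {u : EuclideanSpace ℝ (Fin n) → EReal}
    {X : Set (EuclideanSpace ℝ (Fin n))} (hu : IsSubharmonicOn F u X) {l : ℝ} (hl : 0 < l) (b : ℝ) :
    IsSubharmonicOn F (fun x => (l : EReal) * u x + b) X where
  usc := (continuous_ereal_affine hl b).comp_upperSemicontinuousOn hu.usc (ereal_affine_mono hl b)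
  ne_top x hx := by
    have h := hu.ne_top x hx
    induction hux : u x with
    | bot => simp [EReal.coe_mul_bot_of_pos hl]
    | top => exact absurd hux h
    | coe a => rw [← EReal.coe_mul, ← EReal.coe_add]; exact EReal.coe_ne_top _
  viscosity x₀ hx₀ φ hφ hle heq := by
    have hφ' : ContDiffAt ℝ 2 (fun x => φ x + -b) x₀ := hφ.add contDiffAt_const
    have h1 := hu.viscosity x₀ hx₀ (fun x => l⁻¹ * (φ x + -b)) (contDiffAt_const.mul hφ')
      (hle.mono fun x hx => (ereal_affine_le_iff hl b).1 hx) ((ereal_affine_eq_iff hl b).1 heq)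
    rw [hessian_const_mul hφ', hessian_add hφ contDiffAt_const, hessian_const, add_zero] at h1
    have h2 := hF.cone _ h1 l hl.le
    rwa [smul_smul, mul_inv_cancel₀ hl.ne', one_smul] at h2

lemma IsSubharmonicOn.comp_smul {n : ℕ} {F : Set (Matrix (Fin n) (Fin n) ℝ)}
    (hF : IsConeSubequation F) {u : EuclideanSpace ℝ (Fin n) → EReal}
    {X : Set (EuclideanSpace ℝ (Fin n))} (hu : IsSubharmonicOn F u X) {r : ℝ} (hr : 0 < r) :
    IsSubharmonicOn F (fun x => u (r • x)) {x | r • x ∈ X} := by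
  have h := hu.comp_matCLM (M := r • 1) (N := r⁻¹ • 1) (F' := F)
    (by rw [Matrix.smul_mul, Matrix.one_mul, smul_smul, mul_inv_cancel₀ hr.ne', one_smul])
    (fun H hH => by
      simp only [Matrix.transpose_smul, Matrix.transpose_one, Matrix.smul_mul,
        Matrix.one_mul, Matrix.mul_smul, Matrix.mul_one, smul_smul]
      exact hF.cone H hH _ (by positivity)) 0
  simpa only [matCLM_smul_apply, matCLM_one_apply, add_zero] using h

namespace IsLocalSubharmonic

variable {n : ℕ} {F : Set (Matrix (Fin n) (Fin n) ℝ)} {u : EuclideanSpace ℝ (Fin n) → EReal}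
  {R c : ℝ}

lemma restrict (h : IsLocalSubharmonic F u R c) {R' c' : ℝ} (hR' : 0 < R') (hR : R' ≤ R)
    (hc : ∀ x ∈ Metric.ball (0 : EuclideanSpace ℝ (Fin n)) R', u x ≤ (c' : EReal)) :
    IsLocalSubharmonic F u R' c' where
  cone := h.cone
  st := h.st
  conv := h.conv
  pos := hR'
  sub := h.sub.mono subset_rfl (Metric.ball_subset_ball hR)
  le := hc
  sphMean_ne_top r hr htop := by
    have := h.neZero
    have hr' : r ∈ Ioo 0 R := ⟨hr.1, hr.2.trans_le hR⟩
    have h1 := sphereMean_eq_sub h.hasMeans.measurable h.le hr' (m := c') fun x hx =>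
      hc x (mem_ball_zero_iff.2 (hx.trans_lt hr.2))
    rw [← sphMean_coOn hr, htop, h.sphereMean_eq hr'] at h1
    simp at h1

lemma meanFun_eq (h : IsLocalSubharmonic F u R c) {R' c' : ℝ} (h' : IsLocalSubharmonic F u R' c')
    {r : ℝ} (hr : r ∈ Ioo 0 R) (hr' : r ∈ Ioo 0 R') : meanFun u R c r = meanFun u R' c' r :=
  EReal.coe_injective ((h.sphereMean_eq hr).symm.trans (h'.sphereMean_eq hr'))

section rescale

variable {r l : ℝ} (b : ℝ)

lemma smul_mem_ball_iff (hr : 0 < r) {x : EuclideanSpace ℝ (Fin n)} :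
    r • x ∈ Metric.ball (0 : EuclideanSpace ℝ (Fin n)) R ↔
      x ∈ Metric.ball (0 : EuclideanSpace ℝ (Fin n)) (R / r) := by
  rw [mem_ball_zero_iff, mem_ball_zero_iff, norm_smul, Real.norm_of_nonneg hr.le, lt_div_iff₀' hr]

lemma coOn_rescale (hr : 0 < r) (hl : 0 < l) (x : EuclideanSpace ℝ (Fin n)) :
    coOn (Metric.ball 0 (R / r)) (l * c + b) (fun x => (l : EReal) * u (r • x) + b) x =
      ENNReal.ofReal l * coOn (Metric.ball 0 R) c u (r • x) := by
  by_cases hx : x ∈ Metric.ball (0 : EuclideanSpace ℝ (Fin n)) (R / r)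
  · rw [coOn_of_mem hx, coOn_of_mem ((smul_mem_ball_iff hr).2 hx), coFun_affine hl]
  · rw [coOn, indicator_of_notMem hx, coOn,
      indicator_of_notMem fun h => hx ((smul_mem_ball_iff hr).1 h), mul_zero]

lemma sphMean_rescale (hr : 0 < r) (hl : 0 < l) (t : ℝ) :
    Tangents.sphMean (coOn (Metric.ball 0 (R / r)) (l * c + b)
        (fun x => (l : EReal) * u (r • x) + b)) t =
      ENNReal.ofReal l * Tangents.sphMean (coOn (Metric.ball 0 R) c u) (r * t) := by
  simp only [Tangents.sphMean, coOn_rescale b hr hl, smul_smul]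
  rw [lintegral_const_mul' _ _ ENNReal.ofReal_ne_top]

lemma mul_mem_Ioo (hr : 0 < r) {t : ℝ} (ht : t ∈ Ioo 0 (R / r)) : r * t ∈ Ioo 0 R :=
  ⟨mul_pos hr ht.1, (lt_div_iff₀' hr).1 ht.2⟩

lemma rescale (h : IsLocalSubharmonic F u R c) (hr : 0 < r) (hl : 0 < l) :
    IsLocalSubharmonic F (fun x => (l : EReal) * u (r • x) + b) (R / r) (l * c + b) where
  cone := h.cone
  st := h.st
  conv := h.conv
  pos := div_pos h.pos hr
  sub := ((h.sub.comp_smul h.cone hr).affine h.cone hl b).mono subset_rfl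
    fun _ hx => (smul_mem_ball_iff hr).2 hx
  le x hx := by
    have h1 := ereal_affine_mono hl b (h.le _ ((smul_mem_ball_iff hr).2 hx))
    simpa using h1
  sphMean_ne_top t ht := by
    rw [sphMean_rescale b hr hl]
    exact ENNReal.mul_ne_top ENNReal.ofReal_ne_top (h.sphMean_ne_top _ (mul_mem_Ioo hr ht))

lemma meanFun_rescale (hr : 0 < r) (hl : 0 < l) (t : ℝ) :
    meanFun (fun x => (l : EReal) * u (r • x) + b) (R / r) (l * c + b) t =
      l * meanFun u R c (r * t) + b := by
  rw [meanFun, meanFun, sphMean_rescale b hr hl, ENNReal.toReal_mul, ENNReal.toReal_ofReal hl.le]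
  ring

lemma maxFun_rescale (h : IsLocalSubharmonic F u R c) (hr : 0 < r) (hl : 0 < l) {t : ℝ}
    (ht : t ∈ Ioo 0 (R / r)) :
    maxFun (fun x => (l : EReal) * u (r • x) + b) t = l * maxFun u (r * t) + b := by
  have hrt := mul_mem_Ioo hr ht
  have key : ∀ a : ℝ, l * maxFun u (r * t) + b ≤ a ↔
      maxFun (fun x => (l : EReal) * u (r • x) + b) t ≤ a := by
    intro a
    rw [← EReal.coe_le_coe_iff (x := maxFun _ _), ← (h.rescale b hr hl).sphereMax_eq ht,
      sphereMax_le_iff ht.1]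
    simp only [ereal_affine_le_iff hl]
    have h1 : l * maxFun u (r * t) + b ≤ a ↔ maxFun u (r * t) ≤ l⁻¹ * (a - b) := by
      rw [le_inv_mul_iff₀ hl]; constructor <;> intro h <;> linarith
    rw [h1, ← EReal.coe_le_coe_iff, ← h.sphereMax_eq hrt, sphereMax_le_iff hrt.1]
    refine ⟨fun h2 x hx => h2 _ ?_, fun h2 x hx => ?_⟩
    · rw [norm_smul, Real.norm_of_nonneg hr.le, hx]
    · have h3 := h2 (r⁻¹ • x) (by
        rw [norm_smul, Real.norm_of_nonneg (inv_nonneg.2 hr.le), hx, inv_mul_cancel_left₀ hr.ne'])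
      rwa [smul_smul, mul_inv_cancel₀ hr.ne', one_smul] at h3
  exact le_antisymm ((key _).1 le_rfl) ((key _).2 le_rfl)

end rescale

end IsLocalSubharmonic

/-! ### Ball averages -/

section ballAvg

variable {n : ℕ} {f g : EuclideanSpace ℝ (Fin n) → ENNReal}

lemma measurable_ballAvg (hf : Measurable f) (s : ℝ) : Measurable (ballAvg f s) := by
  refine Measurable.const_mul ?_ _
  exact Measurable.lintegral_prod_right' (f := fun p : EuclideanSpace ℝ (Fin n) ×
    EuclideanSpace ℝ (Fin n) => f (p.1 + s • p.2)) (by fun_prop)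

/-- The volume of the ball of radius `s`, inverted. -/
noncomputable def ballWeight (n : ℕ) (s : ℝ) : ENNReal :=
  (volume (Metric.ball (0 : EuclideanSpace ℝ (Fin n)) 1))⁻¹ * ENNReal.ofReal (|(s ^ n)⁻¹|)

lemma ballWeight_ne_top (n : ℕ) (s : ℝ) : ballWeight n s ≠ ⊤ :=
  ENNReal.mul_ne_top (ENNReal.inv_ne_top.2 (volume_unitBall_ne_zero n)) ENNReal.ofReal_ne_top

lemma ballAvg_eq_setLIntegral {s : ℝ} (hs : 0 < s) (hf : Measurable f)
    (x : EuclideanSpace ℝ (Fin n)) :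
    ballAvg f s x = ballWeight n s * ∫⁻ z in Metric.ball x s, f z := by
  have h1 : ∀ y : EuclideanSpace ℝ (Fin n),
      (Metric.ball (0 : EuclideanSpace ℝ (Fin n)) 1).indicator (fun y => f (x + s • y)) y =
        (Metric.ball x s).indicator f (x + s • y) := fun y => by
    have h2 : x + s • y ∈ Metric.ball x s ↔ y ∈ Metric.ball (0 : EuclideanSpace ℝ (Fin n)) 1 := by
      rw [mem_ball_iff_norm, add_sub_cancel_left, norm_smul, Real.norm_of_nonneg hs.le,
        mem_ball_zero_iff]
      exact ⟨fun h => by nlinarith, fun h => by nlinarith⟩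
    by_cases hy : y ∈ Metric.ball (0 : EuclideanSpace ℝ (Fin n)) 1
    · rw [indicator_of_mem hy, indicator_of_mem (h2.2 hy)]
    · rw [indicator_of_notMem hy, indicator_of_notMem fun h => hy (h2.1 h)]
  rw [ballAvg, ballWeight, mul_assoc, ← lintegral_indicator measurableSet_ball,
    ← lintegral_indicator measurableSet_ball]
  congr 1
  have hm : Measurable ((Metric.ball x s).indicator f) := hf.indicator measurableSet_ball
  calc ∫⁻ y, (Metric.ball (0 : EuclideanSpace ℝ (Fin n)) 1).indicator (fun y => f (x + s • y)) y
      = ∫⁻ y, (Metric.ball x s).indicator f (x + s • y) := lintegral_congr h1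
    _ = ∫⁻ z, (Metric.ball x s).indicator f (x + z) ∂(Measure.map (s • ·) volume) :=
        (lintegral_map (f := fun z => (Metric.ball x s).indicator f (x + z))
          (hm.comp (measurable_const_add x)) (measurable_const_smul s)).symm
    _ = _ := by
        rw [Measure.map_addHaar_smul _ hs.ne', lintegral_smul_measure, smul_eq_mul,
          lintegral_add_left_eq_self, finrank_euclideanSpace_fin]

lemma ballAvg_mono {s : ℝ} {x : EuclideanSpace ℝ (Fin n)} (hs : 0 < s)
    (h : ∀ y ∈ Metric.ball x s, f y ≤ g y) : ballAvg f s x ≤ ballAvg g s x := by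
  refine mul_le_mul_right (setLIntegral_mono' measurableSet_ball fun y hy => h _ ?_) _
  rw [mem_ball_iff_norm, add_sub_cancel_left, norm_smul, Real.norm_of_nonneg hs.le]
  nlinarith [mem_ball_zero_iff.1 hy]

lemma ballAvg_const (a : ENNReal) (s : ℝ) (x : EuclideanSpace ℝ (Fin n)) :
    ballAvg (fun _ => a) s x = a := by
  rw [ballAvg, ← lintegral_ballProb]; simp

/-- For a fixed point, the indicator of an open ball of radius `s` is lower semicontinuous in the
centre; Fatou's lemma does the rest. -/
lemma lowerSemicontinuous_ballAvg {s : ℝ} (hs : 0 < s) (hf : Measurable f) :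
    LowerSemicontinuous (ballAvg f s) := by
  set G : EuclideanSpace ℝ (Fin n) → EuclideanSpace ℝ (Fin n) → ENNReal := fun y z =>
    ballWeight n s * (Metric.ball y s).indicator f z with hG
  have h1 : ballAvg f s = fun y => ∫⁻ z, G y z := funext fun y => by
    rw [ballAvg_eq_setLIntegral hs hf, hG, lintegral_const_mul' _ _ (ballWeight_ne_top n s),
      lintegral_indicator measurableSet_ball]
  have hGm : ∀ y, Measurable (G y) := fun y => (hf.indicator measurableSet_ball).const_mul _
  have hGl : ∀ x z, G x z ≤ liminf (fun y => G y z) (𝓝 x) := by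
    intro x z
    by_cases hz : z ∈ Metric.ball x s
    · refine le_liminf_of_le (by isBoundedDefault) ?_
      have : ∀ᶠ y in 𝓝 x, dist z y < s :=
        (continuous_const.dist continuous_id).continuousAt.eventually (gt_mem_nhds hz)
      filter_upwards [this] with y hy
      simp only [hG]
      rw [indicator_of_mem hz, indicator_of_mem (Metric.mem_ball.2 hy)]
    · have : G x z = 0 := by simp only [hG]; rw [indicator_of_notMem hz, mul_zero]
      rw [this]
      exact zero_le
  rw [h1]
  refine lowerSemicontinuous_iff_le_liminf.2 fun x => ?_
  calc ∫⁻ z, G x z ≤ ∫⁻ z, liminf (fun y => G y z) (𝓝 x) := lintegral_mono (hGl x)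
    _ ≤ liminf (fun y => ∫⁻ z, G y z) (𝓝 x) := lintegral_liminf_le hGm

/-- At a fixed radius, an `L¹` error on the large ball becomes an error of the averages that is
uniform in the centre. -/
lemma ballAvg_le_add {d : EuclideanSpace ℝ (Fin n) → ENNReal} {R s : ℝ}
    {x : EuclideanSpace ℝ (Fin n)} (hs : 0 < s) (hxs : ‖x‖ + s ≤ R)
    (hg : Measurable g) (hd : Measurable d)
    (h : ∀ y ∈ Metric.ball (0 : EuclideanSpace ℝ (Fin n)) R, f y ≤ g y + d y) :
    ballAvg f s x ≤ ballAvg g s x +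
      ballWeight n s * ∫⁻ z in Metric.ball (0 : EuclideanSpace ℝ (Fin n)) R, d z := by
  have hsub : Metric.ball x s ⊆ Metric.ball (0 : EuclideanSpace ℝ (Fin n)) R :=
    Metric.ball_subset_ball' (by rw [dist_zero_right]; linarith)
  refine (ballAvg_mono (g := fun y => g y + d y) hs fun y hy => h y (hsub hy)).trans ?_
  rw [ballAvg_eq_setLIntegral (f := fun y => g y + d y) hs (hg.add hd), lintegral_add_left hg,
    mul_add,
    ← ballAvg_eq_setLIntegral hs hg]
  gcongr

end ballAvg

/-- The mean value inequality on spheres of radius `s|y|` is integrated over the unit ball. -/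
theorem IsLocalSubharmonic.ballAvg_le {n : ℕ} {F : Set (Matrix (Fin n) (Fin n) ℝ)}
    {u : EuclideanSpace ℝ (Fin n) → EReal} {R c : ℝ} (h : IsLocalSubharmonic F u R c)
    {s : ℝ} (hs : 0 < s) {x : EuclideanSpace ℝ (Fin n)} (hxs : ‖x‖ + s < R) :
    ballAvg (coOn (Metric.ball 0 R) c u) s x ≤ coOn (Metric.ball 0 R) c u x := by
  have := h.neZero
  obtain ⟨Ω, mΩ, ν, g, hav, -⟩ := h.cone.exists_isRotationAverage h.st
  rw [hav.ballAvg_eq h.lowerSemicontinuous.measurable, ← lintegral_ballProb]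
  calc _ ≤ ∫⁻ _, coOn (Metric.ball 0 R) c u x ∂(ballProb n) := by
        refine lintegral_mono_ae ?_
        filter_upwards [ae_ballProb n] with y hy
        have ht : 0 < s * ‖y‖ := mul_pos hs hy.1
        have hmat : ∀ z : EuclideanSpace ℝ (Fin n),
            matCLM ((s * ‖y‖) • 1) z + x = x + (s * ‖y‖) • z := fun z => by
          rw [matCLM_smul_apply, matCLM_one_apply, add_comm]
        have hball : ∀ z : EuclideanSpace ℝ (Fin n), ‖z‖ ≤ 1 →
            x + (s * ‖y‖) • z ∈ Metric.ball (0 : EuclideanSpace ℝ (Fin n)) R := fun z hz => by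
          rw [mem_ball_zero_iff]
          refine (norm_add_le _ _).trans_lt ?_
          rw [norm_smul, Real.norm_of_nonneg ht.le]
          nlinarith [hy.2]
        have h1 := h.sub.lintegral_ellipsoid_le (M := (s * ‖y‖) • 1) (N := (s * ‖y‖)⁻¹ • 1)
          (b := x) (c := c)
          (by rw [Matrix.smul_mul, Matrix.one_mul, smul_smul, mul_inv_cancel₀ ht.ne', one_smul])
          (fun H hH => by
            have := h.cone.trace_nonneg h.st h.conv hH
            simp only [Matrix.transpose_smul, Matrix.transpose_one, Matrix.smul_mul,
              Matrix.one_mul, Matrix.mul_smul, Matrix.mul_one, Matrix.trace_smul, smul_eq_mul]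
            positivity)
          (fun z hz => by
            rw [hmat]
            exact ⟨hball z (mem_closedBall_zero_iff.1 hz), h.le _ (hball z
              (mem_closedBall_zero_iff.1 hz))⟩)
        simp only [hmat] at h1
        rw [coOn_of_mem (mem_ball_zero_iff.2 (by linarith : ‖x‖ < R))]
        refine le_trans (le_of_eq (lintegral_congr fun σ => ?_)) h1
        exact coOn_of_mem (hball σ (norm_eq_of_mem_sphere σ).le)
    _ = _ := by simp

/-! ### Limits of functions satisfying the mean value inequality -/

/-- The functions `v j` satisfy the mean value inequality and converge to `w` in `L¹` of the ball
of radius `R`; the errors are controlled by the functions `d j`. -/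
structure IsSubmeanLimit {n : ℕ} (R : ℝ) (v : ℕ → EuclideanSpace ℝ (Fin n) → ENNReal)
    (w : EuclideanSpace ℝ (Fin n) → ENNReal) (d : ℕ → EuclideanSpace ℝ (Fin n) → ENNReal) :
    Prop where
  measurable : ∀ j, Measurable (v j)
  measurable_lim : Measurable w
  measurable_error : ∀ j, Measurable (d j)
  le_lim : ∀ j, ∀ x ∈ Metric.ball (0 : EuclideanSpace ℝ (Fin n)) R, v j x ≤ w x + d j x
  lim_le : ∀ j, ∀ x ∈ Metric.ball (0 : EuclideanSpace ℝ (Fin n)) R, w x ≤ v j x + d j x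
  tendsto_error : Tendsto (fun j => ∫⁻ x in Metric.ball (0 : EuclideanSpace ℝ (Fin n)) R, d j x)
    atTop (𝓝 0)
  ballAvg_le : ∀ j, ∀ s : ℝ, 0 < s → ∀ x, ‖x‖ + s < R → ballAvg (v j) s x ≤ v j x

namespace IsSubmeanLimit

variable {n : ℕ} {R : ℝ} {v : ℕ → EuclideanSpace ℝ (Fin n) → ENNReal}
  {w wt : EuclideanSpace ℝ (Fin n) → ENNReal} {d : ℕ → EuclideanSpace ℝ (Fin n) → ENNReal}

/-- The uniform error of the ball averages. -/
noncomputable def error (R : ℝ) (d : ℕ → EuclideanSpace ℝ (Fin n) → ENNReal) (s : ℝ) (j : ℕ) :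
    ENNReal :=
  ballWeight n s * ∫⁻ x in Metric.ball (0 : EuclideanSpace ℝ (Fin n)) R, d j x

lemma tendsto_uniform_error (h : IsSubmeanLimit R v w d) (s : ℝ) :
    Tendsto (error R d s) atTop (𝓝 0) := by
  have := ENNReal.Tendsto.const_mul h.tendsto_error (Or.inr (ballWeight_ne_top n s))
  rwa [mul_zero] at this

lemma ballAvg_lim_le (h : IsSubmeanLimit R v w d) {s : ℝ} (hs : 0 < s)
    {x : EuclideanSpace ℝ (Fin n)} (hx : ‖x‖ + s < R) (j : ℕ) :
    ballAvg w s x ≤ v j x + error R d s j :=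
  (ballAvg_le_add hs hx.le (h.measurable j) (h.measurable_error j) (h.lim_le j)).trans
    (add_le_add (h.ballAvg_le j s hs x hx) le_rfl)

lemma ballAvg_le_lim (h : IsSubmeanLimit R v w d) {s : ℝ} (hs : 0 < s)
    {x : EuclideanSpace ℝ (Fin n)} (hx : ‖x‖ + s < R) (j : ℕ) :
    ballAvg (v j) s x ≤ ballAvg w s x + error R d s j :=
  ballAvg_le_add hs hx.le h.measurable_lim (h.measurable_error j) (h.le_lim j)

/-- Convergence is only in `L¹`, so the inequality is first integrated over an arbitrary measurable
set, where the limit can be taken, and then read off almost everywhere. -/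
lemma ballAvg_lim_le_lim (h : IsSubmeanLimit R v w d) {s : ℝ} (hs : 0 < s) :
    ∀ᵐ x ∂(volume.restrict (Metric.ball (0 : EuclideanSpace ℝ (Fin n)) (R - s))),
      ballAvg w s x ≤ w x := by
  refine ae_le_of_forall_setLIntegral_le_of_sigmaFinite (measurable_ballAvg h.measurable_lim s)
    fun A hA _ => ?_
  rw [Measure.restrict_restrict hA]
  set B := A ∩ Metric.ball (0 : EuclideanSpace ℝ (Fin n)) (R - s) with hB
  have hBm : MeasurableSet B := hA.inter measurableSet_ball
  have hBsub : B ⊆ Metric.ball (0 : EuclideanSpace ℝ (Fin n)) R :=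
    inter_subset_right.trans (Metric.ball_subset_ball (by linarith))
  have hBfin : volume B ≠ ⊤ :=
    ((measure_mono hBsub).trans_lt measure_ball_lt_top).ne
  have key : ∀ j, ∫⁻ x in B, ballAvg w s x ≤ (∫⁻ x in B, w x) +
      ((∫⁻ x in Metric.ball (0 : EuclideanSpace ℝ (Fin n)) R, d j x) +
        error R d s j * volume B) := by
    intro j
    calc ∫⁻ x in B, ballAvg w s x
        ≤ ∫⁻ x in B, (w x + d j x + error R d s j) := by
          refine setLIntegral_mono' hBm fun x hx => ?_
          have hx2 : ‖x‖ + s < R := by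
            have := mem_ball_zero_iff.1 hx.2
            linarith
          exact (h.ballAvg_lim_le hs hx2 j).trans (add_le_add (h.le_lim j x (hBsub hx)) le_rfl)
      _ = (∫⁻ x in B, w x) + (∫⁻ x in B, d j x) + error R d s j * volume B := by
          rw [lintegral_add_right _ measurable_const, lintegral_add_left h.measurable_lim,
            setLIntegral_const]
      _ ≤ _ := by
          rw [add_assoc]
          gcongr
  have hlim : Tendsto (fun j => (∫⁻ x in B, w x) +
      ((∫⁻ x in Metric.ball (0 : EuclideanSpace ℝ (Fin n)) R, d j x) +
        error R d s j * volume B)) atTop (𝓝 ((∫⁻ x in B, w x) + (0 + 0 * volume B))) :=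
    tendsto_const_nhds.add (h.tendsto_error.add
      (ENNReal.Tendsto.mul_const (h.tendsto_uniform_error s) (Or.inr hBfin)))
  rw [zero_mul, add_zero, add_zero] at hlim
  exact ge_of_tendsto' hlim key

/-- `wt` is the lower semicontinuous representative of `w`. -/
def IsEssLim (w wt : EuclideanSpace ℝ (Fin n) → ENNReal) : Prop :=
  ∀ x, Tendsto (fun s : ℝ => essInf w (volume.restrict (Metric.closedBall x s)))
    (𝓝[>] (0 : ℝ)) (𝓝 (wt x))

/-- Lower semicontinuity of the ball average in its centre upgrades the almost everywhere inequality
to the representative `wt` at every point. -/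
lemma ballAvg_le_essLim (h : IsSubmeanLimit R v w d) (hw : IsEssLim w wt) {s : ℝ} (hs : 0 < s)
    {x : EuclideanSpace ℝ (Fin n)} (hx : ‖x‖ + s < R) : ballAvg w s x ≤ wt x := by
  refine le_of_forall_lt fun a ha => ?_
  obtain ⟨b, hab, hb⟩ := exists_between ha
  refine hab.trans_le (ge_of_tendsto (hw x) ?_)
  have hxb : x ∈ Metric.ball (0 : EuclideanSpace ℝ (Fin n)) (R - s) :=
    mem_ball_zero_iff.2 (by linarith)
  obtain ⟨δ, hδ, hball⟩ := Metric.nhds_basis_closedBall.eventually_iff.1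
    ((lowerSemicontinuous_ballAvg hs h.measurable_lim x b hb).and
      (Metric.isOpen_ball.mem_nhds hxb))
  filter_upwards [Ioo_mem_nhdsGT hδ] with t ht
  refine le_essInf_of_ae_le b ?_
  have hsub : Metric.closedBall x t ⊆ Metric.closedBall x δ :=
    Metric.closedBall_subset_closedBall ht.2.le
  have h1 := ae_restrict_of_ae_restrict_of_subset (s := Metric.closedBall x t)
    (fun y hy => (hball (hsub hy)).2) (h.ballAvg_lim_le_lim hs)
  filter_upwards [h1, ae_restrict_mem measurableSet_closedBall] with y hy hyt
  exact (hball (hsub hyt)).1.le.trans hy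

lemma essInf_le_ballAvg (h : IsSubmeanLimit R v w d) {s : ℝ} (hs : 0 < s)
    (x : EuclideanSpace ℝ (Fin n)) :
    essInf w (volume.restrict (Metric.closedBall x s)) ≤ ballAvg w s x := by
  conv_lhs => rw [← ballAvg_const (essInf w (volume.restrict (Metric.closedBall x s))) s x]
  rw [ballAvg_eq_setLIntegral hs measurable_const, ballAvg_eq_setLIntegral hs h.measurable_lim]
  refine mul_le_mul_right (lintegral_mono_ae ?_) _
  exact ae_restrict_of_ae_restrict_of_subset Metric.ball_subset_closedBall ae_essInf_le

lemma eventually_norm_add_lt {x : EuclideanSpace ℝ (Fin n)} (hx : ‖x‖ < R) :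
    ∀ᶠ s in 𝓝[>] (0 : ℝ), 0 < s ∧ ‖x‖ + s < R := by
  filter_upwards [Ioo_mem_nhdsGT (sub_pos.2 hx)] with s hs
  exact ⟨hs.1, by linarith [hs.2]⟩

/-- The averages are squeezed between the essential infimum over the shrinking ball and its limit
`wt x`. -/
lemma tendsto_ballAvg (h : IsSubmeanLimit R v w d) (hw : IsEssLim w wt)
    {x : EuclideanSpace ℝ (Fin n)} (hx : ‖x‖ < R) :
    Tendsto (fun s => ballAvg w s x) (𝓝[>] (0 : ℝ)) (𝓝 (wt x)) := by
  refine tendsto_of_tendsto_of_tendsto_of_le_of_le' (hw x) tendsto_const_nhds ?_ ?_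
  · filter_upwards [self_mem_nhdsWithin] with s hs using h.essInf_le_ballAvg hs x
  · filter_upwards [eventually_norm_add_lt hx] with s hs
    exact h.ballAvg_le_essLim hw hs.1 hs.2

lemma exists_seq_nhdsGT : ∃ t : ℕ → ℝ, Tendsto t atTop (𝓝[>] (0 : ℝ)) :=
  exists_seq_tendsto _

lemma measurable_indicator_essLim (h : IsSubmeanLimit R v w d) (hw : IsEssLim w wt) :
    Measurable ((Metric.ball (0 : EuclideanSpace ℝ (Fin n)) R).indicator wt) := by
  obtain ⟨t, ht⟩ := exists_seq_nhdsGT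
  refine measurable_of_tendsto_metrizable (f := fun k =>
    (Metric.ball (0 : EuclideanSpace ℝ (Fin n)) R).indicator (ballAvg w (t k)))
    (fun k => (measurable_ballAvg h.measurable_lim _).indicator measurableSet_ball)
    (tendsto_pi_nhds.2 fun x => ?_)
  by_cases hx : x ∈ Metric.ball (0 : EuclideanSpace ℝ (Fin n)) R
  · simp only [indicator_of_mem hx]
    exact (h.tendsto_ballAvg hw (mem_ball_zero_iff.1 hx)).comp ht
  · simp only [indicator_of_notMem hx]
    exact tendsto_const_nhds

/-- For the upper bound, ball averages of the limit lie below the `v j` up to a uniform error, and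
Fatou's lemma applies as the averaging radius shrinks to zero. For the lower bound, the mean of `v
j` at the larger radius `ρ + s` is at most its means at all points within `s` of the sphere of
radius `ρ`. Commuting spherical means with ball averages bounds this by the mean of `wt` plus an
error, and continuity of `σ` removes `s`. -/
theorem sphMean_essLim [NeZero n] (h : IsSubmeanLimit R v w d) (hw : IsEssLim w wt)
    {Ω : Type*} [MeasurableSpace Ω] {ν : Measure Ω}
    {T : Ω → EuclideanSpace ℝ (Fin n) ≃ₗᵢ[ℝ] EuclideanSpace ℝ (Fin n)}
    (hT : IsRotationAverage ν T)
    (hanti : ∀ j r, r ∈ Ioo 0 R → ∀ y : EuclideanSpace ℝ (Fin n), ‖y‖ ≤ r →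
      sphMean (v j) r ≤ sphMean (v j) ‖y‖)
    {σ : ℝ → ENNReal} (hσ : ∀ r ∈ Ioo 0 R, Tendsto (fun j => sphMean (v j) r) atTop (𝓝 (σ r)))
    {ρ : ℝ} (hρ : ρ ∈ Ioo 0 R) (hσc : ContinuousAt σ ρ) : sphMean wt ρ = σ ρ := by
  obtain ⟨x, hx⟩ := exists_norm_eq_of_neZero (n := n) hρ.1.le
  have hxR : ‖x‖ < R := hx.trans_lt hρ.2
  have hnorm : ∀ σ : Metric.sphere (0 : EuclideanSpace ℝ (Fin n)) 1,
      ‖ρ • (σ : EuclideanSpace ℝ (Fin n))‖ = ρ := fun σ => by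
    rw [norm_smul, norm_eq_of_mem_sphere, mul_one, Real.norm_of_nonneg hρ.1.le]
  have hev : ∀ᶠ s in 𝓝[>] (0 : ℝ), 0 < s ∧ ρ + s < R := by
    have := eventually_norm_add_lt hxR
    rwa [hx] at this
  refine le_antisymm ?_ ?_
  · have hup : ∀ s, 0 < s → ρ + s < R → sphMean (ballAvg w s) ρ ≤ σ ρ := by
      intro s hs hsR
      have hlim : Tendsto (fun j => sphMean (v j) ρ + error R d s j) atTop (𝓝 (σ ρ + 0)) :=
        (hσ ρ hρ).add (h.tendsto_uniform_error s)
      rw [add_zero] at hlim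
      refine ge_of_tendsto' hlim fun j => ?_
      calc sphMean (ballAvg w s) ρ ≤ sphMean (fun y => v j y + error R d s j) ρ :=
            sphMean_mono fun y hy => h.ballAvg_lim_le hs (by
              rw [hy, abs_of_pos hρ.1]; exact hsR) j
        _ = sphMean (v j) ρ + error R d s j := by
            rw [sphMean, lintegral_add_right _ measurable_const, lintegral_const, measure_univ,
              mul_one, sphMean]
    calc sphMean wt ρ = ∫⁻ τ, liminf (fun s => ballAvg w s (ρ • (τ : EuclideanSpace ℝ (Fin n))))
          (𝓝[>] (0 : ℝ)) ∂(sphereProb n) := lintegral_congr fun τ =>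
            ((h.tendsto_ballAvg hw ((hnorm τ).trans_lt hρ.2)).liminf_eq).symm
      _ ≤ liminf (fun s => sphMean (ballAvg w s) ρ) (𝓝[>] (0 : ℝ)) :=
          lintegral_liminf_le fun s => (measurable_ballAvg h.measurable_lim s).comp
            (measurable_subtype_coe.const_smul ρ)
      _ ≤ σ ρ := liminf_le_of_le (by isBoundedDefault) fun b hb => by
          obtain ⟨s, hs1, hs2⟩ := (hb.and hev).exists
          exact hs1.trans (hup s hs2.1 hs2.2)
  · have hlow : ∀ s, 0 < s → ρ + s < R → σ (ρ + s) ≤ sphMean wt ρ := by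
      intro s hs hsR
      have hrs : ρ + s ∈ Ioo 0 R := ⟨by linarith [hρ.1], hsR⟩
      have hlim : Tendsto (fun j => sphMean wt ρ + error R d s j) atTop (𝓝 (sphMean wt ρ + 0)) :=
        tendsto_const_nhds.add (h.tendsto_uniform_error s)
      rw [add_zero] at hlim
      refine le_of_tendsto_of_tendsto' (hσ _ hrs) hlim fun j => ?_
      calc sphMean (v j) (ρ + s) = ballAvg (fun _ => sphMean (v j) (ρ + s)) s x :=
            (ballAvg_const _ _ _).symm
        _ ≤ ballAvg (fun y => sphMean (v j) ‖y‖) s x := ballAvg_mono hs fun y hy =>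
            hanti j _ hrs y (by
              have h1 := mem_ball_iff_norm.1 hy
              have h2 := norm_le_norm_add_norm_sub' y x
              linarith)
        _ = sphMean (ballAvg (v j) s) ρ := by rw [← hT.sphMean_ballAvg (h.measurable j), hx]
        _ ≤ sphMean (fun y => wt y + error R d s j) ρ := sphMean_mono fun y hy => by
            rw [abs_of_pos hρ.1] at hy
            have hy' : ‖y‖ + s < R := by rw [hy]; exact hsR
            exact (h.ballAvg_le_lim hs hy' j).trans
              (add_le_add (h.ballAvg_le_essLim hw hs hy') le_rfl)
        _ = sphMean wt ρ + error R d s j := by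
            rw [sphMean, lintegral_add_right _ measurable_const, lintegral_const, measure_univ,
              mul_one, sphMean]
    have hcont : Tendsto (fun s => σ (ρ + s)) (𝓝[>] (0 : ℝ)) (𝓝 (σ ρ)) := by
      have h1 : Tendsto (fun s : ℝ => ρ + s) (𝓝[>] (0 : ℝ)) (𝓝 ρ) := by
        have : Tendsto (fun s : ℝ => ρ + s) (𝓝 0) (𝓝 (ρ + 0)) := tendsto_const_nhds.add tendsto_id
        rw [add_zero] at this
        exact this.mono_left nhdsWithin_le_nhds
      exact hσc.tendsto.comp h1
    refine le_of_tendsto hcont ?_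
    filter_upwards [hev] with s hs using hlow s hs.1 hs.2

/-- A lower bound for `v j` on a slightly larger ball passes to its ball averages, then to the
limit; continuity of `μ` removes the enlargement. -/
theorem le_essLim (h : IsSubmeanLimit R v w d) (hw : IsEssLim w wt) {m : ℕ → ℝ → ENNReal}
    (hm : ∀ j, ∀ r ∈ Ioo 0 R, ∀ y : EuclideanSpace ℝ (Fin n), ‖y‖ ≤ r → m j r ≤ v j y)
    {μ : ℝ → ENNReal} (hμ : ∀ r ∈ Ioo 0 R, Tendsto (fun j => m j r) atTop (𝓝 (μ r)))
    {ρ : ℝ} (hρ : ρ ∈ Ioo 0 R) (hμc : ContinuousAt μ ρ) {x : EuclideanSpace ℝ (Fin n)}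
    (hx : ‖x‖ ≤ ρ) : μ ρ ≤ wt x := by
  have hev : ∀ᶠ s in 𝓝[>] (0 : ℝ), 0 < s ∧ ρ + s < R := by
    filter_upwards [Ioo_mem_nhdsGT (sub_pos.2 hρ.2)] with s hs
    exact ⟨hs.1, by linarith [hs.2]⟩
  have hlow : ∀ s, 0 < s → ρ + s < R → μ (ρ + s) ≤ wt x := by
    intro s hs hsR
    have hrs : ρ + s ∈ Ioo 0 R := ⟨by linarith [hρ.1], hsR⟩
    have hxs : ‖x‖ + s < R := by linarith
    have hlim : Tendsto (fun j => wt x + error R d s j) atTop (𝓝 (wt x + 0)) :=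
      tendsto_const_nhds.add (h.tendsto_uniform_error s)
    rw [add_zero] at hlim
    refine le_of_tendsto_of_tendsto' (hμ _ hrs) hlim fun j => ?_
    calc m j (ρ + s) = ballAvg (fun _ => m j (ρ + s)) s x := (ballAvg_const _ _ _).symm
      _ ≤ ballAvg (v j) s x := ballAvg_mono hs fun y hy => hm j _ hrs y (by
          have h1 := mem_ball_iff_norm.1 hy
          have h2 := norm_le_norm_add_norm_sub' y x
          linarith)
      _ ≤ wt x + error R d s j := (h.ballAvg_le_lim hs hxs j).trans
          (add_le_add (h.ballAvg_le_essLim hw hs hxs) le_rfl)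
  have hcont : Tendsto (fun s => μ (ρ + s)) (𝓝[>] (0 : ℝ)) (𝓝 (μ ρ)) := by
    have h1 : Tendsto (fun s : ℝ => ρ + s) (𝓝[>] (0 : ℝ)) (𝓝 ρ) := by
      have : Tendsto (fun s : ℝ => ρ + s) (𝓝 0) (𝓝 (ρ + 0)) := tendsto_const_nhds.add tendsto_id
      rw [add_zero] at this
      exact this.mono_left nhdsWithin_le_nhds
    exact hμc.tendsto.comp h1
  refine le_of_tendsto hcont ?_
  filter_upwards [hev] with s hs using hlow s hs.1 hs.2

/-- Points where `v j` is small accumulate on the compact sphere. Lower semicontinuity of the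
averages at fixed radius transfers the bound to the accumulation point, after which the radius
shrinks. -/
theorem exists_essLim_le (h : IsSubmeanLimit R v w d) (hw : IsEssLim w wt) {ρ : ℝ}
    (hρ : ρ ∈ Ioo 0 R) {m : ℕ → ENNReal}
    (hm : ∀ j, ∃ y : EuclideanSpace ℝ (Fin n), ‖y‖ = ρ ∧ v j y ≤ m j)
    {μ : ENNReal} (hμ : Tendsto m atTop (𝓝 μ)) :
    ∃ x : EuclideanSpace ℝ (Fin n), ‖x‖ = ρ ∧ wt x ≤ μ := by
  choose y hy hym using hm
  obtain ⟨x, hx, k, hk, hlim⟩ := (isCompact_sphere (0 : EuclideanSpace ℝ (Fin n)) ρ).tendsto_subseq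
    fun j => mem_sphere_zero_iff_norm.2 (hy j)
  rw [mem_sphere_zero_iff_norm] at hx
  refine ⟨x, hx, le_of_tendsto (h.tendsto_ballAvg hw (hx.trans_lt hρ.2)) ?_⟩
  filter_upwards [eventually_norm_add_lt (hx.trans_lt hρ.2)] with s hs
  have h1 : Tendsto (fun i => m (k i) + error R d s (k i)) atTop (𝓝 (μ + 0)) :=
    (hμ.comp hk.tendsto_atTop).add ((h.tendsto_uniform_error s).comp hk.tendsto_atTop)
  rw [add_zero] at h1
  refine le_of_forall_lt fun a ha => ?_
  obtain ⟨b, hab, hb⟩ := exists_between ha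
  refine hab.trans_le (ge_of_tendsto h1 ?_)
  filter_upwards [hlim.eventually
    (lowerSemicontinuous_ballAvg hs.1 h.measurable_lim x b hb)] with i hi
  refine hi.le.trans ((h.ballAvg_lim_le hs.1 ?_ (k i)).trans (add_le_add (hym _) le_rfl))
  simp only [Function.comp, hy]
  rw [← hx]; exact hs.2

end IsSubmeanLimit

/-! ### Blow-ups of functions with a density -/

namespace HasRealDensity

variable {p Θ : ℝ} {ψ : ℝ → ℝ}

lemma exists_abs_le (h : HasRealDensity p ψ Θ) {ε : ℝ} (hε : 0 < ε) :
    ∃ δ : ℝ, 0 < δ ∧ ∀ s ∈ Ioo 0 δ, ∀ r ∈ Ioo 0 δ,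
      |ψ r - ψ s - Θ * (rieszK p r - rieszK p s)| ≤ ε * |rieszK p r - rieszK p s| := by
  obtain ⟨δ, hδ, hd⟩ := h ε hε
  refine ⟨δ, hδ, fun s hs r hr => ?_⟩
  rcases lt_trichotomy s r with hsr | rfl | hrs
  · exact (hd s r hs.1 hsr hr.2).trans (mul_le_mul_of_nonneg_left (le_abs_self _) hε.le)
  · simp
  · have h1 := hd r s hr.1 hrs hs.2
    rw [← abs_neg, ← abs_neg (rieszK p r - rieszK p s)]
    refine le_trans (le_of_eq ?_) (h1.trans (mul_le_mul_of_nonneg_left ?_ hε.le))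
    · congr 1; ring
    · rw [neg_sub]; exact le_abs_self _

lemma eventually_mul_mem {ρ δ : ℝ} (hρ : 0 < ρ) (hδ : 0 < δ) :
    ∀ᶠ r in 𝓝[>] (0 : ℝ), 0 < r ∧ r * ρ ∈ Ioo 0 δ := by
  filter_upwards [Ioo_mem_nhdsGT (div_pos hδ hρ)] with r hr
  exact ⟨hr.1, mul_pos hr.1 hρ, (lt_div_iff₀ hρ).1 hr.2⟩

/-- The factor `r^(p-2)` cancels the scaling `r^(2-p)` of increments of `K`, so the density estimate
becomes independent of scale. -/
lemma tendsto_sub (h : HasRealDensity p ψ Θ) {ρ τ : ℝ} (hρ : 0 < ρ) (hτ : 0 < τ) :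
    Tendsto (fun r => r ^ (p - 2) * (ψ (r * ρ) - ψ (r * τ))) (𝓝[>] (0 : ℝ))
      (𝓝 (Θ * (rieszK p ρ - rieszK p τ))) := by
  refine Metric.tendsto_nhds.2 fun ε hε => ?_
  set k := rieszK p ρ - rieszK p τ with hk
  obtain ⟨δ, hδ, hd⟩ := h.exists_abs_le (ε := ε / (|k| + 1)) (by positivity)
  filter_upwards [eventually_mul_mem hρ hδ, eventually_mul_mem hτ hδ] with r hr1 hr2
  have hr := hr1.1
  have h1 := hd _ hr2.2 _ hr1.2
  have h2 : rieszK p (r * ρ) - rieszK p (r * τ) = r ^ (2 - p) * k := by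
    rw [mul_comm r, mul_comm r, rieszK_mul_sub p hρ hτ hr]
  have h3 : r ^ (p - 2) * r ^ (2 - p) = 1 := by
    rw [← Real.rpow_add hr]; simp
  have hpos : 0 < r ^ (p - 2) := Real.rpow_pos_of_pos hr _
  have hpos2 : 0 < r ^ (2 - p) := Real.rpow_pos_of_pos hr _
  rw [h2] at h1
  rw [Real.dist_eq]
  have h4 : r ^ (p - 2) * (ψ (r * ρ) - ψ (r * τ)) - Θ * k =
      r ^ (p - 2) * (ψ (r * ρ) - ψ (r * τ) - Θ * (r ^ (2 - p) * k)) := by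
    linear_combination (-Θ * k) * (-h3)
  have h5 : |r ^ (2 - p) * k| = r ^ (2 - p) * |k| := by rw [abs_mul, abs_of_pos hpos2]
  rw [h4, abs_mul, abs_of_pos hpos]
  calc r ^ (p - 2) * |ψ (r * ρ) - ψ (r * τ) - Θ * (r ^ (2 - p) * k)|
      ≤ r ^ (p - 2) * (ε / (|k| + 1) * |r ^ (2 - p) * k|) := mul_le_mul_of_nonneg_left h1 hpos.le
    _ = ε / (|k| + 1) * |k| := by
        rw [h5]; linear_combination (ε / (|k| + 1) * |k|) * h3
    _ < ε := by
        rw [div_mul_eq_mul_div, div_lt_iff₀ (by positivity)]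
        nlinarith [abs_nonneg k]

/-- Here `K` vanishes at zero, so the inner radius in the density estimate can be sent to zero. -/
lemma tendsto_of_lt (h : HasRealDensity p ψ Θ) (hp : p < 2) {a : ℝ}
    (ha : Tendsto ψ (𝓝[>] (0 : ℝ)) (𝓝 a)) {ρ : ℝ} (hρ : 0 < ρ) :
    Tendsto (fun r => r ^ (p - 2) * (ψ (r * ρ) - a)) (𝓝[>] (0 : ℝ)) (𝓝 (Θ * rieszK p ρ)) := by
  have hK0 : Tendsto (rieszK p) (𝓝[>] (0 : ℝ)) (𝓝 0) := by
    rw [rieszK_of_lt hp]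
    have h1 : ContinuousAt (fun t : ℝ => t ^ (2 - p)) 0 :=
      Real.continuousAt_rpow_const 0 _ (Or.inr (by linarith))
    have h2 := h1.tendsto
    simp only [Real.zero_rpow (by linarith : 2 - p ≠ 0)] at h2
    exact h2.mono_left nhdsWithin_le_nhds
  refine Metric.tendsto_nhds.2 fun ε hε => ?_
  obtain ⟨δ, hδ, hd⟩ := h.exists_abs_le (ε := ε / (|rieszK p ρ| + 1)) (by positivity)
  filter_upwards [eventually_mul_mem hρ hδ] with r hr
  have h1 : |ψ (r * ρ) - a - Θ * (rieszK p (r * ρ) - 0)| ≤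
      ε / (|rieszK p ρ| + 1) * |rieszK p (r * ρ) - 0| := by
    refine le_of_tendsto_of_tendsto
      ((tendsto_const_nhds.sub ha).sub ((tendsto_const_nhds.sub hK0).const_mul Θ)).abs
      ((tendsto_const_nhds.sub hK0).abs.const_mul _) ?_
    filter_upwards [Ioo_mem_nhdsGT hδ] with s hs using hd s hs _ hr.2
  have h2 : rieszK p (r * ρ) = r ^ (2 - p) * rieszK p ρ := rieszK_mul hp.ne hr.1 hρ
  have h3 : r ^ (p - 2) * r ^ (2 - p) = 1 := by
    rw [← Real.rpow_add hr.1]; simp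
  have hpos : 0 < r ^ (p - 2) := Real.rpow_pos_of_pos hr.1 _
  have hpos2 : 0 < r ^ (2 - p) := Real.rpow_pos_of_pos hr.1 _
  rw [sub_zero, h2] at h1
  have h4 : r ^ (p - 2) * (ψ (r * ρ) - a) - Θ * rieszK p ρ =
      r ^ (p - 2) * (ψ (r * ρ) - a - Θ * (r ^ (2 - p) * rieszK p ρ)) := by
    linear_combination (-Θ * rieszK p ρ) * (-h3)
  have h5 : |r ^ (2 - p) * rieszK p ρ| = r ^ (2 - p) * |rieszK p ρ| := by
    rw [abs_mul, abs_of_pos hpos2]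
  rw [Real.dist_eq, h4, abs_mul, abs_of_pos hpos]
  calc _ ≤ r ^ (p - 2) * (ε / (|rieszK p ρ| + 1) * |r ^ (2 - p) * rieszK p ρ|) :=
        mul_le_mul_of_nonneg_left h1 hpos.le
    _ = ε / (|rieszK p ρ| + 1) * |rieszK p ρ| := by
        rw [h5]; linear_combination (ε / (|rieszK p ρ| + 1) * |rieszK p ρ|) * h3
    _ < ε := by
        rw [div_mul_eq_mul_div, div_lt_iff₀ (by positivity)]
        nlinarith [abs_nonneg (rieszK p ρ)]

/-- Here the inner radius cannot be sent to zero; the comparison radius is fixed at `δ / 2`, and its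
bounded contribution is killed by `r^(p-2) → 0`. -/
lemma tendsto_of_gt (h : HasRealDensity p ψ Θ) (hp : 2 < p) {ρ : ℝ} (hρ : 0 < ρ) :
    Tendsto (fun r => r ^ (p - 2) * ψ (r * ρ)) (𝓝[>] (0 : ℝ)) (𝓝 (Θ * rieszK p ρ)) := by
  have h0 : Tendsto (fun r : ℝ => r ^ (p - 2)) (𝓝[>] (0 : ℝ)) (𝓝 0) := by
    have h1 : ContinuousAt (fun t : ℝ => t ^ (p - 2)) 0 :=
      Real.continuousAt_rpow_const 0 _ (Or.inr (by linarith))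
    have h2 := h1.tendsto
    simp only [Real.zero_rpow (by linarith : p - 2 ≠ 0)] at h2
    exact h2.mono_left nhdsWithin_le_nhds
  refine Metric.tendsto_nhds.2 fun ε hε => ?_
  set k := rieszK p ρ with hk
  set η := ε / (2 * (|k| + 1)) with hη
  have hη0 : 0 < η := by positivity
  obtain ⟨δ, hδ, hd⟩ := h.exists_abs_le hη0
  have hs : δ / 2 ∈ Ioo 0 δ := ⟨by linarith, by linarith⟩
  set A := η * |rieszK p (δ / 2)| + |ψ (δ / 2) - Θ * rieszK p (δ / 2)| with hA
  have h1 : Tendsto (fun r : ℝ => r ^ (p - 2) * A) (𝓝[>] (0 : ℝ)) (𝓝 0) := by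
    simpa using h0.mul_const A
  filter_upwards [eventually_mul_mem hρ hδ, h1.eventually (gt_mem_nhds (half_pos hε))] with r hr hrA
  have h2 : rieszK p (r * ρ) = r ^ (2 - p) * k := rieszK_mul hp.ne' hr.1 hρ
  have h3 : r ^ (p - 2) * r ^ (2 - p) = 1 := by
    rw [← Real.rpow_add hr.1]; simp
  have hpos : 0 < r ^ (p - 2) := Real.rpow_pos_of_pos hr.1 _
  have hpos2 : 0 < r ^ (2 - p) := Real.rpow_pos_of_pos hr.1 _
  have h4 := hd _ hs _ hr.2
  have h5 : |ψ (r * ρ) - Θ * rieszK p (r * ρ)| ≤ η * |rieszK p (r * ρ)| + A := by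
    have e1 : ψ (r * ρ) - Θ * rieszK p (r * ρ) =
        (ψ (r * ρ) - ψ (δ / 2) - Θ * (rieszK p (r * ρ) - rieszK p (δ / 2))) +
          (ψ (δ / 2) - Θ * rieszK p (δ / 2)) := by ring
    have e2 := mul_le_mul_of_nonneg_left (abs_sub (rieszK p (r * ρ)) (rieszK p (δ / 2))) hη0.le
    rw [e1]
    refine (abs_add_le _ _).trans ?_
    rw [hA]; linarith
  rw [h2] at h5
  have h6 : r ^ (p - 2) * ψ (r * ρ) - Θ * k =
      r ^ (p - 2) * (ψ (r * ρ) - Θ * (r ^ (2 - p) * k)) := by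
    linear_combination (-Θ * k) * (-h3)
  have h7 : |r ^ (2 - p) * k| = r ^ (2 - p) * |k| := by rw [abs_mul, abs_of_pos hpos2]
  rw [Real.dist_eq, h6, abs_mul, abs_of_pos hpos]
  calc _ ≤ r ^ (p - 2) * (η * |r ^ (2 - p) * k| + A) := mul_le_mul_of_nonneg_left h5 hpos.le
    _ = η * |k| + r ^ (p - 2) * A := by
        rw [h7]; linear_combination (η * |k|) * h3
    _ < ε := by
        have : η * |k| ≤ ε / 2 := by
          rw [hη, div_mul_eq_mul_div, div_le_div_iff₀ (by positivity) two_pos]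
          nlinarith [abs_nonneg k]
        linarith

end HasRealDensity

/-! ### The value at the origin -/

namespace IsLocalSubharmonic

variable {n : ℕ} {F : Set (Matrix (Fin n) (Fin n) ℝ)} {u : EuclideanSpace ℝ (Fin n) → EReal}
  {R c : ℝ}

lemma eventually_maxFun_le (h : IsLocalSubharmonic F u R c) {a : ℝ} (ha : u 0 < a) :
    ∀ᶠ r in 𝓝[>] (0 : ℝ), maxFun u r ≤ a := by
  have h0 : (0 : EuclideanSpace ℝ (Fin n)) ∈ Metric.ball 0 R := Metric.mem_ball_self h.pos
  have h1 := h.sub.usc 0 h0 _ ha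
  rw [Metric.isOpen_ball.nhdsWithin_eq h0] at h1
  obtain ⟨δ, hδ, hball⟩ := Metric.eventually_nhds_iff_ball.1 h1
  filter_upwards [Ioo_mem_nhdsGT (lt_min hδ h.pos)] with r hr
  rw [← EReal.coe_le_coe_iff, ← h.sphereMax_eq ⟨hr.1, hr.2.trans_le (min_le_right _ _)⟩,
    sphereMax_le_iff hr.1]
  exact fun x hx => (hball x (mem_ball_zero_iff.2 (by
    rw [hx]; exact hr.2.trans_le (min_le_left _ _)))).le

/-- Harnack's inequality at the centre, where the constant is one, is the mean value inequality. -/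
lemma zero_le_meanFun (h : IsLocalSubharmonic F u R c) {r : ℝ} (hr : r ∈ Ioo 0 R) :
    u 0 ≤ (meanFun u R c r : EReal) := by
  have h1 := h.maxFun_mul_le hr (x := 0) (by simp)
  rwa [smul_zero, norm_zero, harnackφ_zero, one_mul, sub_sub_cancel] at h1

/-- For `p < 2` the kernel stays bounded near zero, so a function with finite density cannot fall to
`-∞`. Upper semicontinuity and the mean value inequality then squeeze maxima and means to `u 0`. -/
lemma exists_eq_zero_of_lt_two (h : IsLocalSubharmonic F u R c) (hp : rieszChar F < 2) :
    ∃ a : ℝ, u 0 = a ∧ Tendsto (maxFun u) (𝓝[>] (0 : ℝ)) (𝓝 a) ∧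
      Tendsto (meanFun u R c) (𝓝[>] (0 : ℝ)) (𝓝 a) := by
  obtain ⟨Θ, hΘ, hd⟩ := h.isRieszConvex_maxFun.exists_hasRealDensity h.pos
  obtain ⟨δ, hδ, hd⟩ := hd 1 one_pos
  have hbot : u 0 ≠ ⊥ := by
    intro hb
    -- The density estimate with `ε = 1` keeps the maxima at small radii above `L`, whereas `u 0 =
    -- -∞` would push them below `L - 1`.
    set L := maxFun u (δ / 2) - (Θ + 1) * rieszK (rieszChar F) (δ / 2) with hL
    have h1 := h.eventually_maxFun_le (a := L - 1) (by rw [hb]; exact EReal.bot_lt_coe _)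
    obtain ⟨s, hs, hsδ⟩ := (h1.and (Ioo_mem_nhdsGT (half_pos hδ))).exists
    have h2 := hd s (δ / 2) hsδ.1 hsδ.2 (by linarith)
    have h3 := abs_le.1 h2
    have h4 : 0 < rieszK (rieszChar F) s := by
      rw [rieszK_of_lt hp]; exact Real.rpow_pos_of_pos hsδ.1 _
    have h5 : (Θ + 1) * rieszK (rieszChar F) s ≥ 0 := by positivity
    nlinarith [h3.2]
  have htop : u 0 ≠ ⊤ := h.sub.ne_top 0 (Metric.mem_ball_self h.pos)
  obtain ⟨a, ha⟩ : ∃ a : ℝ, u 0 = a := ⟨_, (EReal.coe_toReal htop hbot).symm⟩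
  have hlow : ∀ᶠ r in 𝓝[>] (0 : ℝ), a ≤ meanFun u R c r ∧ meanFun u R c r ≤ maxFun u r := by
    filter_upwards [Ioo_mem_nhdsGT h.pos] with r hr
    have := h.zero_le_meanFun hr
    rw [ha, EReal.coe_le_coe_iff] at this
    exact ⟨this, h.meanFun_le_maxFun hr⟩
  have hmax : Tendsto (maxFun u) (𝓝[>] (0 : ℝ)) (𝓝 a) := by
    refine tendsto_order.2 ⟨fun b hb => ?_, fun b hb => ?_⟩
    · filter_upwards [hlow] with r hr using hb.trans_le (hr.1.trans hr.2)
    · obtain ⟨b', h1, h2⟩ := exists_between hb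
      filter_upwards [h.eventually_maxFun_le (a := b') (by
        rw [ha]; exact EReal.coe_lt_coe_iff.2 h1)] with r hr using hr.trans_lt h2
  exact ⟨a, ha, hmax, tendsto_of_tendsto_of_tendsto_of_le_of_le' tendsto_const_nhds hmax
    (hlow.mono fun r hr => hr.1) (hlow.mono fun r hr => hr.2)⟩

end IsLocalSubharmonic

/-! ### Tangents -/

/-- Truncated reflection is 1-Lipschitz; the sum of the two truncated differences is the absolute
difference. No bound on `t` is assumed, because the limit function is not yet known to lie below
`c`. -/
lemma coFun_sub_add_sub_le {c t : ℝ} {a : EReal} (ha : a ≤ c) :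
    (coFun c a - coFun c t) + (coFun c t - coFun c a) ≤ (a - (t : EReal)).abs := by
  induction a with
  | bot =>
    rw [EReal.bot_sub, EReal.abs_bot]
    exact le_top
  | top => simp at ha
  | coe a =>
    have h1 := EReal.coe_le_coe_iff.1 ha
    rw [coFun_coe, coFun_coe, ← EReal.coe_sub, EReal.abs_def]
    rcases le_total a t with h | h
    · have h2 : ENNReal.ofReal (c - t) - ENNReal.ofReal (c - a) = 0 :=
        tsub_eq_zero_of_le (ENNReal.ofReal_le_ofReal (by linarith))
      rw [h2, add_zero, tsub_le_iff_right, abs_of_nonpos (by linarith)]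
      refine le_trans (ENNReal.ofReal_le_ofReal (le_of_eq ?_)) ENNReal.ofReal_add_le
      ring
    · have h2 : ENNReal.ofReal (c - a) - ENNReal.ofReal (c - t) = 0 :=
        tsub_eq_zero_of_le (ENNReal.ofReal_le_ofReal (by linarith))
      rw [h2, zero_add, tsub_le_iff_right, abs_of_nonneg (by linarith)]
      refine le_trans (ENNReal.ofReal_le_ofReal (le_of_eq ?_)) ENNReal.ofReal_add_le
      ring

/-- In every case the flow has the form `l u(r x) + b`, so one statement serves all values of `p`.
The rescaled functions are reflected at a common upper bound, which places them in the setting of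
`IsSubmeanLimit`; the limits of maxima and means are then read off from the results proved there. -/
theorem IsLocalSubharmonic.tangent_means {n : ℕ} {F : Set (Matrix (Fin n) (Fin n) ℝ)}
    {u U : EuclideanSpace ℝ (Fin n) → EReal} {R c : ℝ} (h : IsLocalSubharmonic F u R c)
    {r l b : ℕ → ℝ} {V : EuclideanSpace ℝ (Fin n) → ℝ} (hr : Tendsto r atTop (𝓝[>] (0 : ℝ)))
    (hl : ∀ᶠ j in atTop, 0 < l j) (hV : LocallyIntegrable V volume)
    (hconv : ∀ R : ℝ, 0 < R →
      Tendsto (fun j => ∫⁻ x in Metric.closedBall (0 : EuclideanSpace ℝ (Fin n)) R,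
        (((l j : EReal) * u (r j • x) + b j) - (V x : EReal)).abs) atTop (𝓝 0))
    (hU : ∀ x, Tendsto (fun s : ℝ => essSup (fun y => (V y : EReal))
      (volume.restrict (Metric.closedBall x s))) (𝓝[>] (0 : ℝ)) (𝓝 (U x)))
    {m s : ℝ → ℝ} (hm : ∀ t, 0 < t → ContinuousAt m t) (hs : ∀ t, 0 < t → ContinuousAt s t)
    (hmlim : ∀ t, 0 < t → Tendsto (fun j => l j * maxFun u (r j * t) + b j) atTop (𝓝 (m t)))
    (hslim : ∀ t, 0 < t → Tendsto (fun j => l j * meanFun u R c (r j * t) + b j) atTop (𝓝 (s t)))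
    {R' : ℝ} (hR' : 0 < R') :
    ∃ c' : ℝ, HasMeans U R' c' s ∧ ∀ t ∈ Ioo 0 R', sphereMax U t = m t := by
  have := h.neZero
  obtain ⟨Ω, mΩ, ν, g, hav, -⟩ := h.cone.exists_isRotationAverage h.st
  -- A uniform bound for all late rescalings on the ball of radius `R'`. The extra one makes it
  -- strictly larger than the limiting maxima.
  set c' : ℝ := m R' + 1 with hc'
  -- discard the first indices
  have hev : ∀ᶠ j in atTop, 0 < r j ∧ 0 < l j ∧ R' < R / r j ∧
      l j * maxFun u (r j * R') + b j < c' := by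
    have h1 : ∀ᶠ j in atTop, r j ∈ Ioo 0 (R / R') := hr (Ioo_mem_nhdsGT (div_pos h.pos hR'))
    filter_upwards [h1, hl, (hmlim R' hR').eventually (gt_mem_nhds (lt_add_one (m R')))]
      with j hj1 hj2 hj3
    refine ⟨hj1.1, hj2, ?_, hj3⟩
    rw [lt_div_iff₀ hj1.1, mul_comm]
    exact (lt_div_iff₀ hR').1 hj1.2
  obtain ⟨N, hN⟩ := eventually_atTop.1 hev
  have hNj : ∀ j, _ := fun j => hN (j + N) (Nat.le_add_left N j)
  have hshift : Tendsto (fun j : ℕ => j + N) atTop atTop := tendsto_add_atTop_nat N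
  set w' : ℕ → EuclideanSpace ℝ (Fin n) → EReal := fun j x =>
    (l (j + N) : EReal) * u (r (j + N) • x) + b (j + N) with hw'
  have hresc : ∀ j, IsLocalSubharmonic F (w' j) (R / r (j + N)) (l (j + N) * c + b (j + N)) :=
    fun j => h.rescale (b (j + N)) (hNj j).1 (hNj j).2.1
  have hmaxw : ∀ j, ∀ t ∈ Ioc 0 R',
      maxFun (w' j) t = l (j + N) * maxFun u (r (j + N) * t) + b (j + N) :=
    fun j t ht => h.maxFun_rescale (b (j + N)) (hNj j).1 (hNj j).2.1
      ⟨ht.1, ht.2.trans_lt (hNj j).2.2.1⟩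
  have hloc : ∀ j, IsLocalSubharmonic F (w' j) R' c' := fun j => by
    refine (hresc j).restrict hR' (hNj j).2.2.1.le fun x hx => ?_
    refine ((hresc j).le_maxFun ⟨hR', (hNj j).2.2.1⟩ (mem_ball_zero_iff.1 hx).le).trans ?_
    rw [EReal.coe_le_coe_iff, hmaxw j R' ⟨hR', le_rfl⟩]
    exact (hNj j).2.2.2.le
  have hmeanw : ∀ j, ∀ t ∈ Ioo 0 R',
      meanFun (w' j) R' c' t = l (j + N) * meanFun u R c (r (j + N) * t) + b (j + N) := by
    intro j t ht
    rw [(hloc j).meanFun_eq (hresc j) ht ⟨ht.1, ht.2.trans (hNj j).2.2.1⟩]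
    exact meanFun_rescale (b (j + N)) (hNj j).1 (hNj j).2.1 t
  have hmaxlim : ∀ t ∈ Ioo 0 R', Tendsto (fun j => maxFun (w' j) t) atTop (𝓝 (m t)) :=
    fun t ht => ((hmlim t ht.1).comp hshift).congr fun j => (hmaxw j t ⟨ht.1, ht.2.le⟩).symm
  have hmeanlim : ∀ t ∈ Ioo 0 R',
      Tendsto (fun j => meanFun (w' j) R' c' t) atTop (𝓝 (s t)) :=
    fun t ht => ((hslim t ht.1).comp hshift).congr fun j => (hmeanw j t ht).symm
  have hmle : ∀ t ∈ Ioo 0 R', m t ≤ m R' := by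
    intro t ht
    refine le_of_tendsto_of_tendsto' ((hmlim t ht.1).comp hshift) ((hmlim R' hR').comp hshift)
      fun j => ?_
    simp only [Function.comp]
    rw [← hmaxw j t ⟨ht.1, ht.2.le⟩, ← hmaxw j R' ⟨hR', le_rfl⟩]
    exact (hresc j).isRieszConvex_maxFun.mono _ ⟨ht.1, ht.2.trans (hNj j).2.2.1⟩ _
      ⟨hR', (hNj j).2.2.1⟩ ht.2.le
  have hsm : ∀ t ∈ Ioo 0 R', s t ≤ m t := fun t ht =>
    le_of_tendsto_of_tendsto' (hmeanlim t ht) (hmaxlim t ht) fun j => (hloc j).meanFun_le_maxFun ht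
  -- the limit function
  obtain ⟨V', hV'm, hVV'⟩ := hV.aestronglyMeasurable
  set v : ℕ → EuclideanSpace ℝ (Fin n) → ENNReal := fun j =>
    coOn (Metric.ball 0 R') c' (w' j) with hv
  set w : EuclideanSpace ℝ (Fin n) → ENNReal := fun x => coFun c' (V' x : EReal) with hw
  have hwm : Measurable w := (continuous_coFun c').measurable.comp
    (measurable_coe_real_ereal.comp hV'm.measurable)
  have hvm : ∀ j, Measurable (v j) := fun j => (hloc j).lowerSemicontinuous.measurable
  have hlim : IsSubmeanLimit R' v w fun j x => (v j x - w x) + (w x - v j x) := by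
    refine ⟨hvm, hwm, fun j => ((hvm j).sub hwm).add (hwm.sub (hvm j)), fun j x _ => ?_,
      fun j x _ => ?_, ?_, fun j t ht x hx => (hloc j).ballAvg_le ht hx⟩
    · exact le_add_tsub.trans (add_le_add le_rfl le_self_add)
    · exact le_add_tsub.trans (add_le_add le_rfl le_add_self)
    · refine tendsto_of_tendsto_of_tendsto_of_le_of_le tendsto_const_nhds
        ((hconv R' hR').comp hshift) (fun _ => zero_le) fun j => ?_
      calc ∫⁻ x in Metric.ball (0 : EuclideanSpace ℝ (Fin n)) R', ((v j x - w x) + (w x - v j x))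
          ≤ ∫⁻ x in Metric.ball (0 : EuclideanSpace ℝ (Fin n)) R',
              (w' j x - (V x : EReal)).abs := by
            refine lintegral_mono_ae ?_
            filter_upwards [ae_restrict_mem measurableSet_ball, ae_restrict_of_ae hVV'] with x hx hxV
            simp only [hv, hw]
            rw [coOn_of_mem hx, ← hxV]
            exact coFun_sub_add_sub_le ((hloc j).le x hx)
        _ ≤ _ := lintegral_mono_set Metric.ball_subset_closedBall
  set wt : EuclideanSpace ℝ (Fin n) → ENNReal := fun x => coFun c' (U x) with hwt
  have hess : IsSubmeanLimit.IsEssLim w wt := by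
    intro x
    refine (((continuous_coFun c').tendsto (U x)).comp (hU x)).congr' ?_
    filter_upwards [self_mem_nhdsWithin] with t ht
    have hne : (ae ((volume : Measure (EuclideanSpace ℝ (Fin n))).restrict
        (Metric.closedBall x t))).NeBot := by
      rw [ae_neBot, Ne, Measure.restrict_eq_zero]
      exact (Metric.measure_closedBall_pos volume x ht).ne'
    have h1 : essInf w (volume.restrict (Metric.closedBall x t)) =
        essInf (fun y => coFun c' (V y : EReal)) (volume.restrict (Metric.closedBall x t)) := by
      refine essInf_congr_ae ?_
      filter_upwards [ae_restrict_of_ae hVV'] with y hy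
      rw [hw, hy]
    rw [h1]
    -- A continuous antitone map turns essential suprema into essential infima.
    exact (antitone_coFun c').map_limsup_of_continuousAt _ (continuous_coFun c').continuousAt
  have hμc : ∀ {f : ℝ → ℝ}, (∀ t, 0 < t → ContinuousAt f t) → ∀ t, 0 < t →
      ContinuousAt (fun t => ENNReal.ofReal (c' - f t)) t := fun hf t ht =>
    ENNReal.continuous_ofReal.continuousAt.comp (continuousAt_const.sub (hf t ht))
  have hofReal : ∀ {f : ℕ → ℝ} {a : ℝ}, Tendsto f atTop (𝓝 a) →
      Tendsto (fun j => ENNReal.ofReal (c' - f j)) atTop (𝓝 (ENNReal.ofReal (c' - a))) :=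
    fun hf => ENNReal.tendsto_ofReal (tendsto_const_nhds.sub hf)
  have hmu : ∀ t ∈ Ioo 0 R', ∀ x : EuclideanSpace ℝ (Fin n), ‖x‖ ≤ t →
      ENNReal.ofReal (c' - m t) ≤ wt x := by
    intro t ht x hx
    refine hlim.le_essLim hess (m := fun j t => ENNReal.ofReal (c' - maxFun (w' j) t))
      (fun j t ht y hy => ?_) (μ := fun t => ENNReal.ofReal (c' - m t))
      (fun t ht => hofReal (hmaxlim t ht)) ht (hμc hm t ht.1) hx
    simp only [hv]
    rw [coOn_of_mem (mem_ball_zero_iff.2 (hy.trans_lt ht.2)), ← coFun_coe]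
    exact antitone_coFun c' ((hloc j).le_maxFun ht hy)
  have hUle : ∀ x ∈ Metric.ball (0 : EuclideanSpace ℝ (Fin n)) R', U x ≤ c' := by
    intro x hx
    have hx := mem_ball_zero_iff.1 hx
    obtain ⟨t, ht1, ht2⟩ := exists_between hx
    have ht : t ∈ Ioo 0 R' := ⟨(norm_nonneg x).trans_lt ht1, ht2⟩
    -- Reflection truncates at zero, so `U x ≤ c'` can be recovered only from a strictly positive
    -- value; this is where the margin in `c'` is spent.
    refine (lt_of_coFun_pos (lt_of_lt_of_le ?_ (hmu t ht x ht1.le))).le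
    rw [ENNReal.ofReal_pos]
    linarith [hmle t ht]
  refine ⟨c', ⟨hlim.measurable_indicator_essLim hess, hUle, fun t ht => ?_, fun t ht => ?_⟩,
    fun t ht => le_antisymm ?_ ?_⟩
  · rw [sphMean_coOn ht]
    refine hlim.sphMean_essLim hess hav (fun j t ht y hy => (hloc j).sphMean_norm_antitone ht hy)
      (σ := fun t => ENNReal.ofReal (c' - s t)) (fun t ht => ?_) ht (hμc hs t ht.1)
    refine (hofReal (hmeanlim t ht)).congr fun j => ?_
    exact ((hloc j).hasMeans.sphMean_eq t ht).symm
  · linarith [hsm t ht, hmle t ht]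
  · refine (sphereMax_le_iff ht.1).2 fun x hx => ?_
    rw [le_iff_coFun_le (hUle x (mem_ball_zero_iff.2 (hx.trans_lt ht.2))), coFun_coe]
    exact hmu t ht x hx.le
  · obtain ⟨x, hx, hxm⟩ := hlim.exists_essLim_le hess ht
      (m := fun j => ENNReal.ofReal (c' - maxFun (w' j) t)) (fun j => by
        obtain ⟨y₀, hy₀⟩ := exists_norm_eq_of_neZero (n := n) ht.1.le
        have hsub : Metric.sphere (0 : EuclideanSpace ℝ (Fin n)) t ⊆ Metric.ball 0 R' :=
          fun y hy => mem_ball_zero_iff.2 ((mem_sphere_zero_iff_norm.1 hy).trans_lt ht.2)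
        obtain ⟨y, hy, hmax⟩ := UpperSemicontinuousOn.exists_isMaxOn
          ⟨y₀, mem_sphere_zero_iff_norm.2 hy₀⟩ (isCompact_sphere 0 t) ((hloc j).sub.usc.mono hsub)
        refine ⟨y, mem_sphere_zero_iff_norm.1 hy, ?_⟩
        simp only [hv]
        rw [coOn_of_mem (hsub hy), ← coFun_coe, ← (hloc j).sphereMax_eq ht]
        exact antitone_coFun c' ((sphereMax_le_iff ht.1).2 fun z hz =>
          hmax (mem_sphere_zero_iff_norm.2 hz))) (hofReal (hmaxlim t ht))
    refine le_trans ?_ (le_sphereMax ht.1 hx)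
    rw [le_iff_coFun_le (c := c') (EReal.coe_le_coe_iff.2 (by linarith [hmle t ht])), coFun_coe]
    exact hxm

/-! ### The tangential flow -/

lemma ereal_mul_sub {l : ℝ} (hl : 0 < l) (a : EReal) (t : ℝ) :
    (l : EReal) * (a - (t : EReal)) = (l : EReal) * a + ((-(l * t) : ℝ) : EReal) := by
  induction a with
  | bot => simp [EReal.coe_mul_bot_of_pos hl]
  | top => rw [EReal.top_sub_coe, EReal.coe_mul_top_of_pos hl, EReal.top_add_coe]
  | coe a =>
    rw [← EReal.coe_sub, ← EReal.coe_mul, ← EReal.coe_mul, ← EReal.coe_add]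
    congr 1; ring

lemma one_div_rpow_sub {r : ℝ} (hr : 0 < r) (p : ℝ) : 1 / r ^ (2 - p) = r ^ (p - 2) := by
  rw [one_div, ← Real.rpow_neg hr.le, neg_sub]

lemma ballRadial_rieszK {n : ℕ} [NeZero n] {p : ℝ} (hp : p ≤ n) (Θ a : ℝ) {r : ℝ} (hr : 0 < r) :
    Integrable (fun y => Θ * rieszK p (r * ‖y‖) + a) (ballProb n) ∧
      ballRadial n (fun t => Θ * rieszK p t + a) r = Θ * (∫ y, ‖y‖ ^ (2 - p) ∂(ballProb n)) *
        (rieszK p r - rieszK p 1) + Θ * (∫ y, rieszK p ‖y‖ ∂(ballProb n)) + a := by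
  have hκ : Integrable (fun y => ‖y‖ ^ (2 - p)) (ballProb n) :=
    integrable_norm_rpow_ballProb (by linarith)
  have hK : Integrable (fun y => rieszK p ‖y‖) (ballProb n) := integrable_rieszK_norm_ballProb hp
  have heq : (fun y : EuclideanSpace ℝ (Fin n) => Θ * (rieszK p r - rieszK p 1) * ‖y‖ ^ (2 - p) +
      Θ * rieszK p ‖y‖ + a) =ᵐ[ballProb n] fun y => Θ * rieszK p (r * ‖y‖) + a := by
    filter_upwards [ae_ballProb n] with y hy
    have h1 := rieszK_mul_sub p hr one_pos hy.1
    rw [one_mul] at h1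
    linear_combination (-Θ) * h1
  have h2 : Integrable (fun y : EuclideanSpace ℝ (Fin n) =>
      Θ * (rieszK p r - rieszK p 1) * ‖y‖ ^ (2 - p) + Θ * rieszK p ‖y‖) (ballProb n) :=
    (hκ.const_mul _).add (hK.const_mul _)
  refine ⟨(h2.add (integrable_const a)).congr heq, ?_⟩
  rw [ballRadial, ← integral_congr_ae heq, integral_add h2 (integrable_const a),
    integral_add (hκ.const_mul _) (hK.const_mul _), integral_const_mul, integral_const_mul]
  simp only [integral_const, probReal_univ, smul_eq_mul, one_mul]
  ring

lemma ballRadial_rieszK_of_ne {n : ℕ} [NeZero n] {p : ℝ} (hp : p ≤ n) (hp2 : p ≠ 2) (Θ : ℝ) {r : ℝ}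
    (hr : 0 < r) : ballRadial n (fun t => Θ * rieszK p t + 0) r =
      Θ * (∫ y, ‖y‖ ^ (2 - p) ∂(ballProb n)) * rieszK p r := by
  rw [(ballRadial_rieszK hp Θ 0 hr).2]
  have h1 : ∫ y, rieszK p ‖y‖ ∂(ballProb n) =
      ∫ y, ‖y‖ ^ (2 - p) * rieszK p 1 ∂(ballProb n) := by
    refine integral_congr_ae ?_
    filter_upwards [ae_ballProb n] with y hy
    have := rieszK_mul hp2 hy.1 one_pos
    rwa [mul_one] at this
  rw [h1, integral_mul_const]
  ring

lemma ballRadial_log {n : ℕ} [NeZero n] (hn : (2 : ℝ) ≤ n) (Θ a : ℝ) {r : ℝ} (hr : 0 < r) :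
    ballRadial n (fun t => Θ * rieszK 2 t + a) r = Θ * Real.log r + (a - Θ / n) := by
  rw [(ballRadial_rieszK hn Θ a hr).2, rieszK_two, integral_log_norm_ballProb]
  simp only [sub_self, Real.rpow_zero, integral_const, probReal_univ, smul_eq_mul, Real.log_one]
  ring

namespace IsLocalSubharmonic

variable {n : ℕ} {F : Set (Matrix (Fin n) (Fin n) ℝ)} {u U : EuclideanSpace ℝ (Fin n) → EReal}
  {R c Θ ΘM ΘS : ℝ}

lemma rieszChar_le (h : IsLocalSubharmonic F u R c) : rieszChar F ≤ n :=
  h.cone.rieszChar_le h.conv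

lemma hasDensity_ballMean (h : IsLocalSubharmonic F u R c)
    (hΘ : HasRealDensity (rieszChar F) (meanFun u R c) Θ) :
    HasDensity (rieszChar F) (ballMean u)
      (Θ * ∫ y, ‖y‖ ^ (2 - rieszChar F) ∂(ballProb n)) := by
  have := h.neZero
  obtain ⟨Ω, mΩ, ν, g, hav, -⟩ := h.cone.exists_isRotationAverage h.st
  obtain ⟨hd, δ, hδ, hint⟩ := hΘ.ballRadial h.rieszChar_le h.measurable_meanFun
  exact hd.hasDensity (lt_min hδ h.pos) fun r hr => h.hasMeans.ballMean_eq hav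
    ⟨hr.1, hr.2.trans_le (min_le_right _ _)⟩
    (hint r ⟨hr.1, hr.2.trans_le (min_le_left _ _)⟩)

lemma tendsto_comp_nhdsGT {f : ℝ → ℝ} {a : ℝ} {r : ℕ → ℝ} (hf : Tendsto f (𝓝[>] (0 : ℝ)) (𝓝 a))
    (hr : Tendsto r atTop (𝓝[>] (0 : ℝ))) : Tendsto (fun j => f (r j)) atTop (𝓝 a) := hf.comp hr

lemma continuousAt_mul_rieszK (p Θ a : ℝ) {t : ℝ} (ht : 0 < t) :
    ContinuousAt (fun t => Θ * rieszK p t + a) t :=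
  ((hasDerivAt_rieszK p ht).continuousAt.const_mul Θ).add_const a

/-- The flow multiplies by `r^(p-2)` in both cases. Its additive term is `-r^(p-2) u 0` for `p < 2`,
where `u 0` is finite, and zero for `p > 2`. -/
theorem tangent_of_ne_two (h : IsLocalSubharmonic F u R c) (hp : rieszChar F ≠ 2)
    (hM : HasRealDensity (rieszChar F) (maxFun u) ΘM)
    (hS : HasRealDensity (rieszChar F) (meanFun u R c) ΘS)
    (hU : IsTangent (rieszChar F) u U) {R' : ℝ} (hR' : 0 < R') :
    ∃ c' : ℝ, HasMeans U R' c' (fun t => ΘS * rieszK (rieszChar F) t + 0) ∧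
      ∀ t ∈ Ioo 0 R', sphereMax U t = ((ΘM * rieszK (rieszChar F) t + 0 : ℝ) : EReal) := by
  obtain ⟨r, V, hr, hV, hconv, hess⟩ := hU
  set p := rieszChar F with hpdef
  have hrpos : ∀ᶠ j in atTop, 0 < r j := hr self_mem_nhdsWithin
  have hlpos : ∀ᶠ j in atTop, 0 < r j ^ (p - 2) := hrpos.mono fun j hj => Real.rpow_pos_of_pos hj _
  obtain ⟨b, hb, hMl, hSl⟩ : ∃ b : ℕ → ℝ,
      (∀ᶠ j in atTop, ∀ x : EuclideanSpace ℝ (Fin n),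
        flow p u (r j) x = ((r j ^ (p - 2) : ℝ) : EReal) * u (r j • x) + b j) ∧
      (∀ t, 0 < t → Tendsto (fun j => r j ^ (p - 2) * maxFun u (r j * t) + b j) atTop
        (𝓝 (ΘM * rieszK p t + 0))) ∧
      (∀ t, 0 < t → Tendsto (fun j => r j ^ (p - 2) * meanFun u R c (r j * t) + b j) atTop
        (𝓝 (ΘS * rieszK p t + 0))) := by
    rcases lt_or_gt_of_ne hp with hp2 | hp2
    · obtain ⟨a, ha, hMa, hSa⟩ := h.exists_eq_zero_of_lt_two hp2
      refine ⟨fun j => -(r j ^ (p - 2) * a), ?_, fun t ht => ?_, fun t ht => ?_⟩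
      · filter_upwards [hrpos, hlpos] with j hj hlj x
        rw [flow, if_pos hp2, ha, one_div_rpow_sub hj, ereal_mul_sub hlj]
      · rw [add_zero]
        refine (tendsto_comp_nhdsGT (hM.tendsto_of_lt hp2 hMa ht) hr).congr fun j => ?_
        ring
      · rw [add_zero]
        refine (tendsto_comp_nhdsGT (hS.tendsto_of_lt hp2 hSa ht) hr).congr fun j => ?_
        ring
    · refine ⟨fun _ => 0, ?_, fun t ht => ?_, fun t ht => ?_⟩
      · filter_upwards with j x
        rw [flow, if_neg (not_lt.2 hp2.le), if_neg hp2.ne']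
        simp
      · simp only [add_zero]
        exact tendsto_comp_nhdsGT (hM.tendsto_of_gt hp2 ht) hr
      · simp only [add_zero]
        exact tendsto_comp_nhdsGT (hS.tendsto_of_gt hp2 ht) hr
  refine h.tangent_means hr hlpos hV (fun R₁ hR₁ => ?_) hess
    (fun t ht => continuousAt_mul_rieszK p ΘM 0 ht)
    (fun t ht => continuousAt_mul_rieszK p ΘS 0 ht) hMl hSl hR'
  refine (hconv R₁ hR₁).congr' ?_
  filter_upwards [hb] with j hj
  exact lintegral_congr fun x => by rw [hj x]

/-! ### The logarithmic case -/

lemma exp_neg_one_lt_one : 1 / Real.exp 1 < 1 := by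
  rw [div_lt_one (Real.exp_pos 1)]
  exact Real.one_lt_exp_iff.2 one_pos

lemma harnackφ_exp_pos (n : ℕ) : 0 < harnackφ n (1 / Real.exp 1) :=
  harnackφ_pos (by positivity) exp_neg_one_lt_one

lemma one_lt_harnackC (n : ℕ) [NeZero n] : 1 < harnackC n := by
  rw [harnackC, lt_div_iff₀ (harnackφ_exp_pos n), one_mul, harnackφ]
  have h0 : 0 < 1 / Real.exp 1 := by positivity
  have hn : (0 : ℤ) ≤ (n : ℤ) - 1 := by
    have := Nat.pos_of_ne_zero (NeZero.ne n)
    omega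
  rw [div_lt_one (zpow_pos (by linarith) _)]
  have := one_le_zpow₀ (by linarith : 1 ≤ 1 + 1 / Real.exp 1) hn
  linarith

/-- Harnack's inequality for the ball of radius `r`, maximized over the sphere of radius `r/e`. -/
lemma harnackφ_mul_sub_le (h : IsLocalSubharmonic F u R c) {r : ℝ} (hr : r ∈ Ioo 0 R) :
    harnackφ n (1 / Real.exp 1) * (maxFun u r - meanFun u R c r) ≤
      maxFun u r - maxFun u (r * (1 / Real.exp 1)) := by
  have := h.neZero
  have hl : 0 < 1 / Real.exp 1 := by positivity
  have hr' : r * (1 / Real.exp 1) ∈ Ioo 0 R :=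
    ⟨mul_pos hr.1 hl, by nlinarith [hr.1, hr.2, exp_neg_one_lt_one]⟩
  have h1 : maxFun u (r * (1 / Real.exp 1)) ≤
      maxFun u r - harnackφ n (1 / Real.exp 1) * (maxFun u r - meanFun u R c r) := by
    rw [← EReal.coe_le_coe_iff, ← h.sphereMax_eq hr', sphereMax_le_iff hr'.1]
    intro x hx
    have hx' : ‖r⁻¹ • x‖ = 1 / Real.exp 1 := by
      rw [norm_smul, Real.norm_of_nonneg (inv_nonneg.2 hr.1.le), hx, inv_mul_cancel_left₀ hr.1.ne']
    have h2 := h.maxFun_mul_le hr (x := r⁻¹ • x) (by rw [hx']; exact exp_neg_one_lt_one)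
    rwa [smul_smul, mul_inv_cancel₀ hr.1.ne', one_smul, hx'] at h2
  linarith

lemma tendsto_sub_log {ψ : ℝ → ℝ} (hψ : HasRealDensity 2 ψ Θ) {t : ℝ} (ht : 0 < t) :
    Tendsto (fun r => ψ (r * t) - ψ r) (𝓝[>] (0 : ℝ)) (𝓝 (Θ * Real.log t)) := by
  have h1 := hψ.tendsto_sub ht one_pos
  simp only [sub_self, Real.rpow_zero, one_mul, mul_one] at h1
  rwa [rieszK_two, Real.log_one, sub_zero] at h1

/-- The ratio `1/e` is chosen because its logarithm is `-1`, so the limit is the density itself. -/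
lemma tendsto_maxFun_sub (hM : HasRealDensity 2 (maxFun u) Θ) :
    Tendsto (fun r => maxFun u r - maxFun u (r * (1 / Real.exp 1))) (𝓝[>] (0 : ℝ)) (𝓝 Θ) := by
  have h1 := (tendsto_sub_log hM (t := 1 / Real.exp 1) (by positivity)).neg
  rw [one_div, Real.log_inv, Real.log_exp, mul_neg, mul_one, neg_neg] at h1
  simpa only [neg_sub, one_div] using h1

lemma exists_gap_le (h : IsLocalSubharmonic F u R c) (hM : HasRealDensity 2 (maxFun u) Θ) :
    ∃ B : ℝ, ∀ᶠ r in 𝓝[>] (0 : ℝ), maxFun u r - meanFun u R c r ∈ Icc 0 B := by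
  have hφ := harnackφ_exp_pos n
  refine ⟨(Θ + 1) / harnackφ n (1 / Real.exp 1), ?_⟩
  filter_upwards [(tendsto_maxFun_sub hM).eventually (gt_mem_nhds (lt_add_one Θ)),
    Ioo_mem_nhdsGT h.pos] with r hr1 hr2
  refine ⟨sub_nonneg.2 (h.meanFun_le_maxFun hr2), ?_⟩
  rw [le_div_iff₀ hφ, mul_comm]
  exact (h.harnackφ_mul_sub_le hr2).trans hr1.le

/-- If `p = 2`, the maxima and the means have the same density. -/
lemma density_max_eq_mean (h : IsLocalSubharmonic F u R c) (hM : HasRealDensity 2 (maxFun u) ΘM)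
    (hS : HasRealDensity 2 (meanFun u R c) ΘS) : ΘM = ΘS := by
  obtain ⟨B, hB⟩ := h.exists_gap_le hM
  -- The difference of the blow-up limits of `M` and `S` is a difference of two gaps, each in `[0,
  -- B]`, whatever the scale `t`.
  have key : ∀ t : ℝ, 0 < t → (ΘM - ΘS) * Real.log t ≤ B := by
    intro t ht
    have h1 := (tendsto_sub_log hM ht).sub (tendsto_sub_log hS ht)
    rw [← sub_mul] at h1
    refine le_of_tendsto h1 ?_
    have hBt : ∀ᶠ r in 𝓝[>] (0 : ℝ), maxFun u (r * t) - meanFun u R c (r * t) ∈ Icc 0 B := by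
      have h2 : Tendsto (fun r : ℝ => r * t) (𝓝[>] (0 : ℝ)) (𝓝[>] (0 : ℝ)) := by
        refine tendsto_nhdsWithin_iff.2 ⟨?_, ?_⟩
        · have : Tendsto (fun r : ℝ => r * t) (𝓝 0) (𝓝 (0 * t)) := tendsto_id.mul_const t
          rw [zero_mul] at this
          exact this.mono_left nhdsWithin_le_nhds
        · filter_upwards [self_mem_nhdsWithin] with r hr using mul_pos hr ht
      exact h2.eventually hB
    filter_upwards [hB, hBt] with r hr hrt
    linarith [hr.1, hrt.2]
  by_contra hne
  -- If the densities differed, this `t` would make the left side equal to `B + 1`.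
  have h1 := key (Real.exp ((B + 1) / (ΘM - ΘS))) (Real.exp_pos _)
  rw [Real.log_exp, mul_div_cancel₀ _ (sub_ne_zero.2 hne)] at h1
  linarith

/-- Normalizing by the maximum makes the limiting maxima `Θ log t` exactly, but the means are
shifted by `S - M` along the blow-up radii. Harnack's inequality bounds that shift and gives the
constant `C` in the limit. -/
theorem tangent_of_eq_two (h : IsLocalSubharmonic F u R c)
    (hM : HasRealDensity 2 (maxFun u) Θ) (hS : HasRealDensity 2 (meanFun u R c) Θ)
    (hU : IsTangent 2 u U) :
    ∃ a : ℝ, -(harnackC n * Θ) ≤ a ∧ a ≤ 0 ∧ ∀ R' : ℝ, 0 < R' →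
      ∃ c' : ℝ, HasMeans U R' c' (fun t => Θ * rieszK 2 t + a) ∧
        ∀ t ∈ Ioo 0 R', sphereMax U t = ((Θ * rieszK 2 t + 0 : ℝ) : EReal) := by
  obtain ⟨r, V, hr, hV, hconv, hess⟩ := hU
  obtain ⟨B, hB⟩ := h.exists_gap_le hM
  -- The gap need not converge along `r`, so a subsequence is taken; the tangent `U` is unchanged.
  -- Extraction precedes the choice of `R'`, so one constant serves all radii.
  obtain ⟨a', ha', k, hk, hlim⟩ := isCompact_Icc.tendsto_subseq' (hr.eventually hB).frequently
  have hrk : Tendsto (fun j => r (k j)) atTop (𝓝[>] (0 : ℝ)) := hr.comp hk.tendsto_atTop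
  have hφ := harnackφ_exp_pos n
  have ha'Θ : harnackφ n (1 / Real.exp 1) * a' ≤ Θ := by
    refine le_of_tendsto_of_tendsto (hlim.const_mul _)
      (tendsto_comp_nhdsGT (tendsto_maxFun_sub hM) hrk) ?_
    filter_upwards [hrk (Ioo_mem_nhdsGT h.pos)] with j hj
    exact h.harnackφ_mul_sub_le hj
  refine ⟨-a', ?_, by linarith [ha'.1], fun R' hR' => ?_⟩
  · rw [harnackC, neg_le_neg_iff, div_mul_eq_mul_div, one_mul, le_div_iff₀ hφ, mul_comm]
    exact ha'Θ
  refine h.tangent_means (l := fun _ => 1) (b := fun j => -maxFun u (r (k j))) hrk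
    (Eventually.of_forall fun _ => one_pos) hV (fun R₁ hR₁ => ?_) hess
    (fun t ht => continuousAt_mul_rieszK 2 Θ 0 ht)
    (fun t ht => continuousAt_mul_rieszK 2 Θ (-a') ht) (fun t ht => ?_) (fun t ht => ?_) hR'
  · refine ((hconv R₁ hR₁).comp hk.tendsto_atTop).congr' ?_
    filter_upwards [hrk (Ioo_mem_nhdsGT h.pos)] with j hj
    refine lintegral_congr fun x => ?_
    rw [flow, if_neg (lt_irrefl _), if_pos rfl, h.sphereMax_eq hj, EReal.coe_one, one_mul, EReal.coe_neg,
      ← sub_eq_add_neg]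
  · rw [rieszK_two, add_zero]
    refine (tendsto_comp_nhdsGT (tendsto_sub_log hM ht) hrk).congr fun j => ?_
    ring
  · rw [rieszK_two]
    refine ((tendsto_comp_nhdsGT (tendsto_sub_log hS ht) hrk).add hlim.neg).congr fun j => ?_
    simp only [Function.comp]
    ring

end IsLocalSubharmonic

end Tangents

/-! ### The theorem -/

open Tangents

theorem theorem10p1 {n : ℕ} (F : Set (Matrix (Fin n) (Fin n) ℝ))
    (hF : Tangents.IsConeSubequation F) (hST : Tangents.IsSTInvariant F) (hconv : Convex ℝ F)
    (X : Set (EuclideanSpace ℝ (Fin n))) (hX : IsOpen X) (h0 : (0 : EuclideanSpace ℝ (Fin n)) ∈ X)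
    (u : EuclideanSpace ℝ (Fin n) → EReal) (hu : Tangents.IsSubharmonicOn F u X)
    (hu_bot : ¬ ∀ᶠ x in 𝓝 (0 : EuclideanSpace ℝ (Fin n)), u x = ⊥)
    (p : ℝ) (hp : p = Tangents.rieszChar F) :
    (p ≠ 2 →
      ∃ ΘM ΘS ΘV : ℝ,
        Tangents.HasDensity p (Tangents.sphereMax u) ΘM ∧
        Tangents.HasDensity p (Tangents.sphereMean u) ΘS ∧
        Tangents.HasDensity p (Tangents.ballMean u) ΘV ∧
        ∀ U : EuclideanSpace ℝ (Fin n) → EReal, Tangents.IsTangent p u U →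
          (∀ r : ℝ, 0 < r →
            Tangents.sphereMax U r = ((ΘM * Tangents.rieszK p r : ℝ) : EReal) ∧
            Tangents.sphereMean U r = ((ΘS * Tangents.rieszK p r : ℝ) : EReal) ∧
            Tangents.ballMean U r = ((ΘV * Tangents.rieszK p r : ℝ) : EReal)) ∧
          Tangents.HasDensity p (Tangents.sphereMax U) ΘM ∧
          Tangents.HasDensity p (Tangents.sphereMean U) ΘS ∧
          Tangents.HasDensity p (Tangents.ballMean U) ΘV) ∧
    (p = 2 →
      ∃ Θ : ℝ,
        Tangents.HasDensity p (Tangents.sphereMax u) Θ ∧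
        Tangents.HasDensity p (Tangents.sphereMean u) Θ ∧
        Tangents.HasDensity p (Tangents.ballMean u) Θ ∧
        1 < Tangents.harnackC n ∧
        ∀ U : EuclideanSpace ℝ (Fin n) → EReal, Tangents.IsTangent p u U →
          Tangents.HasDensity p (Tangents.sphereMax U) Θ ∧
          Tangents.HasDensity p (Tangents.sphereMean U) Θ ∧
          Tangents.HasDensity p (Tangents.ballMean U) Θ ∧
          ∃ a b : ℝ,
            Tangents.sphereMean U 1 = (a : EReal) ∧
            Tangents.ballMean U 1 = (b : EReal) ∧
            (∀ r : ℝ, 0 < r →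
              Tangents.sphereMax U r = ((Θ * Real.log r : ℝ) : EReal) ∧
              Tangents.sphereMean U r = ((Θ * Real.log r + a : ℝ) : EReal) ∧
              Tangents.ballMean U r = ((Θ * Real.log r + b : ℝ) : EReal)) ∧
            -(Tangents.harnackC n * Θ) ≤ a ∧ a ≤ 0 ∧
            -((Tangents.harnackC n + 1) * Θ) ≤ b) := by
  obtain ⟨R, c, h⟩ := hu.exists_isLocalSubharmonic hF hST hconv hX h0 hu_bot
  have := h.neZero
  obtain ⟨Ω, mΩ, ν, g, hav, -⟩ := hF.exists_isRotationAverage hST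
  obtain ⟨ΘM, hΘM, hM⟩ := h.isRieszConvex_maxFun.exists_hasRealDensity h.pos
  obtain ⟨ΘS, hΘS, hS⟩ := h.isRieszConvex_meanFun.exists_hasRealDensity h.pos
  have hdM := hM.hasDensity h.pos fun r hr => h.sphereMax_eq hr
  have hdS := hS.hasDensity h.pos fun r hr => h.sphereMean_eq hr
  have hdV := h.hasDensity_ballMean hS
  have hpn := h.rieszChar_le
  rw [← hp] at hM hS hdM hdS hdV hpn
  refine ⟨fun hp2 => ?_, fun hp2 => ?_⟩
  · refine ⟨ΘM, ΘS, _, hdM, hdS, hdV, fun U hU => ?_⟩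
    have key : ∀ r : ℝ, 0 < r →
        sphereMax U r = ((ΘM * rieszK p r : ℝ) : EReal) ∧
        sphereMean U r = ((ΘS * rieszK p r : ℝ) : EReal) ∧
        ballMean U r = ((ΘS * (∫ y, ‖y‖ ^ (2 - p) ∂(ballProb n)) * rieszK p r : ℝ) : EReal) := by
      intro r hr
      have hr1 : r ∈ Ioo 0 (r + 1) := ⟨hr, by linarith⟩
      subst hp
      -- The transfer to `U` works on bounded balls; any radius beyond `r` will do.
      obtain ⟨c', hmeans, hmax⟩ := h.tangent_of_ne_two hp2 hM hS hU (R' := r + 1) (by linarith)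
      refine ⟨?_, ?_, ?_⟩
      · rw [hmax r hr1, add_zero]
      · rw [hmeans.sphereMean_eq hr1, add_zero]
      · rw [hmeans.ballMean_eq hav hr1 (ballRadial_rieszK hpn ΘS 0 hr).1,
          ballRadial_rieszK_of_ne hpn hp2 ΘS hr]
    refine ⟨key, ?_, ?_, ?_⟩
    · exact (hasRealDensity_of_eq (c := 0) one_pos fun r _ => (add_zero _).symm).hasDensity one_pos
        fun r hr => (key r hr.1).1
    · exact (hasRealDensity_of_eq (c := 0) one_pos fun r _ => (add_zero _).symm).hasDensity one_pos
        fun r hr => (key r hr.1).2.1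
    · exact (hasRealDensity_of_eq (c := 0) one_pos fun r _ => (add_zero _).symm).hasDensity one_pos
        fun r hr => (key r hr.1).2.2
  · rw [hp2] at hM hS hdM hdS hdV hpn ⊢
    have hΘ := h.density_max_eq_mean hM hS
    rw [← hΘ] at hS hdS hdV
    rw [sub_self] at hdV
    simp only [Real.rpow_zero, integral_const, probReal_univ, smul_eq_mul, mul_one] at hdV
    refine ⟨ΘM, hdM, hdS, hdV, IsLocalSubharmonic.one_lt_harnackC n, fun U hU => ?_⟩
    obtain ⟨a, ha1, ha2, ha⟩ := h.tangent_of_eq_two hM hS hU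
    have key : ∀ r : ℝ, 0 < r →
        sphereMax U r = ((ΘM * Real.log r : ℝ) : EReal) ∧
        sphereMean U r = ((ΘM * Real.log r + a : ℝ) : EReal) ∧
        ballMean U r = ((ΘM * Real.log r + (a - ΘM / n) : ℝ) : EReal) := by
      intro r hr
      have hr1 : r ∈ Ioo 0 (r + 1) := ⟨hr, by linarith⟩
      obtain ⟨c', hmeans, hmax⟩ := ha (r + 1) (by linarith)
      refine ⟨?_, ?_, ?_⟩
      · rw [hmax r hr1, add_zero, rieszK_two]
      · rw [hmeans.sphereMean_eq hr1, rieszK_two]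
      · rw [hmeans.ballMean_eq hav hr1 (ballRadial_rieszK hpn ΘM a hr).1,
          ballRadial_log hpn ΘM a hr]
    have hlog : ∀ r : ℝ, rieszK 2 r = Real.log r := fun r => by rw [rieszK_two]
    -- At `r = 1` the logarithm vanishes, which identifies the constants `a` and `a - ΘM / n` as the
    -- averages of `U` over the unit sphere and the unit ball.
    have k1 := key 1 one_pos
    simp only [Real.log_one, mul_zero, zero_add] at k1
    refine ⟨?_, ?_, ?_, a, a - ΘM / n, k1.2.1, k1.2.2, key, ha1, ha2, ?_⟩
    · exact (hasRealDensity_of_eq (c := 0) one_pos fun r _ => by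
        rw [hlog, add_zero]).hasDensity one_pos fun r hr => (key r hr.1).1
    · exact (hasRealDensity_of_eq one_pos fun r _ => by
        rw [hlog]).hasDensity one_pos fun r hr => (key r hr.1).2.1
    · exact (hasRealDensity_of_eq one_pos fun r _ => by
        rw [hlog]).hasDensity one_pos fun r hr => (key r hr.1).2.2
    -- Since `ΘM ≥ 0`, the shift `ΘM / n` costs at most one further `ΘM` beyond the lower bound for
    -- `a`.
    · have hn : (1 : ℝ) ≤ n := by linarith
      have : ΘM / n ≤ ΘM := div_le_self hΘM hn
      linarith
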